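/- Let $\mathbb H_{\mathbb C}=\mathbb C\otimes_{\mathbb R}\mathbb H$, identified with the algebra of complex $2\times 2$ matrices $Z=(z_{ij})$, and $N(Z)=\det Z$. Let $Ш'=Ш=\mathbb C[z_{11},z_{12},z_{21},z_{22},N(Z)^{-1}]$ be the space of polynomial functions on the invertible elements of $\mathbb H_{\mathbb C}$. Let the Lie algebra $\mathfrak{gl}(2,\mathbb H_{\mathbb C})$ act on $Ш'$ by $\rho'$ and on $Ш$ by $\rho$, the differentials of $$(\rho'(h)f)(Z)=f\bigl((aZ+b)(cZ+d)^{-1}\bigr),\qquad (\rho(h)f)(Z)=\frac{f\bigl((aZ+b)(cZ+d)^{-1}\bigr)}{N(cZ+d)^2\,N(a'-Zc')^2},$$ where $h=\begin{pmatrix}a'&b'\\c'&d'\end{pmatrix}$ and $h^{-1}=\begin{pmatrix}a&b\\c&d\end{pmatrix}$; explicitly, for $X=\begin{pmatrix}A&B\\C&D\end{pmatrix}$ and $\partial=\begin{pmatrix}\partial_{11}&\partial_{21}\\\partial_{12}&\partial_{22}\end{pmatrix}$, where $\partial_{ij}=\partial/\partial z_{ij}$, $\rho'(X)f=\operatorname{Tr}\bigl((ZCZ+ZD-AZ-B)\partial\bigr)f$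 and $\rho(X)f=\rho'(X)f+\operatorname{Tr}(4CZ+2D-2A)f$. For $l\in\{0,\tfrac12,1,\dots\}$ and $m,n\in\{-l,-l+1,\dots,l\}$ put $$t^l_{n\,\underline m}(Z)=\frac1{2\pi i}\oint (sz_{11}+z_{21})^{l-m}(sz_{12}+z_{22})^{l+m}s^{-l+n}\frac{ds}{s},$$ the integral being over a loop going once counterclockwise around the origin. For a condition $P$ on $k\in\mathbb Z$ and $l$ let $\langle P\rangle$ denote the $\mathbb C$-span of all $N(Z)^k\,t^l_{n\,\underline m}(Z)$ for which $(k,l)$ satisfies $P$ ($m,n$ arbitrary). **Theorem.** In $(\rho',Ш')$ the subspaces $$\mathcal I'_0=\mathbb C=\langle k=l=0\rangle,\quad \mathcal{BH}^+=\langle 0\le k\le 1\rangle,\quad \mathcal{BH}^-=\langle -1\le 2l+k\le 0\rangle,\quad Ш^+=\langle k\ge 0\rangle,\quad Ш'^-=\langle k\le -2l\rangle,$$ $$\mathcal I'^+=\langle k\ge -(2l+1)\rangle,\quad \mathcal I'^-=\langle k\le 1\rangle,\quad \mathcal J'=\langle -(2l+1)\le k\le 1\rangle$$ are $\mathfrak{gl}(2,\mathbb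 H_{\mathbb C})$-invariant, nonzero and different from $Ш'$, and every invariant subspace other than $0$ and $Ш'$ is a sum of some of them. The irreducible components (composition factors, each occurring exactly once) of $(\rho',Ш')$ are the six irreducible modules: the trivial one-dimensional subrepresentation $\mathcal I'_0$, and the quotients $$\mathcal{BH}^+/\mathcal I'_0,\quad \mathcal{BH}^- /\mathcal I'_0,\quad Ш^+/\mathcal{BH}^+\simeq Ш'/\mathcal I'^-,\quad Ш'^- /\mathcal{BH}^-\simeq Ш'/\mathcal I'^+,$$ $$\mathcal J'/(\mathcal{BH}^++\mathcal{BH}^-)\simeq \mathcal I'^+/(Ш^++\mathcal{BH}^-)\simeq \mathcal I'^- /(Ш'^-+\mathcal{BH}^+)\simeq Ш'/(Ш^++Ш'^-),$$ where all the isomorphisms are induced by the inclusions of the numerators. **Corollary.** Let $\square=4(\partial_{11}\partial_{22}-\partial_{12}\partial_{21})$. The map $\square\circ\square:(\rho',Ш')\to(\rho,Ш)$ is $\mathfrak{gl}(2,\mathbb H_{\mathbb C})$-equivariant. Its image is $Ш^+\oplus\mathcal J\oplus Ш^-$, where $Ш^+=\langle k\ge0\rangle$, $\mathcal J=\langle -(2l+1)\le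 k\le -3\rangle$ and $Ш^-=\langle k\le -(2l+4)\rangle$ are invariant subspaces of $(\rho,Ш)$, and it induces isomorphisms of $\mathfrak{gl}(2,\mathbb H_{\mathbb C})$-modules $$(\rho',Ш^+/\mathcal{BH}^+)\simeq(\rho,Ш^+),\qquad (\rho',\mathcal J'/(\mathcal{BH}^++\mathcal{BH}^-))\simeq(\rho,\mathcal J),\qquad (\rho',Ш'^- /\mathcal{BH}^-)\simeq(\rho,Ш^-).$$ -/

import Mathlib

namespace QuatConf

noncomputable section

/-- The algebra of complexified quaternions, identified with complex 2 x 2 matrices. -/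
abbrev HC : Type := Matrix (Fin 2) (Fin 2) ℂ

/-- The standard units `e₀, e₁, e₂, e₃` of the quaternions as complex matrices. -/
def quatUnit : Fin 4 → HC :=
  ![!![1, 0; 0, 1],
    !![0, -Complex.I; -Complex.I, 0],
    !![0, -1; 1, 0],
    !![-Complex.I, 0; 0, Complex.I]]

/-- The Lie algebra of 2 x 2 matrices over the complexified quaternions, with the commutator
bracket. The entries of `X` are written `A = X 0 0`, `B = X 0 1`, `C = X 1 0`, `D = X 1 1`. -/
abbrev GlHC : Type := Matrix (Fin 2) (Fin 2) HC

instance : LieRing GlHC := LieRing.ofAssociativeRing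

instance : LieAlgebra ℂ GlHC := LieAlgebra.ofAssociativeAlgebra

/-- The norm `N(Z) = det Z` as a polynomial in the four entries of `Z`. -/
def normPoly : MvPolynomial (Fin 2 × Fin 2) ℂ :=
  MvPolynomial.X (0, 0) * MvPolynomial.X (1, 1) - MvPolynomial.X (0, 1) * MvPolynomial.X (1, 0)

/-- Polynomial functions on the invertible elements of `HC`: the ring
`ℂ[z₁₁, z₁₂, z₂₁, z₂₂, N(Z)⁻¹]`. -/
abbrev Laurent : Type := Localization.Away normPoly

/-- The coordinate matrix `Z`, with entries `z i j`. -/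
def coord : Matrix (Fin 2) (Fin 2) Laurent :=
  Matrix.of fun i j => algebraMap (MvPolynomial (Fin 2 × Fin 2) ℂ) Laurent (MvPolynomial.X (i, j))

/-- `N(Z)` as a unit of the ring of polynomial functions. -/
def normUnit : Laurentˣ :=
  (IsLocalization.Away.algebraMap_isUnit (S := Laurent) normPoly).unit

lemma normUnit_eq : (normUnit : Laurent) = coord.det := by
  rw [Matrix.det_fin_two]
  simp [normUnit, coord, normPoly]

/-! Derivations -/

/-- The substitution `f ↦ f (Z + ε V)` over the dual numbers, on polynomials. -/
def dualPoly (V : Matrix (Fin 2) (Fin 2) Laurent) :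
    MvPolynomial (Fin 2 × Fin 2) ℂ →ₐ[ℂ] DualNumber Laurent :=
  MvPolynomial.aeval fun p =>
    (TrivSqZeroExt.inl (coord p.1 p.2) + TrivSqZeroExt.inr (V p.1 p.2) : DualNumber Laurent)

lemma fst_dualPoly (V : Matrix (Fin 2) (Fin 2) Laurent) (p : MvPolynomial (Fin 2 × Fin 2) ℂ) :
    (dualPoly V p).fst = algebraMap _ Laurent p := by
  have h : (TrivSqZeroExt.fstHom ℂ Laurent Laurent).comp (dualPoly V) =
      IsScalarTower.toAlgHom ℂ (MvPolynomial (Fin 2 × Fin 2) ℂ) Laurent := by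
    ext i
    simp [dualPoly, coord]
  simpa using DFunLike.congr_fun h p

lemma isUnit_dualPoly (V : Matrix (Fin 2) (Fin 2) Laurent) (y : Submonoid.powers normPoly) :
    IsUnit (dualPoly V y) := by
  rw [TrivSqZeroExt.isUnit_iff_isUnit_fst, fst_dualPoly]
  exact IsLocalization.map_units Laurent y

/-- The substitution `f ↦ f (Z + ε V)` over the dual numbers. -/
def dualHom (V : Matrix (Fin 2) (Fin 2) Laurent) : Laurent →ₐ[ℂ] DualNumber Laurent :=
  IsLocalization.liftAlgHom (M := Submonoid.powers normPoly) (f := dualPoly V) (isUnit_dualPoly V)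

lemma dualHom_algebraMap (V : Matrix (Fin 2) (Fin 2) Laurent)
    (p : MvPolynomial (Fin 2 × Fin 2) ℂ) :
    dualHom V (algebraMap _ Laurent p) = dualPoly V p := by
  simp [dualHom]

lemma fst_dualHom (V : Matrix (Fin 2) (Fin 2) Laurent) (f : Laurent) :
    (dualHom V f).fst = f := by
  have h : (TrivSqZeroExt.fstHom ℂ Laurent Laurent).comp (dualHom V) = AlgHom.id ℂ Laurent := by
    apply IsLocalization.algHom_ext (Submonoid.powers normPoly)
    ext i
    change (dualHom V (algebraMap _ Laurent (MvPolynomial.X i))).fst =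
      algebraMap _ Laurent (MvPolynomial.X i)
    rw [dualHom_algebraMap, fst_dualPoly]
  exact DFunLike.congr_fun h f

/-- The derivation of the ring of polynomial functions along the vector field `V`: the coefficient
of `ε` in `f (Z + ε V)`. It is the operator `∑ V i j * ∂ / ∂ z i j = Tr (V ∂)`. -/
def derivAlong (V : Matrix (Fin 2) (Fin 2) Laurent) : Derivation ℂ Laurent Laurent :=
  Derivation.mk'
    { toFun := fun f => (dualHom V f).snd
      map_add' := fun f g => by simp
      map_smul' := fun c f => by simp }
    (fun f g => by simp [fst_dualHom, mul_comm])

lemma derivAlong_coord (V : Matrix (Fin 2) (Fin 2) Laurent) (i j : Fin 2) :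
    derivAlong V (coord i j) = V i j := by
  have h : dualHom V (coord i j) = dualPoly V (MvPolynomial.X (i, j)) :=
    dualHom_algebraMap V (MvPolynomial.X (i, j))
  have h2 : derivAlong V (coord i j) = (dualHom V (coord i j)).snd := rfl
  rw [h2, h, dualPoly, MvPolynomial.aeval_X]
  simp

lemma derivation_ext {D₁ D₂ : Derivation ℂ Laurent Laurent}
    (h : ∀ i j, D₁ (coord i j) = D₂ (coord i j)) : D₁ = D₂ := by
  have h1 : ∀ p : MvPolynomial (Fin 2 × Fin 2) ℂ,
      D₁ (algebraMap _ Laurent p) = D₂ (algebraMap _ Laurent p) := by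
    intro p
    induction p using MvPolynomial.induction_on with
    | C a =>
      have : algebraMap (MvPolynomial (Fin 2 × Fin 2) ℂ) Laurent (MvPolynomial.C a) =
          algebraMap ℂ Laurent a := by
        rw [IsScalarTower.algebraMap_apply ℂ (MvPolynomial (Fin 2 × Fin 2) ℂ) Laurent]
        rfl
      rw [this, Derivation.map_algebraMap, Derivation.map_algebraMap]
    | add p q hp hq => simp [hp, hq]
    | mul_X p i hp =>
      have := h i.1 i.2
      simp only [coord, Matrix.of_apply] at this
      simp [hp, this]
  ext f
  obtain ⟨⟨p, s⟩, hs⟩ := IsLocalization.surj (Submonoid.powers normPoly) f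
  have hu := IsLocalization.map_units Laurent s
  have e1 := congrArg D₁ hs
  have e2 := congrArg D₂ hs
  simp only [Derivation.leibniz, smul_eq_mul, h1] at e1 e2
  have e3 : algebraMap _ Laurent (s : MvPolynomial (Fin 2 × Fin 2) ℂ) * D₁ f =
      algebraMap _ Laurent (s : MvPolynomial (Fin 2 × Fin 2) ℂ) * D₂ f := by
    rw [← e2] at e1
    exact add_left_cancel e1
  exact hu.mul_left_cancel e3

/-- A constant matrix seen as a matrix of polynomial functions. -/
abbrev const (A : HC) : Matrix (Fin 2) (Fin 2) Laurent := A.map (algebraMap ℂ Laurent)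

/-- The partial derivative `∂ / ∂ z i j`. -/
def partialZ (i j : Fin 2) : Derivation ℂ Laurent Laurent :=
  derivAlong (Matrix.single i j 1)

lemma derivAlong_eq_sum (V : Matrix (Fin 2) (Fin 2) Laurent) :
    derivAlong V = ∑ i, ∑ j, V i j • partialZ i j := by
  apply derivation_ext
  intro i j
  simp only [Fin.sum_univ_two, Derivation.add_apply, Derivation.smul_apply, partialZ,
    derivAlong_coord, smul_eq_mul]
  fin_cases i <;> fin_cases j <;> simp [Matrix.single]

/-- The operator `□ = ∑ (∂ / ∂ z^μ)²`, where `Z = ∑ z^μ e_μ`. -/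
def box : Laurent →ₗ[ℂ] Laurent :=
  ∑ μ : Fin 4, (derivAlong (const (quatUnit μ)) : Laurent →ₗ[ℂ] Laurent) ∘ₗ
    (derivAlong (const (quatUnit μ)) : Laurent →ₗ[ℂ] Laurent)

lemma partialZ_comm (i j k l : Fin 2) (f : Laurent) :
    partialZ i j (partialZ k l f) = partialZ k l (partialZ i j f) := by
  have h : ⁅partialZ i j, partialZ k l⁆ = 0 := by
    apply derivation_ext
    intro a b
    rw [Derivation.commutator_apply, partialZ, partialZ, derivAlong_coord, derivAlong_coord]
    simp only [Matrix.single_apply]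
    split_ifs <;> simp
  have h2 := DFunLike.congr_fun h f
  rw [Derivation.commutator_apply] at h2
  exact sub_eq_zero.mp h2

/-- In terms of the partial derivatives, `□ = 4 (∂₁₁ ∂₂₂ - ∂₁₂ ∂₂₁)`. -/
lemma box_apply (f : Laurent) :
    box f = 4 * (partialZ 0 0 (partialZ 1 1 f) - partialZ 0 1 (partialZ 1 0 f)) := by
  simp only [box, Fin.sum_univ_four, quatUnit, LinearMap.add_apply, LinearMap.comp_apply,
    derivAlong_eq_sum, Fin.sum_univ_two]
  have hI : algebraMap ℂ Laurent Complex.I * algebraMap ℂ Laurent Complex.I = -1 := by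
    rw [← map_mul, Complex.I_mul_I, map_neg, map_one]
  have h1 := partialZ_comm 1 1 0 0 f
  have h2 := partialZ_comm 1 0 0 1 f
  simp [Algebra.smul_def, h1, h2]
  linear_combination (partialZ 0 1 (partialZ 0 1 f) + 2 * partialZ 0 1 (partialZ 1 0 f)
    + partialZ 1 0 (partialZ 1 0 f) + partialZ 0 0 (partialZ 0 0 f)
    - 2 * partialZ 0 0 (partialZ 1 1 f) + partialZ 1 1 (partialZ 1 1 f)) * hI

/-! The representations `ρ'` and `ρ` -/

/-- The vector field `Z C Z + Z D - A Z - B`, the derivative at `s = 0` of the fractional linear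
action of `exp (-s X)` on `Z`. -/
def vField (X : GlHC) : Matrix (Fin 2) (Fin 2) Laurent :=
  coord * const (X 1 0) * coord + coord * const (X 1 1) - const (X 0 0) * coord - const (X 0 1)

/-- The multiplier `Tr (4 C Z + 2 D - 2 A)` in the action `ρ`. -/
def multiplier (X : GlHC) : Laurent :=
  (4 * (const (X 1 0) * coord) + 2 * const (X 1 1) - 2 * const (X 0 0)).trace

lemma map_derivation_mul (D : Derivation ℂ Laurent Laurent)
    (P Q : Matrix (Fin 2) (Fin 2) Laurent) :
    (P * Q).map D = P.map D * Q + P * Q.map D := by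
  ext i j
  simp only [Matrix.map_apply, Matrix.mul_apply, Fin.sum_univ_two, Matrix.add_apply, map_add,
    Derivation.leibniz, smul_eq_mul]
  ring

lemma map_derivation_const (D : Derivation ℂ Laurent Laurent) (A : HC) :
    (const A).map D = 0 := by
  ext i j
  simp

lemma map_derivAlong_coord (V : Matrix (Fin 2) (Fin 2) Laurent) :
    coord.map (derivAlong V) = V := by
  ext i j
  simp [derivAlong_coord]

lemma map_derivAlong_vField (V : Matrix (Fin 2) (Fin 2) Laurent) (X : GlHC) :
    (vField X).map (derivAlong V) =
      V * const (X 1 0) * coord + coord * const (X 1 0) * V + V * const (X 1 1)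
        - const (X 0 0) * V := by
  have hadd : ∀ P Q : Matrix (Fin 2) (Fin 2) Laurent,
      (P + Q).map (derivAlong V) = P.map (derivAlong V) + Q.map (derivAlong V) := by
    intro P Q; ext i j; simp
  have hsub : ∀ P Q : Matrix (Fin 2) (Fin 2) Laurent,
      (P - Q).map (derivAlong V) = P.map (derivAlong V) - Q.map (derivAlong V) := by
    intro P Q; ext i j; simp
  simp only [vField, hadd, hsub, map_derivation_mul, map_derivation_const, map_derivAlong_coord]
  simp

lemma const_mul (A B : HC) : const (A * B) = const A * const B := by
  simp [const, Matrix.map_mul]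

lemma const_add (A B : HC) : const (A + B) = const A + const B := by
  ext i j; simp

lemma const_sub (A B : HC) : const (A - B) = const A - const B := by
  ext i j; simp

lemma const_smul (c : ℂ) (A : HC) : const (c • A) = c • const A := by
  ext i j
  simp only [Matrix.map_apply, Matrix.smul_apply, smul_eq_mul, map_mul]
  rw [Algebra.smul_def]

lemma bracket_apply (X Y : GlHC) (i j : Fin 2) :
    ⁅X, Y⁆ i j = X i 0 * Y 0 j + X i 1 * Y 1 j - (Y i 0 * X 0 j + Y i 1 * X 1 j) := by
  change (X * Y - Y * X) i j = _
  simp [Matrix.mul_apply, Fin.sum_univ_two]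

lemma derivAlong_vField_lie (X Y : GlHC) :
    derivAlong (vField ⁅X, Y⁆) = ⁅derivAlong (vField X), derivAlong (vField Y)⁆ := by
  apply derivation_ext
  intro i j
  rw [Derivation.commutator_apply, derivAlong_coord, derivAlong_coord, derivAlong_coord]
  have hX := congrFun (congrFun (map_derivAlong_vField (vField X) Y) i) j
  have hY := congrFun (congrFun (map_derivAlong_vField (vField Y) X) i) j
  rw [Matrix.map_apply] at hX hY
  rw [hX, hY, ← Matrix.sub_apply]
  refine congrFun (congrFun ?_ i) j
  simp only [vField, bracket_apply, const_sub, const_add, const_mul]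
  noncomm_ring

lemma multiplier_lie (X Y : GlHC) :
    multiplier ⁅X, Y⁆ =
      derivAlong (vField X) (multiplier Y) - derivAlong (vField Y) (multiplier X) := by
  have key : ∀ (V : Matrix (Fin 2) (Fin 2) Laurent) (W : GlHC),
      derivAlong V (multiplier W) = 4 * (const (W 1 0) * V).trace := by
    intro V W
    have h4 : multiplier W = 4 * (const (W 1 0) * coord).trace +
        algebraMap ℂ Laurent (2 * (W 1 1).trace - 2 * (W 0 0).trace) := by
      simp only [multiplier, Matrix.trace_fin_two, Matrix.sub_apply, Matrix.add_apply, two_mul,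
        Matrix.map_apply, map_add, map_sub, show (4 : Matrix (Fin 2) (Fin 2) Laurent) =
          1 + 1 + 1 + 1 by norm_num, add_mul, one_mul]
      ring
    rw [h4, map_add, Derivation.map_algebraMap]
    have h5 : derivAlong V (4 : Laurent) = 0 := by
      exact_mod_cast Derivation.map_natCast (derivAlong V) 4
    have h6 := congrArg Matrix.trace (map_derivation_mul (derivAlong V) (const (W 1 0)) coord)
    rw [map_derivation_const, map_derivAlong_coord, zero_mul, zero_add] at h6
    rw [← h6, Derivation.leibniz, h5]
    simp [Matrix.trace_fin_two]
  rw [key, key]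
  simp only [multiplier, bracket_apply, const_sub, const_add, const_mul, vField]
  simp only [Matrix.trace_fin_two, Matrix.sub_apply, Matrix.add_apply, two_mul,
    show (4 : Matrix (Fin 2) (Fin 2) Laurent) = 1 + 1 + 1 + 1 by norm_num, add_mul, one_mul,
    Matrix.mul_apply, Fin.sum_univ_two]
  ring

lemma vField_add (X Y : GlHC) : vField (X + Y) = vField X + vField Y := by
  simp only [vField, Matrix.add_apply, const_add]
  noncomm_ring

lemma vField_smul (c : ℂ) (X : GlHC) : vField (c • X) = c • vField X := by
  simp only [vField, Matrix.smul_apply, const_smul]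
  simp [smul_sub, smul_add]

lemma multiplier_add (X Y : GlHC) : multiplier (X + Y) = multiplier X + multiplier Y := by
  simp only [multiplier, Matrix.add_apply, const_add, ← Matrix.trace_add]
  congr 1
  noncomm_ring

lemma multiplier_smul (c : ℂ) (X : GlHC) : multiplier (c • X) = c • multiplier X := by
  simp only [multiplier, Matrix.smul_apply, const_smul, ← Matrix.trace_smul]
  congr 1
  simp [smul_sub, smul_add]

lemma derivAlong_add (V W : Matrix (Fin 2) (Fin 2) Laurent) :
    derivAlong (V + W) = derivAlong V + derivAlong W := by
  apply derivation_ext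
  simp [derivAlong_coord]

lemma derivAlong_smul (c : ℂ) (V : Matrix (Fin 2) (Fin 2) Laurent) :
    derivAlong (c • V) = c • derivAlong V := by
  apply derivation_ext
  simp [derivAlong_coord]

/-- The space `Ш'`: polynomial functions on invertible complexified quaternions, with the
action `ρ'` below. -/
def ShP : Type := Laurent

instance : AddCommGroup ShP := inferInstanceAs (AddCommGroup Laurent)
instance : Module ℂ ShP := inferInstanceAs (Module ℂ Laurent)

/-- The identification of `Ш'` with the space of polynomial functions. -/
def ShP.of : Laurent ≃ₗ[ℂ] ShP := LinearEquiv.refl ℂ Laurent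

/-- The space `Ш`: polynomial functions on invertible complexified quaternions, with the
action `ρ` below. -/
def Sh : Type := Laurent

instance : AddCommGroup Sh := inferInstanceAs (AddCommGroup Laurent)
instance : Module ℂ Sh := inferInstanceAs (Module ℂ Laurent)

/-- The identification of `Ш` with the space of polynomial functions. -/
def Sh.of : Laurent ≃ₗ[ℂ] Sh := LinearEquiv.refl ℂ Laurent

/-- The action `ρ'`: `ρ'(X) f = Tr ((Z C Z + Z D - A Z - B) ∂) f`. -/
instance : LieRingModule GlHC ShP where
  bracket X f := ShP.of (derivAlong (vField X) (ShP.of.symm f))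
  add_lie X Y f := by
    simp [vField_add, derivAlong_add]
  lie_add X f g := by simp
  leibniz_lie X Y f := by
    simp only [LinearEquiv.symm_apply_apply, derivAlong_vField_lie, Derivation.commutator_apply,
      map_sub, sub_add_cancel]

lemma lie_ShP (X : GlHC) (f : Laurent) :
    ⁅X, ShP.of f⁆ = ShP.of (derivAlong (vField X) f) := rfl

instance : LieModule ℂ GlHC ShP where
  smul_lie c X f := by
    change ShP.of (derivAlong (vField (c • X)) (ShP.of.symm f)) =
      c • ShP.of (derivAlong (vField X) (ShP.of.symm f))
    simp [vField_smul, derivAlong_smul]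
  lie_smul c X f := by
    change ShP.of (derivAlong (vField X) (ShP.of.symm (c • f))) =
      c • ShP.of (derivAlong (vField X) (ShP.of.symm f))
    simp

/-- The action `ρ`: `ρ(X) f = Tr ((Z C Z + Z D - A Z - B) ∂ + 4 C Z + 2 D - 2 A) f`. -/
instance : LieRingModule GlHC Sh where
  bracket X f :=
    Sh.of (derivAlong (vField X) (Sh.of.symm f) + multiplier X * Sh.of.symm f)
  add_lie X Y f := by
    rw [← map_add]
    congr 1
    simp only [vField_add, derivAlong_add, multiplier_add, Derivation.add_apply]
    ring
  lie_add X f g := by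
    rw [← map_add]
    congr 1
    simp only [map_add]
    ring
  leibniz_lie X Y f := by
    rw [← map_add]
    congr 1
    simp only [LinearEquiv.symm_apply_apply, derivAlong_vField_lie, Derivation.commutator_apply,
      map_add, Derivation.leibniz, smul_eq_mul, multiplier_lie]
    ring

lemma lie_Sh (X : GlHC) (f : Laurent) :
    ⁅X, Sh.of f⁆ = Sh.of (derivAlong (vField X) f + multiplier X * f) := rfl

instance : LieModule ℂ GlHC Sh where
  smul_lie c X f := by
    change Sh.of (derivAlong (vField (c • X)) (Sh.of.symm f) + multiplier (c • X) * Sh.of.symm f) =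
      c • Sh.of (derivAlong (vField X) (Sh.of.symm f) + multiplier X * Sh.of.symm f)
    rw [← map_smul]
    congr 1
    simp [vField_smul, derivAlong_smul, multiplier_smul]
  lie_smul c X f := by
    change Sh.of (derivAlong (vField X) (Sh.of.symm (c • f)) + multiplier X * Sh.of.symm (c • f)) =
      c • Sh.of (derivAlong (vField X) (Sh.of.symm f) + multiplier X * Sh.of.symm f)
    rw [← map_smul]
    congr 1
    simp

/-! Evaluation, and comparison of the two actions with the conformal group actions -/

open Classical in
/-- The value of a polynomial function at an invertible `Z` (and `0` if `det Z = 0`). -/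
def evalAt (Z : HC) (f : Laurent) : ℂ :=
  if h : IsUnit (MvPolynomial.aeval (fun p : Fin 2 × Fin 2 => Z p.1 p.2) normPoly) then
    IsLocalization.Away.lift (S := Laurent) normPoly
      (g := (MvPolynomial.aeval fun p : Fin 2 × Fin 2 => Z p.1 p.2 :
        MvPolynomial (Fin 2 × Fin 2) ℂ →ₐ[ℂ] ℂ).toRingHom) h f
  else 0

lemma aeval_normPoly (Z : HC) :
    MvPolynomial.aeval (fun p : Fin 2 × Fin 2 => Z p.1 p.2) normPoly = Z.det := by
  simp [normPoly, Matrix.det_fin_two]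

lemma exists_evalAt_hom (Z : HC) (hZ : Z.det ≠ 0) :
    ∃ φ : Laurent →ₐ[ℂ] ℂ, (∀ f, evalAt Z f = φ f) ∧ ∀ i j, φ (coord i j) = Z i j := by
  have h : IsUnit (MvPolynomial.aeval (fun p : Fin 2 × Fin 2 => Z p.1 p.2) normPoly) := by
    rw [aeval_normPoly]
    exact isUnit_iff_ne_zero.mpr hZ
  have h1 : ∀ p : MvPolynomial (Fin 2 × Fin 2) ℂ, evalAt Z (algebraMap _ Laurent p) =
      MvPolynomial.aeval (fun p : Fin 2 × Fin 2 => Z p.1 p.2) p := by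
    intro p
    rw [evalAt, dif_pos h]
    exact IsLocalization.Away.lift_eq normPoly h p
  refine ⟨{ IsLocalization.Away.lift (S := Laurent) normPoly
      (g := (MvPolynomial.aeval fun p : Fin 2 × Fin 2 => Z p.1 p.2 :
        MvPolynomial (Fin 2 × Fin 2) ℂ →ₐ[ℂ] ℂ).toRingHom) h with
      commutes' := ?_ }, ?_, ?_⟩
  · intro c
    have := h1 (MvPolynomial.C c)
    rw [evalAt, dif_pos h] at this
    rw [IsScalarTower.algebraMap_apply ℂ (MvPolynomial (Fin 2 × Fin 2) ℂ) Laurent]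
    refine Eq.trans this ?_
    simp
  · intro f
    rw [evalAt, dif_pos h]
    rfl
  · intro i j
    have := h1 (MvPolynomial.X (i, j))
    rw [evalAt, dif_pos h] at this
    refine Eq.trans this ?_
    simp

lemma hasDerivAt_evalAt (c : ℂ → HC) (V : HC) (hc : ∀ i j, HasDerivAt (fun s => c s i j) (V i j) 0)
    (h0 : (c 0).det ≠ 0) (f : Laurent) :
    HasDerivAt (fun s => evalAt (c s) f)
      (∑ i, ∑ j, V i j * evalAt (c 0) (partialZ i j f)) 0 := by
  have hdet : ContinuousAt (fun s => (c s).det) 0 := by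
    simp only [Matrix.det_fin_two]
    exact (((hc 0 0).mul (hc 1 1)).sub ((hc 0 1).mul (hc 1 0))).continuousAt
  have hev : ∀ᶠ s in nhds (0 : ℂ), (c s).det ≠ 0 := hdet.eventually_ne h0
  obtain ⟨φ, hφ, hφc⟩ := exists_evalAt_hom (c 0) h0
  have hadd : ∀ f g, HasDerivAt (fun s => evalAt (c s) f)
      (∑ i, ∑ j, V i j * evalAt (c 0) (partialZ i j f)) 0 →
      HasDerivAt (fun s => evalAt (c s) g)
      (∑ i, ∑ j, V i j * evalAt (c 0) (partialZ i j g)) 0 →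
      HasDerivAt (fun s => evalAt (c s) (f + g))
      (∑ i, ∑ j, V i j * evalAt (c 0) (partialZ i j (f + g))) 0 := by
    intro f g hf hg
    refine ((hf.add hg).congr_of_eventuallyEq ?_).congr_deriv ?_
    · filter_upwards [hev] with s hs
      obtain ⟨ψ, hψ, -⟩ := exists_evalAt_hom (c s) hs
      simp [hψ]
    · simp only [hφ, map_add, Fin.sum_univ_two]
      ring
  have hmul : ∀ f g, HasDerivAt (fun s => evalAt (c s) f)
      (∑ i, ∑ j, V i j * evalAt (c 0) (partialZ i j f)) 0 →
      HasDerivAt (fun s => evalAt (c s) g)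
      (∑ i, ∑ j, V i j * evalAt (c 0) (partialZ i j g)) 0 →
      HasDerivAt (fun s => evalAt (c s) (f * g))
      (∑ i, ∑ j, V i j * evalAt (c 0) (partialZ i j (f * g))) 0 := by
    intro f g hf hg
    refine ((hf.mul hg).congr_of_eventuallyEq ?_).congr_deriv ?_
    · filter_upwards [hev] with s hs
      obtain ⟨ψ, hψ, -⟩ := exists_evalAt_hom (c s) hs
      simp [hψ]
    · simp only [hφ, map_add, map_mul, Derivation.leibniz, smul_eq_mul, Fin.sum_univ_two]
      ring
  have hconst : ∀ a : ℂ, HasDerivAt (fun s => evalAt (c s) (algebraMap ℂ Laurent a))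
      (∑ i, ∑ j, V i j * evalAt (c 0) (partialZ i j (algebraMap ℂ Laurent a))) 0 := by
    intro a
    refine ((hasDerivAt_const (0 : ℂ) a).congr_of_eventuallyEq ?_).congr_deriv ?_
    · filter_upwards [hev] with s hs
      obtain ⟨ψ, hψ, -⟩ := exists_evalAt_hom (c s) hs
      simp [hψ]
    · simp [hφ]
  have hcoord : ∀ k l, HasDerivAt (fun s => evalAt (c s) (coord k l))
      (∑ i, ∑ j, V i j * evalAt (c 0) (partialZ i j (coord k l))) 0 := by
    intro k l
    refine ((hc k l).congr_of_eventuallyEq ?_).congr_deriv ?_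
    · filter_upwards [hev] with s hs
      obtain ⟨ψ, hψ, hψc⟩ := exists_evalAt_hom (c s) hs
      simp [hψ, hψc]
    · simp only [hφ, partialZ, derivAlong_coord, Fin.sum_univ_two]
      fin_cases k <;> fin_cases l <;> simp [Matrix.single]
  have hpoly : ∀ p : MvPolynomial (Fin 2 × Fin 2) ℂ,
      HasDerivAt (fun s => evalAt (c s) (algebraMap _ Laurent p))
      (∑ i, ∑ j, V i j * evalAt (c 0) (partialZ i j (algebraMap _ Laurent p))) 0 := by
    intro p
    induction p using MvPolynomial.induction_on with
    | C a =>
      have := hconst a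
      rwa [IsScalarTower.algebraMap_apply ℂ (MvPolynomial (Fin 2 × Fin 2) ℂ) Laurent] at this
    | add p q hp hq => rw [map_add]; exact hadd _ _ hp hq
    | mul_X p i hp => rw [map_mul]; exact hmul _ _ hp (hcoord i.1 i.2)
  have hinv : ∀ f g, f * g = 1 → HasDerivAt (fun s => evalAt (c s) f)
      (∑ i, ∑ j, V i j * evalAt (c 0) (partialZ i j f)) 0 →
      HasDerivAt (fun s => evalAt (c s) g)
      (∑ i, ∑ j, V i j * evalAt (c 0) (partialZ i j g)) 0 := by
    intro f g hfg hf
    have hv : φ f * φ g = 1 := by rw [← map_mul, hfg, map_one]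
    have hne : evalAt (c 0) f ≠ 0 := by
      rw [hφ]
      exact left_ne_zero_of_mul_eq_one hv
    refine ((hf.inv hne).congr_of_eventuallyEq ?_).congr_deriv ?_
    · filter_upwards [hev] with s hs
      obtain ⟨ψ, hψ, -⟩ := exists_evalAt_hom (c s) hs
      rw [Pi.inv_apply, hψ, hψ]
      refine eq_inv_of_mul_eq_one_right ?_
      rw [← map_mul, hfg, map_one]
    · have hD : ∀ i j, φ (partialZ i j g) = - (φ g) ^ 2 * φ (partialZ i j f) := by
        intro i j
        have h1 := congrArg (fun x => φ (partialZ i j x)) hfg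
        simp only [Derivation.leibniz, smul_eq_mul, map_add, map_mul, Derivation.map_one_eq_zero,
          map_zero] at h1
        linear_combination φ g * h1 - φ (partialZ i j g) * hv
      rw [hφ] at hne ⊢
      have hg : φ g = (φ f)⁻¹ := eq_inv_of_mul_eq_one_right hv
      simp only [hφ, hD, Fin.sum_univ_two, hg]
      field_simp
      ring
  obtain ⟨⟨p, t⟩, ht⟩ := IsLocalization.surj (Submonoid.powers normPoly) f
  obtain ⟨u, hu⟩ := IsLocalization.map_units Laurent t
  have hf : f = algebraMap _ Laurent p * ((u⁻¹ : Laurentˣ) : Laurent) := by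
    simp only at ht
    rw [← ht, ← hu, mul_assoc, Units.mul_inv, mul_one]
  rw [hf]
  refine hmul _ _ (hpoly p) (hinv u _ (Units.mul_inv u) ?_)
  rw [hu]
  exact hpoly _

/-- The fractional linear map `Z ↦ (a Z + b) (c Z + d)⁻¹`. -/
def moebius (g : GlHC) (Z : HC) : HC :=
  (g 0 0 * Z + g 0 1) * (g 1 0 * Z + g 1 1)⁻¹

lemma hasDerivAt_exp_entry (X : GlHC) (i j p q : Fin 2) :
    HasDerivAt (fun s : ℂ => NormedSpace.exp (s • X) i j p q) (X i j p q) 0 := by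
  let : NormedRing HC := Matrix.linftyOpNormedRing
  let : NormedAlgebra ℂ HC := Matrix.linftyOpNormedAlgebra
  let : NormedRing GlHC := Matrix.linftyOpNormedRing
  let : NormedAlgebra ℂ GlHC := Matrix.linftyOpNormedAlgebra
  have h := hasDerivAt_exp_smul_const (𝕂 := ℂ) X 0
  simp only [zero_smul, NormedSpace.exp_zero, one_mul] at h
  let l : GlHC →ₗ[ℂ] ℂ :=
    { toFun := fun Y => Y i j p q
      map_add' := fun _ _ => rfl
      map_smul' := fun _ _ => rfl }
  exact (l.toContinuousLinearMap.hasFDerivAt.comp_hasDerivAt (0 : ℂ) h)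

lemma hasDerivAt_exp_neg_entry (X : GlHC) (i j p q : Fin 2) :
    HasDerivAt (fun s : ℂ => NormedSpace.exp (-(s • X)) i j p q) (-X i j p q) 0 := by
  have h := hasDerivAt_exp_entry (-X) i j p q
  simpa only [smul_neg, Matrix.neg_apply] using h

lemma hasDerivAt_mul_entry {P Q : ℂ → HC} {P' Q' : HC}
    (hP : ∀ i j, HasDerivAt (fun s => P s i j) (P' i j) 0)
    (hQ : ∀ i j, HasDerivAt (fun s => Q s i j) (Q' i j) 0) (i j : Fin 2) :
    HasDerivAt (fun s => (P s * Q s) i j) ((P' * Q 0 + P 0 * Q') i j) 0 := by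
  simp only [Matrix.mul_apply, Fin.sum_univ_two, Matrix.add_apply]
  refine (((hP i 0).mul (hQ 0 j)).add ((hP i 1).mul (hQ 1 j))).congr_deriv ?_
  ring

lemma hasDerivAt_det {Q : ℂ → HC} {Q' : HC}
    (hQ : ∀ i j, HasDerivAt (fun s => Q s i j) (Q' i j) 0) (h0 : Q 0 = 1) :
    HasDerivAt (fun s => (Q s).det) Q'.trace 0 := by
  simp only [Matrix.det_fin_two]
  refine (((hQ 0 0).mul (hQ 1 1)).sub ((hQ 0 1).mul (hQ 1 0))).congr_deriv ?_
  simp [h0, Matrix.trace_fin_two]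

lemma hasDerivAt_inv_entry {Q : ℂ → HC} {Q' : HC}
    (hQ : ∀ i j, HasDerivAt (fun s => Q s i j) (Q' i j) 0) (h0 : Q 0 = 1) (i j : Fin 2) :
    HasDerivAt (fun s => (Q s)⁻¹ i j) ((-Q') i j) 0 := by
  have hd := (hasDerivAt_det hQ h0).inv (by simp [h0])
  simp only [Matrix.inv_def, Ring.inverse_eq_inv', Matrix.adjugate_fin_two, Matrix.smul_apply,
    smul_eq_mul]
  fin_cases i <;> fin_cases j
  · refine (hd.mul (hQ 1 1)).congr_deriv ?_
    simp [h0, Matrix.trace_fin_two]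
  · refine (hd.mul (hQ 0 1).neg).congr_deriv ?_
    simp [h0]
  · refine (hd.mul (hQ 1 0).neg).congr_deriv ?_
    simp [h0]
  · refine (hd.mul (hQ 0 0)).congr_deriv ?_
    simp [h0, Matrix.trace_fin_two]

lemma hasDerivAt_row (X : GlHC) (Z : HC) (k i j : Fin 2) :
    HasDerivAt (fun s : ℂ => (NormedSpace.exp (-(s • X)) k 0 * Z +
      NormedSpace.exp (-(s • X)) k 1) i j) ((-(X k 0 * Z + X k 1)) i j) 0 := by
  simp only [Matrix.add_apply, Matrix.mul_apply, Fin.sum_univ_two, Matrix.neg_apply]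
  refine ((((hasDerivAt_exp_neg_entry X k 0 i 0).mul_const (Z 0 j)).add
    ((hasDerivAt_exp_neg_entry X k 0 i 1).mul_const (Z 1 j))).add
    (hasDerivAt_exp_neg_entry X k 1 i j)).congr_deriv ?_
  ring

lemma row_zero (X : GlHC) (Z : HC) (k : Fin 2) :
    NormedSpace.exp (-((0 : ℂ) • X)) k 0 * Z + NormedSpace.exp (-((0 : ℂ) • X)) k 1 =
      if k = 0 then Z else 1 := by
  simp only [zero_smul, neg_zero, NormedSpace.exp_zero]
  obtain rfl | rfl : k = 0 ∨ k = 1 := by fin_cases k <;> simp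
  · simp
  · simp

lemma hasDerivAt_moebius (X : GlHC) (Z : HC) (i j : Fin 2) :
    HasDerivAt (fun s : ℂ => moebius (NormedSpace.exp (-(s • X))) Z i j)
      ((Z * X 1 0 * Z + Z * X 1 1 - X 0 0 * Z - X 0 1) i j) 0 := by
  have h1 : NormedSpace.exp (-((0 : ℂ) • X)) 1 0 * Z + NormedSpace.exp (-((0 : ℂ) • X)) 1 1 = 1 := by
    rw [row_zero]; simp
  have h := hasDerivAt_mul_entry (hasDerivAt_row X Z 0)
    (hasDerivAt_inv_entry (hasDerivAt_row X Z 1) h1) i j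
  refine h.congr_deriv ?_
  rw [h1, row_zero]
  simp only [if_true, inv_one, neg_neg]
  refine congrFun (congrFun ?_ i) j
  noncomm_ring

lemma moebius_zero (X : GlHC) (Z : HC) :
    moebius (NormedSpace.exp (-((0 : ℂ) • X))) Z = Z := by
  rw [moebius, row_zero, row_zero]
  simp

/-- The action `ρ'` is the derivative of the group action
`(ρ'(h) f) (Z) = f ((a Z + b) (c Z + d)⁻¹)`, where `h⁻¹ = (a, b; c, d)`. -/
theorem hasDerivAt_rhoPrime (X : GlHC) (f : Laurent) (Z : HC) (hZ : Z.det ≠ 0) :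
    HasDerivAt (fun s : ℂ => evalAt (moebius (NormedSpace.exp (-(s • X))) Z) f)
      (evalAt Z (ShP.of.symm ⁅X, ShP.of f⁆)) 0 := by
  have h := hasDerivAt_evalAt _ _ (hasDerivAt_moebius X Z) (by rwa [moebius_zero]) f
  refine h.congr_deriv ?_
  rw [moebius_zero, lie_ShP, LinearEquiv.symm_apply_apply, derivAlong_eq_sum]
  obtain ⟨φ, hφ, hφc⟩ := exists_evalAt_hom Z hZ
  simp only [hφ, Fin.sum_univ_two, Derivation.add_apply, Derivation.smul_apply, map_add, map_mul,
    smul_eq_mul, vField, Matrix.add_apply, Matrix.sub_apply, Matrix.mul_apply, map_sub, hφc,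
    Matrix.map_apply, AlgHom.commutes, Algebra.algebraMap_self, RingHom.id_apply]

/-- The action `ρ` is the derivative of the group action
`(ρ(h) f) (Z) = f ((a Z + b) (c Z + d)⁻¹) / (N (c Z + d) ^ 2 N (a' - Z c') ^ 2)`, where
`h = (a', b'; c', d')` and `h⁻¹ = (a, b; c, d)`. -/
theorem hasDerivAt_rho (X : GlHC) (f : Laurent) (Z : HC) (hZ : Z.det ≠ 0) :
    HasDerivAt (fun s : ℂ =>
        evalAt (moebius (NormedSpace.exp (-(s • X))) Z) f /
          ((NormedSpace.exp (-(s • X)) 1 0 * Z + NormedSpace.exp (-(s • X)) 1 1).det ^ 2 *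
            (NormedSpace.exp (s • X) 0 0 - Z * NormedSpace.exp (s • X) 1 0).det ^ 2))
      (evalAt Z (Sh.of.symm ⁅X, Sh.of f⁆)) 0 := by
  have h1 : NormedSpace.exp (-((0 : ℂ) • X)) 1 0 * Z + NormedSpace.exp (-((0 : ℂ) • X)) 1 1 = 1 := by
    rw [row_zero]; simp
  have h2 : NormedSpace.exp ((0 : ℂ) • X) 0 0 - Z * NormedSpace.exp ((0 : ℂ) • X) 1 0 = 1 := by
    simp [NormedSpace.exp_zero]
  have hr : ∀ i j, HasDerivAt (fun s : ℂ => (NormedSpace.exp (s • X) 0 0 -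
      Z * NormedSpace.exp (s • X) 1 0) i j) ((X 0 0 - Z * X 1 0) i j) 0 := by
    intro i j
    simp only [Matrix.sub_apply, Matrix.mul_apply, Fin.sum_univ_two]
    exact (hasDerivAt_exp_entry X 0 0 i j).sub
      (((hasDerivAt_exp_entry X 1 0 0 j).const_mul (Z i 0)).add
        ((hasDerivAt_exp_entry X 1 0 1 j).const_mul (Z i 1)))
  have hd1 := hasDerivAt_det (hasDerivAt_row X Z 1) h1
  have hd2 := hasDerivAt_det hr h2
  have hf := hasDerivAt_rhoPrime X f Z hZ
  refine (hf.div ((hd1.pow 2).mul (hd2.pow 2)) ?_).congr_deriv ?_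
  · simp
  · obtain ⟨φ, hφ, hφc⟩ := exists_evalAt_hom Z hZ
    have hm : φ (multiplier X) = 4 * (X 1 0 * Z).trace + 2 * (X 1 1).trace - 2 * (X 0 0).trace := by
      simp only [multiplier, two_mul, show (4 : Matrix (Fin 2) (Fin 2) Laurent) =
        1 + 1 + 1 + 1 by norm_num, add_mul, one_mul, Matrix.trace_fin_two, Matrix.add_apply,
        Matrix.sub_apply, Matrix.mul_apply, Fin.sum_univ_two, map_add, map_sub, map_mul, hφc,
        Matrix.map_apply, AlgHom.commutes, Algebra.algebraMap_self, RingHom.id_apply]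
      ring
    rw [lie_ShP, lie_Sh, LinearEquiv.symm_apply_apply, LinearEquiv.symm_apply_apply]
    simp only [h1, h2, moebius_zero, hφ, map_add, map_mul, hm, Pi.mul_apply, Pi.pow_apply]
    simp [Matrix.trace_fin_two, Matrix.mul_apply, Fin.sum_univ_two]
    ring

/-! `K`-types -/

/-- The matrix coefficient `t^l_{n m}` with `L = 2 l`, `a = l - m`, `b = l - n`
(so that `0 ≤ a, b ≤ 2 l`), as the coefficient of `s ^ (l - n)` in
`(s z₁₁ + z₂₁) ^ (l - m) * (s z₁₂ + z₂₂) ^ (l + m)`. -/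
def tCoeff (L : ℕ) (a b : Fin (L + 1)) : Laurent :=
  ((Polynomial.X * Polynomial.C (coord 0 0) + Polynomial.C (coord 1 0)) ^ (a : ℕ) *
    (Polynomial.X * Polynomial.C (coord 0 1) + Polynomial.C (coord 1 1)) ^ (L - (a : ℕ)) :
      Polynomial Laurent).coeff b

lemma coeff_eq_circleIntegral (G : Polynomial ℂ) (b : ℕ) :
    (2 * Real.pi * Complex.I)⁻¹ * (∮ s in C(0, 1), G.eval s * s ^ (-(b : ℤ)) / s) = G.coeff b := by
  have hI : ∀ n : ℤ, CircleIntegrable (fun s : ℂ => s ^ n) 0 1 := by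
    intro n
    have := circleIntegrable_sub_zpow_iff (c := 0) (w := 0) (R := 1) (n := n)
    simp only [sub_zero] at this
    rw [this]
    simp
  have h1 : (∮ s in C(0, 1), G.eval s * s ^ (-(b : ℤ)) / s) =
      ∮ s in C(0, 1), ∑ k ∈ G.support, G.coeff k * s ^ ((k : ℤ) - b - 1) := by
    refine circleIntegral.integral_congr zero_le_one ?_
    intro s hs
    have hs0 : s ≠ 0 := by
      rintro rfl
      simp at hs
    simp only [Polynomial.eval_eq_sum, Polynomial.sum, Finset.sum_mul, Finset.sum_div]
    refine Finset.sum_congr rfl fun k _ => ?_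
    rw [zpow_sub₀ hs0, zpow_sub₀ hs0, zpow_neg, zpow_one, zpow_natCast, zpow_natCast]
    field_simp
  have h2 : (∮ s in C(0, 1), ∑ k ∈ G.support, G.coeff k * s ^ ((k : ℤ) - b - 1)) =
      ∑ k ∈ G.support, ∮ s in C(0, 1), G.coeff k * s ^ ((k : ℤ) - b - 1) := by
    refine circleIntegral.integral_fun_sum fun k _ => ?_
    exact (hI _).const_fun_smul
  have h3 : ∀ k : ℕ, (∮ s in C(0, 1), G.coeff k * s ^ ((k : ℤ) - b - 1)) =
      if k = b then G.coeff k * (2 * Real.pi * Complex.I) else 0 := by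
    intro k
    rw [circleIntegral.integral_const_mul]
    split_ifs with hk
    · subst hk
      have := circleIntegral.integral_sub_center_inv (0 : ℂ) (one_ne_zero (α := ℝ))
      simp only [sub_zero] at this
      simp [this]
    · have := circleIntegral.integral_sub_zpow_of_ne (n := (k : ℤ) - b - 1) (by omega) 0 0 1
      simp only [sub_zero] at this
      rw [this, mul_zero]
  have h2pi : (2 * Real.pi * Complex.I : ℂ) ≠ 0 := Complex.two_pi_I_ne_zero
  rw [h1, h2, Finset.sum_congr rfl fun k _ => h3 k, Finset.sum_ite_eq' G.support b]
  split_ifs with hb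
  · field_simp
  · rw [Polynomial.notMem_support_iff.mp hb, mul_zero]

/-- `t^l_{n m}` is given by the contour integral
`(2πi)⁻¹ ∮ (s z₁₁ + z₂₁) ^ (l - m) (s z₁₂ + z₂₂) ^ (l + m) s ^ (-l + n) ds / s`. -/
theorem evalAt_tCoeff (L : ℕ) (a b : Fin (L + 1)) (Z : HC) (hZ : Z.det ≠ 0) :
    evalAt Z (tCoeff L a b) = (2 * Real.pi * Complex.I)⁻¹ *
      ∮ s in C(0, 1), (s * Z 0 0 + Z 1 0) ^ (a : ℕ) * (s * Z 0 1 + Z 1 1) ^ (L - (a : ℕ)) *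
        s ^ (-((b : ℕ) : ℤ)) / s := by
  obtain ⟨φ, hφ, hφc⟩ := exists_evalAt_hom Z hZ
  have hc : ∀ i j, (φ : Laurent →+* ℂ) (coord i j) = Z i j := hφc
  have h1 : evalAt Z (tCoeff L a b) =
      (((Polynomial.X * Polynomial.C (Z 0 0) + Polynomial.C (Z 1 0)) ^ (a : ℕ) *
        (Polynomial.X * Polynomial.C (Z 0 1) + Polynomial.C (Z 1 1)) ^ (L - (a : ℕ)) :
          Polynomial ℂ).coeff b) := by
    rw [hφ, tCoeff]
    change (φ : Laurent →+* ℂ) _ = _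
    rw [← Polynomial.coeff_map]
    simp only [Polynomial.map_mul, Polynomial.map_pow, Polynomial.map_add, Polynomial.map_X,
      Polynomial.map_C, hc]
  rw [h1, ← coeff_eq_circleIntegral]
  simp only [Polynomial.eval_mul, Polynomial.eval_pow, Polynomial.eval_add, Polynomial.eval_X,
    Polynomial.eval_C]

/-- The span of all functions `N(Z) ^ k * t^l_{n m}(Z)` for which `(k, 2 l)` satisfies `P`. -/
def kSpan (P : ℤ → ℤ → Prop) : Submodule ℂ Laurent :=
  Submodule.span ℂ {f | ∃ (k : ℤ) (L : ℕ) (a b : Fin (L + 1)),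
    P k L ∧ f = ((normUnit ^ k : Laurentˣ) : Laurent) * tCoeff L a b}

/-- The span in `Ш'` of all `N(Z) ^ k * t^l_{n m}(Z)` for which `(k, 2 l)` satisfies `P`. -/
def ShP.kSpan (P : ℤ → ℤ → Prop) : Submodule ℂ ShP :=
  (QuatConf.kSpan P).map (ShP.of : Laurent →ₗ[ℂ] ShP)

/-- The span in `Ш` of all `N(Z) ^ k * t^l_{n m}(Z)` for which `(k, 2 l)` satisfies `P`. -/
def Sh.kSpan (P : ℤ → ℤ → Prop) : Submodule ℂ Sh :=
  (QuatConf.kSpan P).map (Sh.of : Laurent →ₗ[ℂ] Sh)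

/-- The map `□ ∘ □ : Ш' → Ш`. -/
def boxBox : ShP →ₗ[ℂ] Sh :=
  (Sh.of : Laurent →ₗ[ℂ] Sh) ∘ₗ box ∘ₗ box ∘ₗ (ShP.of.symm : ShP →ₗ[ℂ] Laurent)

/-! Subquotients -/

section Subquotients

variable {M : Type} [AddCommGroup M] [Module ℂ M] [LieRingModule GlHC M] [LieModule ℂ GlHC M]

/-- The quotient `V / W` of invariant subspaces `W ≤ V` (in general `V / (V ∩ W)`). -/
abbrev SubQuot (V W : LieSubmodule ℂ GlHC M) : Type :=
  V ⧸ W.comap V.incl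

/-- The class in `V / W` of an element of `V`. -/
abbrev SubQuot.mk (V W : LieSubmodule ℂ GlHC M) : V →ₗ⁅ℂ, GlHC⁆ SubQuot V W :=
  LieSubmodule.Quotient.mk' (W.comap V.incl)

/-- The inclusion `V ≤ V'` induces an isomorphism `V / W ≃ V' / W'`. -/
def InclusionIso (V W V' W' : LieSubmodule ℂ GlHC M) : Prop :=
  ∃ (h : V ≤ V') (e : SubQuot V W ≃ₗ⁅ℂ, GlHC⁆ SubQuot V' W'),
    ∀ x : V, e (SubQuot.mk V W x) = SubQuot.mk V' W' (LieSubmodule.inclusion h x)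

/-- `0 = F 0 ≤ F 1 ≤ ... ≤ F r = M` is a composition series of `M`. -/
def IsCompositionSeries (r : ℕ) (F : Fin (r + 1) → LieSubmodule ℂ GlHC M) : Prop :=
  F 0 = ⊥ ∧ F (Fin.last r) = ⊤ ∧
    ∀ i : Fin r, F i.castSucc ≤ F i.succ ∧
      LieModule.IsIrreducible ℂ GlHC (SubQuot (F i.succ) (F i.castSucc))

end Subquotients

end

end QuatConf

open QuatConf

namespace QuatConf

noncomputable section

open Polynomial

/-! Write `L = 2l`. For fixed `(k, L)` the functions `N^k t^l` span a `K`-type, on which left and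
right multiplications by matrices act irreducibly, so `Ш'` is pictured as the set of lattice points
`(k, L)` with `L ≥ 0`. A coordinate times a harmonic polynomial of degree `L` is harmonic of degree
`L + 1` plus `N` times a derivative (`exists_coord_mul_harm`). Hence the remaining generators, `∂`
and `Tr (Z E Z ∂)`, only move a `K`-type to a neighbour, and the coefficients are, up to nonzero
factors: `k` for `(k - 1, L + 1)`, `k + L + 1` for `(k, L - 1)`, `k + L` for `(k, L + 1)`, and `k -
1` for `(k + 1, L - 1)`.

An invariant subspace is spanned by the basis functions it contains, because four operators built
from the Lie algebra have distinct joint eigenvalues on them (`sepWt_injective`, `fam_mem_of_inv`),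
and with one function it contains its whole `K`-type (`ladder`). So invariant subspaces correspond
to sets of lattice points closed under the four moves (`inv_kSpan`, `transClosed_types`).

In the coordinates `u = k`, `v = -(k + L)` the domain is `u + v ≤ 0`, and each of `u`, `v` moves by
one, except that the steps `0 → -1` and `1 → 2` are forbidden. These barriers cut the domain into
six cells, and reachability depends only on the cells (`TransClosed.reach`, `cell_mem_down_iff`).
The lattice of invariant subspaces is thus the lattice of lower sets of a poset with six elements.
Inclusions, sums, covers and isomorphisms become finite checks, and every composition series adds
each cell once.

For the corollary, one `□` commutes with the action up to half of the multiplier of `ρ` and a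
first-order error; over two applications the errors cancel (`boxBox_lie`). On a `K`-type `□` is
multiplication by `4k(k + L + 1) N⁻¹` (`box_nz_mul`), so `□ ∘ □` annihilates precisely the two
strips `k ∈ {0, 1}` and `k + L ∈ {-1, 0}`. -/

/-- The linear form `s z₁ⱼ + z₂ⱼ` in the auxiliary variable `s`. -/
def linForm (j : Fin 2) : Laurent[X] := X * C (coord 0 j) + C (coord 1 j)

/-- The generating polynomial `(s z₁₁ + z₂₁) ^ a * (s z₁₂ + z₂₂) ^ c`. -/
def genPoly (a c : ℕ) : Laurent[X] := linForm 0 ^ a * linForm 1 ^ c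

/-- The coefficients of the generating polynomials, indexed by the two exponents. -/
def tc (a c n : ℕ) : Laurent := (genPoly a c).coeff n

lemma coeff_genPoly (a c n : ℕ) : (genPoly a c).coeff n = tc a c n := rfl

lemma tCoeff_eq_tc (L : ℕ) (a b : Fin (L + 1)) : tCoeff L a b = tc a (L - a) b := rfl

/-! ### Derivatives of the coefficients of the generating polynomials -/

lemma coeff_deriv_mul {D : Derivation ℂ Laurent Laurent} {P P' Q Q' : Laurent[X]}
    (hP : ∀ n, D (P.coeff n) = P'.coeff n) (hQ : ∀ n, D (Q.coeff n) = Q'.coeff n) (n : ℕ) :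
    D ((P * Q).coeff n) = (P' * Q + P * Q').coeff n := by
  simp only [coeff_add, coeff_mul, map_sum, Derivation.leibniz, smul_eq_mul, hP, hQ,
    ← Finset.sum_add_distrib]
  refine Finset.sum_congr rfl fun x _ => ?_
  ring

lemma coeff_deriv_pow {D : Derivation ℂ Laurent Laurent} {P P' : Laurent[X]}
    (hP : ∀ n, D (P.coeff n) = P'.coeff n) (m n : ℕ) :
    D ((P ^ m).coeff n) = ((m : Laurent[X]) * P ^ (m - 1) * P').coeff n := by
  induction m generalizing n with
  | zero => simp [coeff_one, apply_ite D]
  | succ m ih =>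
    rw [pow_succ, coeff_deriv_mul ih hP]
    congr 1
    rcases m with _ | m
    · simp
    · simp only [Nat.cast_add, Nat.cast_one, Nat.add_sub_cancel]
      ring

lemma derivation_linForm (D : Derivation ℂ Laurent Laurent) (j : Fin 2) (n : ℕ) :
    D ((linForm j).coeff n) = (X * C (D (coord 0 j)) + C (D (coord 1 j))).coeff n := by
  rcases n with _ | _ | n <;> simp [linForm, coeff_X, coeff_C]

/-- The product rule reduces a derivation on `tc` to its values `U` and `V` on the two linear forms.
The truncated exponents `a - 1` and `c - 1` are harmless, since their terms carry the factors `a`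
and `c`. -/
lemma derivation_tc (D : Derivation ℂ Laurent Laurent) (a c n : ℕ) {U V : Laurent[X]}
    (hU : X * C (D (coord 0 0)) + C (D (coord 1 0)) = U)
    (hV : X * C (D (coord 0 1)) + C (D (coord 1 1)) = V) :
    D (tc a c n) = ((a : Laurent[X]) * U * genPoly (a - 1) c
      + (c : Laurent[X]) * V * genPoly a (c - 1)).coeff n := by
  subst hU hV
  rw [tc, genPoly, coeff_deriv_mul (coeff_deriv_pow (derivation_linForm D 0) a)
    (coeff_deriv_pow (derivation_linForm D 1) c)]
  congr 1
  simp only [genPoly]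
  ring

lemma partialZ_coord (i j k l : Fin 2) :
    partialZ i j (coord k l) = if i = k ∧ j = l then 1 else 0 := by
  rw [partialZ, derivAlong_coord, Matrix.single_apply]

lemma coeff_natCast_mul' (m : ℕ) (P : Laurent[X]) (n : ℕ) :
    ((m : Laurent[X]) * P).coeff n = (m : Laurent) * P.coeff n := by
  rw [← C_eq_natCast, coeff_C_mul]

lemma partialZ_tc_00 (a c n : ℕ) :
    partialZ 0 0 (tc a c n) = a * (X * genPoly (a - 1) c).coeff n := by
  rw [derivation_tc (U := X) (V := 0) _ _ _ _ (by simp [partialZ_coord])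
    (by simp [partialZ_coord]), ← coeff_natCast_mul']
  congr 1
  ring

lemma partialZ_tc_10 (a c n : ℕ) :
    partialZ 1 0 (tc a c n) = a * tc (a - 1) c n := by
  rw [derivation_tc (U := 1) (V := 0) _ _ _ _ (by simp [partialZ_coord])
    (by simp [partialZ_coord]), tc, ← coeff_natCast_mul']
  congr 1
  ring

lemma partialZ_tc_01 (a c n : ℕ) :
    partialZ 0 1 (tc a c n) = c * (X * genPoly a (c - 1)).coeff n := by
  rw [derivation_tc (U := 0) (V := X) _ _ _ _ (by simp [partialZ_coord])
    (by simp [partialZ_coord]), ← coeff_natCast_mul']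
  congr 1
  ring

lemma partialZ_tc_11 (a c n : ℕ) :
    partialZ 1 1 (tc a c n) = c * tc a (c - 1) n := by
  rw [derivation_tc (U := 0) (V := 1) _ _ _ _ (by simp [partialZ_coord])
    (by simp [partialZ_coord]), tc, ← coeff_natCast_mul']
  congr 1
  ring

/-! ### Linear and quadratic vector fields on the coefficients -/

/-- The derivation `Tr (E Z ∂)` for the matrix unit `E = E i j`. -/
def rowD (i j : Fin 2) : Derivation ℂ Laurent Laurent :=
  derivAlong (const (Matrix.single i j 1) * coord)

/-- The derivation `Tr (Z E ∂)` for the matrix unit `E = E i j`. -/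
def colD (i j : Fin 2) : Derivation ℂ Laurent Laurent :=
  derivAlong (coord * const (Matrix.single i j 1))

/-- The derivation `Tr (Z E Z ∂)` for the matrix unit `E = E i j`. -/
def quadD (i j : Fin 2) : Derivation ℂ Laurent Laurent :=
  derivAlong (coord * const (Matrix.single i j 1) * coord)

lemma rowD_coord (i j k l : Fin 2) : rowD i j (coord k l) = if k = i then coord j l else 0 := by
  rw [rowD, derivAlong_coord]
  fin_cases i <;> fin_cases j <;> fin_cases k <;>
    simp [Matrix.mul_apply, Matrix.single_apply]

lemma colD_coord (i j k l : Fin 2) : colD i j (coord k l) = if l = j then coord k i else 0 := by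
  rw [colD, derivAlong_coord]
  fin_cases i <;> fin_cases j <;> fin_cases l <;>
    simp [Matrix.mul_apply, Matrix.single_apply]

lemma quadD_coord (i j k l : Fin 2) : quadD i j (coord k l) = coord k i * coord j l := by
  rw [quadD, derivAlong_coord]
  fin_cases i <;> fin_cases j <;>
    simp [Matrix.mul_apply, Fin.sum_univ_two, Matrix.single_apply]

lemma derivative_linForm (j : Fin 2) : derivative (linForm j) = C (coord 0 j) := by
  simp [linForm]

lemma derivative_genPoly (a c : ℕ) :
    derivative (genPoly a c) = (a : Laurent[X]) * C (coord 0 0) * genPoly (a - 1) c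
      + (c : Laurent[X]) * C (coord 0 1) * genPoly a (c - 1) := by
  simp only [genPoly, derivative_mul, derivative_pow, derivative_linForm, C_eq_natCast]
  ring

lemma linForm_mul_genPoly_zero (a c : ℕ) : linForm 0 * genPoly a c = genPoly (a + 1) c := by
  simp only [genPoly]; ring

lemma linForm_mul_genPoly_one (a c : ℕ) : linForm 1 * genPoly a c = genPoly a (c + 1) := by
  simp only [genPoly]; ring

lemma natCast_mul_genPoly_left (a c : ℕ) :
    (a : Laurent[X]) * (linForm 0 * genPoly (a - 1) c) = a * genPoly a c := by
  rcases a with _ | a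
  · simp
  · rw [linForm_mul_genPoly_zero, Nat.add_sub_cancel]

lemma natCast_mul_genPoly_right (a c : ℕ) :
    (c : Laurent[X]) * (linForm 1 * genPoly a (c - 1)) = c * genPoly a c := by
  rcases c with _ | c
  · simp
  · rw [linForm_mul_genPoly_one, Nat.add_sub_cancel]

/-- Euler's identity for the generating polynomials, in the form obtained by solving for the
derivative in the homogenizing variable. -/
lemma euler_genPoly (a c : ℕ) :
    (a : Laurent[X]) * C (coord 1 0) * genPoly (a - 1) c
      + (c : Laurent[X]) * C (coord 1 1) * genPoly a (c - 1) =
      ((a + c : ℕ) : Laurent[X]) * genPoly a c - X * derivative (genPoly a c) := by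
  have h1 := natCast_mul_genPoly_left a c
  have h2 := natCast_mul_genPoly_right a c
  rw [derivative_genPoly]
  have e0 : C (coord 1 0) = linForm 0 - X * C (coord 0 0) := by simp [linForm]
  have e1 : C (coord 1 1) = linForm 1 - X * C (coord 0 1) := by simp [linForm]
  rw [e0, e1, Nat.cast_add]
  linear_combination h1 + h2

/-- On both linear forms `rowD 1 0` has the effect of `d/ds`, hence also on the generating
polynomials. In the same way `rowD 0 0` acts as `s d/ds`. -/
lemma rowD_tc_10 (a c n : ℕ) : rowD 1 0 (tc a c n) = (n + 1) * tc a c (n + 1) := by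
  have : ((n : Laurent) + 1) * tc a c (n + 1) = (derivative (genPoly a c)).coeff n := by
    rw [coeff_derivative, tc, mul_comm]
  rw [this, derivative_genPoly, derivation_tc (U := C (coord 0 0)) (V := C (coord 0 1)) _ _ _ _
    (by simp [rowD_coord]) (by simp [rowD_coord])]

lemma rowD_tc_00 (a c n : ℕ) : rowD 0 0 (tc a c n) = n * tc a c n := by
  have : (n : Laurent) * tc a c n = (X * derivative (genPoly a c)).coeff n := by
    rcases n with _ | n
    · simp
    · rw [coeff_X_mul, coeff_derivative, tc, mul_comm, Nat.cast_add, Nat.cast_one]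
  rw [this, derivative_genPoly, derivation_tc (U := X * C (coord 0 0)) (V := X * C (coord 0 1))
    _ _ _ _ (by simp [rowD_coord]) (by simp [rowD_coord])]
  congr 1
  ring

lemma coeff_euler (a c n : ℕ) :
    ((a : Laurent[X]) * C (coord 1 0) * genPoly (a - 1) c
      + (c : Laurent[X]) * C (coord 1 1) * genPoly a (c - 1)).coeff n =
      ((a : Laurent) + c - n) * tc a c n := by
  have : (X * derivative (genPoly a c)).coeff n = (n : Laurent) * tc a c n := by
    rcases n with _ | n
    · simp
    · rw [coeff_X_mul, coeff_derivative, tc, mul_comm, Nat.cast_add, Nat.cast_one]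
  rw [euler_genPoly, coeff_sub, this, coeff_natCast_mul', ← tc]
  push_cast
  ring

lemma rowD_tc_11 (a c n : ℕ) : rowD 1 1 (tc a c n) = (a + c - n) * tc a c n := by
  rw [← coeff_euler, derivation_tc (U := C (coord 1 0)) (V := C (coord 1 1))
    _ _ _ _ (by simp [rowD_coord]) (by simp [rowD_coord])]

/-- Here the derivation acts as `s (a + c - s d/ds)`, by Euler's identity; the factor `s` shifts the
index by one. -/
lemma rowD_tc_01 (a c n : ℕ) : rowD 0 1 (tc a c (n + 1)) = (a + c - n) * tc a c n := by
  rw [← coeff_euler, ← coeff_X_mul, derivation_tc (U := X * C (coord 1 0))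
    (V := X * C (coord 1 1)) _ _ _ _ (by simp [rowD_coord]) (by simp [rowD_coord])]
  refine congrArg (fun P : Laurent[X] => coeff P (n + 1)) ?_
  ring

lemma rowD_tc_01_zero (a c : ℕ) : rowD 0 1 (tc a c 0) = 0 := by
  rw [derivation_tc (U := X * C (coord 1 0)) (V := X * C (coord 1 1))
    _ _ _ _ (by simp [rowD_coord]) (by simp [rowD_coord])]
  simp [mul_coeff_zero]

lemma colD_tc_00 (a c n : ℕ) : colD 0 0 (tc a c n) = a * tc a c n := by
  rw [derivation_tc (U := linForm 0) (V := 0) _ _ _ _ (by simp [colD_coord, linForm])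
    (by simp [colD_coord]), mul_assoc, natCast_mul_genPoly_left]
  simp [tc]

lemma colD_tc_11 (a c n : ℕ) : colD 1 1 (tc a c n) = c * tc a c n := by
  rw [derivation_tc (U := 0) (V := linForm 1) _ _ _ _ (by simp [colD_coord])
    (by simp [colD_coord, linForm]), mul_assoc (c : Laurent[X]), natCast_mul_genPoly_right]
  simp [tc]

/-- The derivation replaces one factor `linForm 1` by `linForm 0`, so only the exponents change. -/
lemma colD_tc_01 (a c n : ℕ) : colD 0 1 (tc a c n) = c * tc (a + 1) (c - 1) n := by
  rw [derivation_tc (U := 0) (V := linForm 0) _ _ _ _ (by simp [colD_coord])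
    (by simp [colD_coord, linForm]), mul_assoc (c : Laurent[X]), linForm_mul_genPoly_zero]
  simp [tc]

lemma colD_tc_10 (a c n : ℕ) : colD 1 0 (tc a c n) = a * tc (a - 1) (c + 1) n := by
  rw [derivation_tc (U := linForm 1) (V := 0) _ _ _ _ (by simp [colD_coord, linForm])
    (by simp [colD_coord]), mul_assoc, linForm_mul_genPoly_one]
  simp [tc]

/-! Multiplication by the coordinates -/

lemma normUnit_eq' : (normUnit : Laurent) =
    coord 0 0 * coord 1 1 - coord 0 1 * coord 1 0 := by
  rw [normUnit_eq, Matrix.det_fin_two]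

lemma C_normUnit : C (normUnit : Laurent) =
    C (coord 0 0) * linForm 1 - C (coord 0 1) * linForm 0 := by
  rw [normUnit_eq']
  simp only [linForm, map_sub, map_mul]
  ring

lemma X_mul_C_normUnit : X * C (normUnit : Laurent) =
    C (coord 1 1) * linForm 0 - C (coord 1 0) * linForm 1 := by
  rw [normUnit_eq']
  simp only [linForm, map_sub, map_mul]
  ring

/-- Substitute `N = z₁₁ linForm 1 - z₁₂ linForm 0` in the last term: the `z₁₂` part cancels against
the derivative of `genPoly (a + 1) c`, and multiples of `z₁₁ genPoly a c` remain. The other three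
coordinates follow the same pattern. -/
lemma coord_00_mul_tc (a c n : ℕ) :
    (a + c + 1) * (coord 0 0 * tc a c n) =
      (n + 1) * tc (a + 1) c (n + 1) + c * (normUnit * tc a (c - 1) n) := by
  have h := natCast_mul_genPoly_right a c
  have key : ((a + c + 1 : ℕ) : Laurent[X]) * (C (coord 0 0) * genPoly a c) =
      derivative (genPoly (a + 1) c) + c * (C (normUnit : Laurent) * genPoly a (c - 1)) := by
    rw [derivative_genPoly, C_normUnit, Nat.add_sub_cancel, ← linForm_mul_genPoly_zero]
    push_cast
    linear_combination -C (coord 0 0) * h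
  have := congrArg (fun P => coeff P n) key
  simp only [coeff_add, coeff_natCast_mul', coeff_C_mul, coeff_derivative, coeff_genPoly] at this
  push_cast at this
  linear_combination this

lemma coord_01_mul_tc (a c n : ℕ) :
    (a + c + 1) * (coord 0 1 * tc a c n) =
      (n + 1) * tc a (c + 1) (n + 1) - a * (normUnit * tc (a - 1) c n) := by
  have h := natCast_mul_genPoly_left a c
  have key : ((a + c + 1 : ℕ) : Laurent[X]) * (C (coord 0 1) * genPoly a c) =
      derivative (genPoly a (c + 1)) - a * (C (normUnit : Laurent) * genPoly (a - 1) c) := by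
    rw [derivative_genPoly, C_normUnit, Nat.add_sub_cancel, ← linForm_mul_genPoly_one]
    push_cast
    linear_combination -C (coord 0 1) * h
  have := congrArg (fun P => coeff P n) key
  simp only [coeff_sub, coeff_natCast_mul', coeff_C_mul, coeff_derivative, coeff_genPoly] at this
  push_cast at this
  linear_combination this

lemma coord_10_mul_tc (a c n : ℕ) :
    (a + c + 1) * (coord 1 0 * tc a c n) =
      (a + c + 1 - n) * tc (a + 1) c n - c * (normUnit * (X * genPoly a (c - 1)).coeff n) := by
  have h := natCast_mul_genPoly_right a c
  have key : ((a + c + 1 : ℕ) : Laurent[X]) * (C (coord 1 0) * genPoly a c) =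
      (((a + 1 : ℕ) : Laurent[X]) * C (coord 1 0) * genPoly (a + 1 - 1) c
      + (c : Laurent[X]) * C (coord 1 1) * genPoly (a + 1) (c - 1))
       - (c : Laurent[X]) * (C (normUnit : Laurent) * (X * genPoly a (c - 1))) := by
    rw [Nat.add_sub_cancel, ← linForm_mul_genPoly_zero]
    push_cast
    linear_combination -C (coord 1 0) * h + (c : Laurent[X]) * genPoly a (c - 1) * X_mul_C_normUnit
  have := congrArg (fun P => coeff P n) key
  simp only [coeff_sub, coeff_euler] at this
  simp only [coeff_natCast_mul', coeff_C_mul, coeff_genPoly] at this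
  push_cast at this
  linear_combination this

lemma coord_11_mul_tc (a c n : ℕ) :
    (a + c + 1) * (coord 1 1 * tc a c n) =
      (a + c + 1 - n) * tc a (c + 1) n + a * (normUnit * (X * genPoly (a - 1) c).coeff n) := by
  have h := natCast_mul_genPoly_left a c
  have key : ((a + c + 1 : ℕ) : Laurent[X]) * (C (coord 1 1) * genPoly a c) =
      ((a : Laurent[X]) * C (coord 1 0) * genPoly (a - 1) (c + 1)
      + ((c + 1 : ℕ) : Laurent[X]) * C (coord 1 1) * genPoly a (c + 1 - 1))
       + (a : Laurent[X]) * (C (normUnit : Laurent) * (X * genPoly (a - 1) c)) := by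
    rw [Nat.add_sub_cancel, ← linForm_mul_genPoly_one]
    push_cast
    linear_combination -C (coord 1 1) * h - (a : Laurent[X]) * genPoly (a - 1) c * X_mul_C_normUnit
  have := congrArg (fun P => coeff P n) key
  rw [coeff_add, coeff_euler] at this
  simp only [coeff_natCast_mul', coeff_C_mul, coeff_genPoly] at this
  push_cast at this
  linear_combination this

/-! ### Powers of the norm under the derivations -/

/-- The power `N(Z) ^ k`. -/
def nz (k : ℤ) : Laurent := ((normUnit ^ k : Laurentˣ) : Laurent)

@[simp] lemma nz_zero : nz 0 = 1 := by simp [nz]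

lemma nz_add (j k : ℤ) : nz (j + k) = nz j * nz k := by simp [nz, zpow_add]

lemma nz_add_one (k : ℤ) : nz (k + 1) = nz k * normUnit := by simp [nz, zpow_add]

lemma nz_sub_one_mul (k : ℤ) : nz (k - 1) * normUnit = nz k := by
  rw [← nz_add_one, sub_add_cancel]

lemma nz_neg_mul (k : ℤ) : nz (-k) * nz k = 1 := by rw [← nz_add]; simp

lemma natCast_mul_eq (n : ℕ) (f : Laurent) : (n : Laurent) * f = (n : ℂ) • f := by
  simp [Algebra.smul_def]

lemma intCast_mul_eq (n : ℤ) (f : Laurent) : (n : Laurent) * f = (n : ℂ) • f := by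
  simp [Algebra.smul_def]

lemma derivation_nz (D : Derivation ℂ Laurent Laurent) (k : ℤ) :
    D (nz k) = k * nz (k - 1) * D normUnit := by
  have hstep : ∀ j : ℤ, D (nz (j + 1)) = nz j * D normUnit + normUnit * D (nz j) := by
    intro j
    rw [nz_add_one, Derivation.leibniz, smul_eq_mul, smul_eq_mul]
  induction k using Int.induction_on with
  | zero => simp
  | succ k ih =>
    rw [hstep, ih, add_sub_cancel_right]
    push_cast
    linear_combination ((k : Laurent) * D normUnit) * nz_sub_one_mul k
  | pred k ih =>
    have h1 := hstep (-k - 1)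
    have h2 := nz_sub_one_mul (-k - 1)
    rw [sub_add_cancel, ih] at h1
    -- The Leibniz rule for `N^j · N` gives `D (N^j)` only after multiplication by `N`, which is a
    -- unit.
    refine normUnit.isUnit.mul_left_cancel ?_
    push_cast at h1 ⊢
    linear_combination -h1 + ((k : Laurent) + 1) * D normUnit * h2

lemma derivation_nz_mul (D : Derivation ℂ Laurent Laurent) (k : ℤ) (f : Laurent) :
    D (nz k * f) = nz k * D f + k * nz (k - 1) * D normUnit * f := by
  rw [Derivation.leibniz, derivation_nz, smul_eq_mul, smul_eq_mul]
  ring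

/-- The sign of the entry `(i, j)` in the adjugate of a matrix of size 2. -/
def sgn (i j : Fin 2) : Laurent := if i = j then 1 else -1

lemma sgn_mul_self (i j : Fin 2) : sgn i j * sgn i j = 1 := by
  unfold sgn; split_ifs <;> ring

lemma partialZ_normUnit (i j : Fin 2) :
    partialZ i j normUnit = sgn i j * coord (i + 1) (j + 1) := by
  rw [normUnit_eq']
  fin_cases i <;> fin_cases j <;> simp [partialZ_coord, sgn]

lemma rowD_normUnit (i j : Fin 2) : rowD i j normUnit =
    if i = j then (normUnit : Laurent) else 0 := by
  rw [normUnit_eq']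
  fin_cases i <;> fin_cases j <;> simp [rowD_coord] <;> ring

lemma colD_normUnit (i j : Fin 2) : colD i j normUnit =
    if i = j then (normUnit : Laurent) else 0 := by
  rw [normUnit_eq']
  fin_cases i <;> fin_cases j <;> simp [colD_coord] <;> ring

lemma rowD_nz_mul (i j : Fin 2) (k : ℤ) (f : Laurent) :
    rowD i j (nz k * f) = nz k * rowD i j f + (if i = j then (k : Laurent) else 0) * (nz k * f) := by
  rw [derivation_nz_mul, rowD_normUnit]
  split_ifs
  · linear_combination (k : Laurent) * f * nz_sub_one_mul k
  · ring

lemma colD_nz_mul (i j : Fin 2) (k : ℤ) (f : Laurent) :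
    colD i j (nz k * f) = nz k * colD i j f + (if i = j then (k : Laurent) else 0) * (nz k * f) := by
  rw [derivation_nz_mul, colD_normUnit]
  split_ifs
  · linear_combination (k : Laurent) * f * nz_sub_one_mul k
  · ring

/-- The Euler operator. -/
def euler : Derivation ℂ Laurent Laurent := rowD 0 0 + rowD 1 1

lemma euler_coord (i j : Fin 2) : euler (coord i j) = coord i j := by
  fin_cases i <;> simp [euler, rowD_coord]

lemma euler_tc (a c n : ℕ) : euler (tc a c n) = (a + c) * tc a c n := by
  rw [euler, Derivation.add_apply, rowD_tc_00, rowD_tc_11]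
  ring

lemma euler_nz_mul (k : ℤ) (f : Laurent) :
    euler (nz k * f) = nz k * euler f + 2 * k * (nz k * f) := by
  simp only [euler, Derivation.add_apply, rowD_nz_mul, if_true]
  ring

/-- The entry `z_ki z_jl` of `Z E Z` differs from `z_ji z_kl` by a minor of `Z`, which is `± N` for
the single entry `(k, l) = (j + 1, i + 1)` and zero otherwise. -/
lemma quadD_eq (i j : Fin 2) (f : Laurent) :
    quadD i j f = coord j i * euler f
      - sgn i j * (normUnit * partialZ (j + 1) (i + 1) f) := by
  have : quadD i j = coord j i • euler
      - (sgn i j * normUnit : Laurent) • partialZ (j + 1) (i + 1) := by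
    apply derivation_ext
    intro k l
    simp only [Derivation.sub_apply, Derivation.smul_apply, euler_coord, quadD_coord,
      partialZ_coord, smul_eq_mul, normUnit_eq', sgn]
    fin_cases i <;> fin_cases j <;> fin_cases k <;> fin_cases l <;> simp <;> ring
  rw [this]
  simp only [Derivation.sub_apply, Derivation.smul_apply, smul_eq_mul]
  ring

/-- The Euler operator contributes `2k + L`, and the derivative of `N^k` takes `k` away again. -/
lemma quadD_nz_mul (i j : Fin 2) (k : ℤ) {L : ℕ} {f : Laurent} (hf : euler f = L * f) :
    quadD i j (nz k * f) = (k + L) * (nz k * (coord j i * f))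
      - sgn i j * (nz (k + 1) * partialZ (j + 1) (i + 1) f) := by
  have h1 : ∀ x : Fin 2, x + 1 + 1 = x := by decide
  have h2 : sgn (j + 1) (i + 1) = sgn i j := by fin_cases i <;> fin_cases j <;> simp [sgn]
  rw [quadD_eq, euler_nz_mul, hf, derivation_nz_mul, partialZ_normUnit, h1, h1, h2, nz_add_one]
  linear_combination -(k : Laurent) * f * coord j i * nz_sub_one_mul k -
    (normUnit : Laurent) * k * nz (k - 1) * coord j i * f * sgn_mul_self i j

/-! ### Harmonic polynomials and the four transitions between `K`-types -/

/-- The space of harmonic polynomials that are homogeneous of degree `L`. -/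
def harm (L : ℕ) : Submodule ℂ Laurent :=
  Submodule.span ℂ {f | ∃ a c n, a + c = L ∧ f = tc a c n}

lemma tc_mem_harm {a c L : ℕ} (n : ℕ) (h : a + c = L) : tc a c n ∈ harm L :=
  Submodule.subset_span ⟨a, c, n, h, rfl⟩

lemma coeff_X_mul_genPoly_mem_harm {a c L : ℕ} (n : ℕ) (h : a + c = L) :
    (X * genPoly a c).coeff n ∈ harm L := by
  rcases n with _ | n
  · simp
  · rw [coeff_X_mul]
    exact tc_mem_harm n h

lemma harm_induction {L : ℕ} {p : Laurent → Prop} (h : ∀ a c n, a + c = L → p (tc a c n))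
    (h0 : p 0) (hadd : ∀ f g, p f → p g → p (f + g)) (hsmul : ∀ (r : ℂ) f, p f → p (r • f))
    {f : Laurent} (hf : f ∈ harm L) : p f := by
  induction hf using Submodule.span_induction with
  | mem x hx => obtain ⟨a, c, n, hL, rfl⟩ := hx; exact h a c n hL
  | zero => exact h0
  | add x y _ _ hx hy => exact hadd _ _ hx hy
  | smul r x _ hx => exact hsmul r x hx

lemma derivation_mem_harm {D : Derivation ℂ Laurent Laurent} {L L' : ℕ}
    (h : ∀ a c n, a + c = L → D (tc a c n) ∈ harm L') {f : Laurent} (hf : f ∈ harm L) :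
    D f ∈ harm L' := by
  have : harm L ≤ (harm L').comap (D : Laurent →ₗ[ℂ] Laurent) := by
    refine Submodule.span_le.mpr ?_
    rintro _ ⟨a, c, n, hL, rfl⟩
    exact h a c n hL
  exact this hf

lemma natCast_mul_mem {U : Submodule ℂ Laurent} (n : ℕ) {f : Laurent} (hf : f ∈ U) :
    (n : Laurent) * f ∈ U := by
  rw [natCast_mul_eq]
  exact U.smul_mem _ hf

lemma intCast_mul_mem {U : Submodule ℂ Laurent} (n : ℤ) {f : Laurent} (hf : f ∈ U) :
    (n : Laurent) * f ∈ U := by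
  rw [intCast_mul_eq]
  exact U.smul_mem _ hf

lemma mem_of_intCast_mul_mem {U : Submodule ℂ Laurent} {n : ℤ} (hn : n ≠ 0) {f : Laurent}
    (hf : (n : Laurent) * f ∈ U) : f ∈ U := by
  rw [intCast_mul_eq] at hf
  exact (U.smul_mem_iff (by exact_mod_cast hn)).mp hf

lemma partialZ_mem_harm (i j : Fin 2) {L : ℕ} {f : Laurent} (hf : f ∈ harm (L + 1)) :
    partialZ i j f ∈ harm L := by
  refine derivation_mem_harm ?_ hf
  intro a c n hL
  have ha : (a : Laurent) * tc (a - 1) c n ∈ harm L := by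
    rcases a with _ | a
    · simp
    · exact natCast_mul_mem _ (tc_mem_harm _ (by omega))
  have hc : (c : Laurent) * tc a (c - 1) n ∈ harm L := by
    rcases c with _ | c
    · simp
    · exact natCast_mul_mem _ (tc_mem_harm _ (by omega))
  have ha' : (a : Laurent) * (X * genPoly (a - 1) c).coeff n ∈ harm L := by
    rcases a with _ | a
    · simp
    · exact natCast_mul_mem _ (coeff_X_mul_genPoly_mem_harm _ (by omega))
  have hc' : (c : Laurent) * (X * genPoly a (c - 1)).coeff n ∈ harm L := by
    rcases c with _ | c
    · simp
    · exact natCast_mul_mem _ (coeff_X_mul_genPoly_mem_harm _ (by omega))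
  fin_cases i <;> fin_cases j
  · exact (partialZ_tc_00 a c n).symm ▸ ha'
  · exact (partialZ_tc_01 a c n).symm ▸ hc'
  · exact (partialZ_tc_10 a c n).symm ▸ ha
  · exact (partialZ_tc_11 a c n).symm ▸ hc

lemma partialZ_harm_zero (i j : Fin 2) {f : Laurent} (hf : f ∈ harm 0) : partialZ i j f = 0 := by
  refine harm_induction (p := fun f => partialZ i j f = 0) ?_ (map_zero _)
    (fun f g hf hg => by rw [map_add, hf, hg, add_zero])
    (fun r f hf => by rw [Derivation.map_smul, hf, smul_zero]) hf
  intro a c n h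
  obtain ⟨rfl, rfl⟩ : a = 0 ∧ c = 0 := by omega
  fin_cases i <;> fin_cases j
  · simpa using partialZ_tc_00 0 0 n
  · simpa using partialZ_tc_01 0 0 n
  · simpa using partialZ_tc_10 0 0 n
  · simpa using partialZ_tc_11 0 0 n

lemma colD_mem_harm (i j : Fin 2) {L : ℕ} {f : Laurent} (hf : f ∈ harm L) :
    colD i j f ∈ harm L := by
  refine derivation_mem_harm ?_ hf
  intro a c n hL
  fin_cases i <;> fin_cases j
  · exact (colD_tc_00 a c n).symm ▸ natCast_mul_mem _ (tc_mem_harm _ hL)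
  · refine (colD_tc_01 a c n).symm ▸ ?_
    rcases c with _ | c
    · simp
    · exact natCast_mul_mem _ (tc_mem_harm _ (by omega))
  · refine (colD_tc_10 a c n).symm ▸ ?_
    rcases a with _ | a
    · simp
    · exact natCast_mul_mem _ (tc_mem_harm _ (by omega))
  · exact (colD_tc_11 a c n).symm ▸ natCast_mul_mem _ (tc_mem_harm _ hL)

lemma rowD_mem_harm (i j : Fin 2) {L : ℕ} {f : Laurent} (hf : f ∈ harm L) :
    rowD i j f ∈ harm L := by
  have hsub : ∀ a c n m : ℕ, a + c = L → ((a : Laurent) + c - n) * tc a c m ∈ harm L := by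
    intro a c n m h
    have := intCast_mul_mem (a + c - n : ℤ) (tc_mem_harm m h)
    push_cast at this
    exact this
  refine derivation_mem_harm ?_ hf
  intro a c n hL
  fin_cases i <;> fin_cases j
  · exact (rowD_tc_00 a c n).symm ▸ natCast_mul_mem _ (tc_mem_harm _ hL)
  · rcases n with _ | n
    · exact (rowD_tc_01_zero a c).symm ▸ Submodule.zero_mem _
    · exact (rowD_tc_01 a c n).symm ▸ hsub _ _ _ _ hL
  · have := natCast_mul_mem (n + 1) (tc_mem_harm (n + 1) hL)
    push_cast at this
    exact (rowD_tc_10 a c n).symm ▸ this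
  · exact (rowD_tc_11 a c n).symm ▸ hsub _ _ _ _ hL

lemma euler_harm {L : ℕ} {f : Laurent} (hf : f ∈ harm L) : euler f = L * f := by
  refine harm_induction (p := fun f => euler f = L * f) ?_ (by simp)
    (fun f g hf hg => by rw [map_add, hf, hg, mul_add])
    (fun r f hf => by rw [Derivation.map_smul, hf, mul_smul_comm]) hf
  rintro a c n rfl
  rw [euler_tc, Nat.cast_add]

/-- The decomposition of the product of a coordinate and a harmonic polynomial. -/
lemma exists_coord_mul_harm (i j : Fin 2) {L : ℕ} {f : Laurent} (hf : f ∈ harm L) :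
    ∃ h ∈ harm (L + 1), (L + 1) * (coord i j * f) =
      h + sgn i j * (normUnit * partialZ (i + 1) (j + 1) f) := by
  have hsub : ∀ a c n m : ℕ, a + c = L + 1 →
      ((L : Laurent) + 1 - n) * tc a c m ∈ harm (L + 1) := by
    intro a c n m h
    have := intCast_mul_mem (L + 1 - n : ℤ) (tc_mem_harm m h)
    push_cast at this
    exact this
  have hadd : ∀ a c n m : ℕ, a + c = L + 1 →
      ((n : Laurent) + 1) * tc a c m ∈ harm (L + 1) := by
    intro a c n m h
    have := natCast_mul_mem (n + 1) (tc_mem_harm m h)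
    push_cast at this
    exact this
  -- The factor `L + 1` is forced: `□ (z f)` is `± 4 ∂f`, while `□ (N g) = 4 (L + 1) g` for harmonic
  -- `g` of degree `L - 1`.
  refine harm_induction (p := fun f => ∃ h ∈ harm (L + 1), (L + 1) * (coord i j * f) =
      h + sgn i j * (normUnit * partialZ (i + 1) (j + 1) f)) ?_ ⟨0, by simp, by simp⟩ ?_ ?_ hf
  · intro a c n h
    have hL : (L : Laurent) = a + c := by rw [← h, Nat.cast_add]
    fin_cases i <;> fin_cases j
    · refine ⟨_, hadd (a + 1) c n (n + 1) (by omega), ?_⟩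
      have h1 := coord_00_mul_tc a c n
      have h2 := partialZ_tc_11 a c n
      simp [sgn, hL]
      linear_combination h1 - normUnit * h2
    · refine ⟨_, hadd a (c + 1) n (n + 1) (by omega), ?_⟩
      have h1 := coord_01_mul_tc a c n
      have h2 := partialZ_tc_10 a c n
      simp [sgn, hL]
      linear_combination h1 + normUnit * h2
    · refine ⟨_, hsub (a + 1) c n n (by omega), ?_⟩
      have h1 := coord_10_mul_tc a c n
      have h2 := partialZ_tc_01 a c n
      simp [sgn, hL, - mul_coeff_zero]
      linear_combination h1 + normUnit * h2
    · refine ⟨_, hsub a (c + 1) n n (by omega), ?_⟩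
      have h1 := coord_11_mul_tc a c n
      have h2 := partialZ_tc_00 a c n
      simp [sgn, hL]
      linear_combination h1 - normUnit * h2
  · rintro f g ⟨h, hh, hf⟩ ⟨h', hh', hg⟩
    refine ⟨h + h', Submodule.add_mem _ hh hh', ?_⟩
    rw [map_add]
    linear_combination hf + hg
  · rintro r f ⟨h, hh, hf⟩
    refine ⟨r • h, Submodule.smul_mem _ r hh, ?_⟩
    rw [Derivation.map_smul, mul_smul_comm, mul_smul_comm, hf]
    simp only [smul_add, mul_smul_comm]

/-- Since `∂N` is up to sign the opposite coordinate, the product rule leaves a product of a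
coordinate with `f`. Its `N ∂f` part adds `k` to the coefficient `L + 1`. The move to `(k, L - 1)`
is thus blocked only at `k + L + 1 = 0`, the move to `(k - 1, L + 1)` only at `k = 0`. -/
lemma exists_partialZ_nz_mul (i j : Fin 2) (k : ℤ) {L : ℕ} {f : Laurent} (hf : f ∈ harm L) :
    ∃ h ∈ harm (L + 1), (L + 1) * partialZ i j (nz k * f) =
      (k + L + 1) * (nz k * partialZ i j f) + k * (nz (k - 1) * h) := by
  obtain ⟨h, hh, e⟩ := exists_coord_mul_harm (i + 1) (j + 1) hf
  have h1 : ∀ x : Fin 2, x + 1 + 1 = x := by decide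
  have h2 : sgn (i + 1) (j + 1) = sgn i j := by fin_cases i <;> fin_cases j <;> simp [sgn]
  rw [h1, h1, h2] at e
  have hs : sgn i j * h ∈ harm (L + 1) := by
    unfold sgn; split_ifs <;> simpa
  refine ⟨_, hs, ?_⟩
  rw [derivation_nz_mul, partialZ_normUnit]
  linear_combination (k : Laurent) * nz (k - 1) * sgn i j * e
    + (k : Laurent) * nz (k - 1) * normUnit * partialZ i j f * sgn_mul_self i j
    + (k : Laurent) * partialZ i j f * nz_sub_one_mul k

/-- The coefficient of `N^(k+1) ∂f` is `(k + L) - (L + 1) = k - 1`. So the move to `(k, L + 1)` is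
blocked only at `k + L = 0`, the move to `(k + 1, L - 1)` only at `k = 1`. -/
lemma exists_quadD_nz_mul (i j : Fin 2) (k : ℤ) {L : ℕ} {f : Laurent} (hf : f ∈ harm L) :
    ∃ h ∈ harm (L + 1), (L + 1) * quadD i j (nz k * f) =
      (k + L) * (nz k * h) + (k - 1) * (sgn i j * (nz (k + 1) * partialZ (j + 1) (i + 1) f)) := by
  obtain ⟨h, hh, e⟩ := exists_coord_mul_harm j i hf
  have h2 : sgn j i = sgn i j := by simp [sgn, eq_comm]
  refine ⟨h, hh, ?_⟩
  rw [h2] at e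
  rw [quadD_nz_mul i j k (euler_harm hf), nz_add_one]
  linear_combination ((k : Laurent) + L) * nz k * e

/-! ### The functions `N^k t^l` span the ring -/

lemma coeff_genPoly_eq_zero {a c n : ℕ} (h : a + c < n) : tc a c n = 0 := by
  refine coeff_eq_zero_of_natDegree_lt (lt_of_le_of_lt ?_ h)
  have hl : ∀ j, (linForm j).natDegree ≤ 1 := by
    intro j
    unfold linForm
    compute_degree
  refine natDegree_mul_le.trans (add_le_add ?_ ?_)
  · simpa using natDegree_pow_le_of_le a (hl 0)
  · simpa using natDegree_pow_le_of_le c (hl 1)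

/-- Bridges the unrestricted index of `tc` and the bounded indices of `tCoeff`: beyond the bound the
coefficient vanishes by degree. -/
lemma tc_mem_range_tCoeff {a c L : ℕ} (n : ℕ) (h : a + c = L) :
    tc a c n = 0 ∨ ∃ x y : Fin (L + 1), tc a c n = tCoeff L x y := by
  subst h
  rcases lt_or_ge (a + c) n with hn | hn
  · exact Or.inl (coeff_genPoly_eq_zero hn)
  · refine Or.inr ⟨⟨a, by omega⟩, ⟨n, by omega⟩, ?_⟩
    rw [tCoeff_eq_tc]
    simp

lemma nz_mul_mem_kSpan {P : ℤ → ℤ → Prop} {k : ℤ} {L : ℕ} (hP : P k L) {f : Laurent}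
    (hf : f ∈ harm L) : nz k * f ∈ kSpan P := by
  have : harm L ≤ (kSpan P).comap (LinearMap.mulLeft ℂ (nz k)) := by
    refine Submodule.span_le.mpr ?_
    rintro _ ⟨a, c, n, hL, rfl⟩
    rcases tc_mem_range_tCoeff n hL with h | ⟨x, y, h⟩
    · simp [h]
    · exact Submodule.subset_span ⟨k, L, x, y, hP, by rw [h]; rfl⟩
  exact this hf

lemma tCoeff_mem_harm (L : ℕ) (a b : Fin (L + 1)) : tCoeff L a b ∈ harm L := by
  rw [tCoeff_eq_tc]
  exact tc_mem_harm _ (by omega)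

lemma kSpan_le {P : ℤ → ℤ → Prop} {U : Submodule ℂ Laurent}
    (h : ∀ (k : ℤ) (L : ℕ), P k L → ∀ f ∈ harm L, nz k * f ∈ U) : kSpan P ≤ U := by
  refine Submodule.span_le.mpr ?_
  rintro _ ⟨k, L, a, b, hP, rfl⟩
  exact h k L hP _ (tCoeff_mem_harm L a b)

lemma coord_mul_mem_kSpan_top (i j : Fin 2) {f : Laurent} (hf : f ∈ kSpan fun _ _ => True) :
    coord i j * f ∈ kSpan fun _ _ => True := by
  have : kSpan (fun _ _ => True) ≤
      (kSpan fun _ _ => True).comap (LinearMap.mulLeft ℂ (coord i j)) := by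
    refine kSpan_le fun k L _ f hf => ?_
    obtain ⟨h, hh, e⟩ := exists_coord_mul_harm i j hf
    rw [Submodule.mem_comap, LinearMap.mulLeft_apply]
    refine mem_of_intCast_mul_mem (n := L + 1) (by omega) ?_
    have : ((L + 1 : ℤ) : Laurent) * (coord i j * (nz k * f)) =
        nz k * h + sgn i j * (nz (k + 1) * partialZ (i + 1) (j + 1) f) := by
      rw [nz_add_one]
      push_cast
      linear_combination nz k * e
    rw [this]
    refine Submodule.add_mem _ (nz_mul_mem_kSpan trivial hh) ?_
    have h2 : nz (k + 1) * partialZ (i + 1) (j + 1) f ∈ kSpan fun _ _ => True := by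
      rcases L with _ | L
      · rw [partialZ_harm_zero _ _ hf]
        simp
      · exact nz_mul_mem_kSpan trivial (partialZ_mem_harm _ _ hf)
    unfold sgn
    split_ifs
    · simpa using h2
    · simpa using h2
  exact this hf

lemma nz_mul_mem_kSpan_top (j : ℤ) {f : Laurent} (hf : f ∈ kSpan fun _ _ => True) :
    nz j * f ∈ kSpan fun _ _ => True := by
  have : kSpan (fun _ _ => True) ≤
      (kSpan fun _ _ => True).comap (LinearMap.mulLeft ℂ (nz j)) := by
    refine kSpan_le fun k L _ f hf => ?_
    rw [Submodule.mem_comap, LinearMap.mulLeft_apply, ← mul_assoc, ← nz_add]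
    exact nz_mul_mem_kSpan trivial hf
  exact this hf

lemma one_eq_tc : (1 : Laurent) = tc 0 0 0 := by simp [tc, genPoly]

/-- The span contains `1` and is stable under the coordinates and all powers of `N`, so it contains
`N^(-m) p` for every polynomial `p`. -/
lemma kSpan_true : kSpan (fun _ _ => True) = ⊤ := by
  rw [eq_top_iff]
  intro f _
  have h1 : (1 : Laurent) ∈ kSpan fun _ _ => True := by
    have := nz_mul_mem_kSpan (P := fun _ _ => True) (k := 0) trivial (tc_mem_harm 0 (add_zero 0))
    rwa [nz_zero, one_mul, ← one_eq_tc] at this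
  have hp : ∀ p : MvPolynomial (Fin 2 × Fin 2) ℂ,
      algebraMap _ Laurent p ∈ kSpan fun _ _ => True := by
    intro p
    induction p using MvPolynomial.induction_on with
    | C a =>
      have : algebraMap (MvPolynomial (Fin 2 × Fin 2) ℂ) Laurent (MvPolynomial.C a) =
          a • (1 : Laurent) := by
        rw [← Algebra.algebraMap_eq_smul_one,
          IsScalarTower.algebraMap_apply ℂ (MvPolynomial (Fin 2 × Fin 2) ℂ) Laurent]
        rfl
      rw [this]
      exact Submodule.smul_mem _ _ h1
    | add p q hp hq => rw [map_add]; exact Submodule.add_mem _ hp hq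
    | mul_X p i hp =>
      rw [map_mul, mul_comm]
      exact coord_mul_mem_kSpan_top i.1 i.2 hp
  obtain ⟨⟨p, ⟨_, m, rfl⟩⟩, hs⟩ := IsLocalization.surj (Submonoid.powers normPoly) f
  have h2 : f * nz m = algebraMap _ Laurent p := by
    rw [← hs]
    simp [nz, normUnit]
  have h3 : f = nz (-m) * algebraMap _ Laurent p := by
    rw [← h2]
    linear_combination -f * nz_neg_mul m
  rw [h3]
  exact nz_mul_mem_kSpan_top _ (hp p)

/-! Invariant subspaces of the ring of polynomial functions -/

/-- Invariance of a subspace under all vector fields of the action `ρ'`. -/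
def Inv (U : Submodule ℂ Laurent) : Prop := ∀ X : GlHC, ∀ f ∈ U, derivAlong (vField X) f ∈ U

lemma derivAlong_vField_eq (X : GlHC) : derivAlong (vField X) =
    ∑ p, ∑ q, (X 1 0 p q • quadD p q + X 1 1 p q • colD p q - X 0 0 p q • rowD p q
      - X 0 1 p q • partialZ p q) := by
  apply derivation_ext
  intro i j
  rw [derivAlong_coord]
  simp only [Fin.sum_univ_two, Derivation.add_apply, Derivation.sub_apply, Derivation.smul_apply,
    quadD_coord, colD_coord, rowD_coord, partialZ_coord, vField, Matrix.add_apply,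
    Matrix.sub_apply, Matrix.mul_apply, Matrix.map_apply, Algebra.smul_def]
  fin_cases i <;> fin_cases j <;> simp <;> ring

lemma inv_iff {U : Submodule ℂ Laurent} : Inv U ↔ ∀ p q, ∀ f ∈ U,
    quadD p q f ∈ U ∧ colD p q f ∈ U ∧ rowD p q f ∈ U ∧ partialZ p q f ∈ U := by
  constructor
  · intro h p q f hf
    refine ⟨?_, ?_, ?_, ?_⟩
    · convert h (Matrix.single 1 0 (Matrix.single p q 1)) f hf using 2
      simp [vField, quadD]
    · convert h (Matrix.single 1 1 (Matrix.single p q 1)) f hf using 2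
      simp [vField, colD]
    -- The blocks `A` and `B` enter the vector field with a minus sign.
    · convert h (-Matrix.single 0 0 (Matrix.single p q 1)) f hf using 2
      rw [← neg_one_smul ℂ, vField_smul]
      simp [vField, rowD]
    · convert h (-Matrix.single 0 1 (Matrix.single p q 1)) f hf using 2
      rw [← neg_one_smul ℂ, vField_smul]
      simp [vField, partialZ, const]
  · intro h X f hf
    rw [derivAlong_vField_eq]
    simp only [Fin.sum_univ_two, Derivation.add_apply, Derivation.sub_apply, Derivation.smul_apply]
    have h1 := fun p q => U.smul_mem (X 1 0 p q) (h p q f hf).1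
    have h2 := fun p q => U.smul_mem (X 1 1 p q) (h p q f hf).2.1
    have h3 := fun p q => U.smul_mem (X 0 0 p q) (h p q f hf).2.2.1
    have h4 := fun p q => U.smul_mem (X 0 1 p q) (h p q f hf).2.2.2
    have h5 := fun p q => U.sub_mem (U.sub_mem (U.add_mem (h1 p q) (h2 p q)) (h3 p q)) (h4 p q)
    exact U.add_mem (U.add_mem (h5 0 0) (h5 0 1)) (U.add_mem (h5 1 0) (h5 1 1))

/-- Closure of a set of `K`-types under the transitions with nonzero coefficient. -/
structure TransClosed (P : ℤ → ℤ → Prop) : Prop where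
  left : ∀ (k : ℤ) (L : ℕ), P k L → k ≠ 0 → P (k - 1) (L + 1)
  down : ∀ (k : ℤ) (L : ℕ), P k (L + 1) → k + L + 2 ≠ 0 → P k L
  up : ∀ (k : ℤ) (L : ℕ), P k L → k + L ≠ 0 → P k (L + 1)
  right : ∀ (k : ℤ) (L : ℕ), P k (L + 1) → k ≠ 1 → P (k + 1) L

/-- The linear fields preserve each `K`-type, and the others move along the four transitions; a
neighbour that need not satisfy `P` occurs with coefficient zero. -/
lemma inv_kSpan {P : ℤ → ℤ → Prop} (hP : TransClosed P) : Inv (kSpan P) := by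
  have hle : ∀ D : Derivation ℂ Laurent Laurent, (∀ (k : ℤ) (L : ℕ), P k L → ∀ f ∈ harm L,
      D (nz k * f) ∈ kSpan P) → ∀ f ∈ kSpan P, D f ∈ kSpan P := fun D h f hf =>
    (kSpan_le h : kSpan P ≤ (kSpan P).comap (D : Laurent →ₗ[ℂ] Laurent)) hf
  refine inv_iff.mpr fun p q f hf => ⟨?_, ?_, ?_, ?_⟩
  · refine hle _ (fun k L hk f hf => ?_) f hf
    obtain ⟨h, hh, e⟩ := exists_quadD_nz_mul p q k hf
    refine mem_of_intCast_mul_mem (n := L + 1) (by omega) ?_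
    push_cast
    rw [e]
    refine Submodule.add_mem _ ?_ ?_
    · by_cases h0 : k + L = 0
      · have : (k : Laurent) + L = 0 := by exact_mod_cast congrArg (Int.cast (R := Laurent)) h0
        simp [this]
      · have := intCast_mul_mem (k + L) (nz_mul_mem_kSpan (P := P) (L := L + 1)
          (by simpa using hP.up k L hk h0) hh)
        push_cast at this
        exact this
    · by_cases h0 : k = 1
      · simp [h0]
      · rcases L with _ | L
        · simp [partialZ_harm_zero _ _ hf]
        · have := intCast_mul_mem (k - 1) (nz_mul_mem_kSpan (P := P) (L := L)
            (hP.right k L (by simpa using hk) h0) (partialZ_mem_harm (q + 1) (p + 1) hf))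
          push_cast at this
          unfold sgn
          split_ifs
          · simpa using this
          · simpa using this
  · refine hle _ (fun k L hk f hf => ?_) f hf
    rw [colD_nz_mul]
    refine Submodule.add_mem _ (nz_mul_mem_kSpan hk (colD_mem_harm _ _ hf)) ?_
    split_ifs
    · exact intCast_mul_mem _ (nz_mul_mem_kSpan hk hf)
    · simp
  · refine hle _ (fun k L hk f hf => ?_) f hf
    rw [rowD_nz_mul]
    refine Submodule.add_mem _ (nz_mul_mem_kSpan hk (rowD_mem_harm _ _ hf)) ?_
    split_ifs
    · exact intCast_mul_mem _ (nz_mul_mem_kSpan hk hf)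
    · simp
  · refine hle _ (fun k L hk f hf => ?_) f hf
    obtain ⟨h, hh, e⟩ := exists_partialZ_nz_mul p q k hf
    refine mem_of_intCast_mul_mem (n := L + 1) (by omega) ?_
    push_cast
    rw [e]
    refine Submodule.add_mem _ ?_ ?_
    · rcases L with _ | L
      · simp [partialZ_harm_zero _ _ hf]
      -- The degree is now `L + 1`, so the coefficient degree `+ k + 1` reads `k + L + 2`.
      · by_cases h0 : k + L + 2 = 0
        · have : (k : Laurent) + L + 2 = 0 := by
            exact_mod_cast congrArg (Int.cast (R := Laurent)) h0
          have : (k : Laurent) + (L + 1 : ℕ) + 1 = 0 := by push_cast; linear_combination this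
          rw [this, zero_mul]
          exact Submodule.zero_mem _
        · have := intCast_mul_mem (k + (L + 1 : ℕ) + 1) (nz_mul_mem_kSpan (P := P) (L := L)
            (hP.down k L (by simpa using hk) h0) (partialZ_mem_harm p q hf))
          push_cast at this ⊢
          exact this
    · by_cases h0 : k = 0
      · simp [h0]
      · exact intCast_mul_mem _ (nz_mul_mem_kSpan (L := L + 1)
          (by simpa using hP.left k L hk h0) hh)

/-- The matrix units of `gl(2) × gl(2)` act transitively on the basis of a `K`-type. -/
lemma ladder {U : Submodule ℂ Laurent}
    (hU : ∀ p q, ∀ f ∈ U, colD p q f ∈ U ∧ rowD p q f ∈ U) {k : ℤ} {a c n a' c' n' : ℕ}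
    (hn : n ≤ a + c) (h' : a' + c' = a + c) (h : nz k * tc a c n ∈ U) :
    nz k * tc a' c' n' ∈ U := by
  have key : ∀ m : ℕ, m ≠ 0 → ∀ f g : Laurent, f = (m : Laurent) * g → nz k * f ∈ U →
      nz k * g ∈ U := by
    rintro m hm f g rfl hf
    refine mem_of_intCast_mul_mem (n := m) (by exact_mod_cast hm) ?_
    push_cast
    rwa [mul_left_comm] at hf
  -- Off-diagonal matrix units annihilate `N`, so `N^k` passes through, and the integers that appear
  -- are nonzero.
  have h1 : ∀ a c n, nz k * tc a (c + 1) n ∈ U → nz k * tc (a + 1) c n ∈ U := by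
    intro a c n h
    have := (hU 0 1 _ h).1
    rw [colD_nz_mul, colD_tc_01] at this
    exact key (c + 1) (by omega) _ _ rfl (by simpa using this)
  have h2 : ∀ a c n, nz k * tc (a + 1) c n ∈ U → nz k * tc a (c + 1) n ∈ U := by
    intro a c n h
    have := (hU 1 0 _ h).1
    rw [colD_nz_mul, colD_tc_10] at this
    exact key (a + 1) (by omega) _ _ rfl (by simpa using this)
  have h3 : ∀ a c n, nz k * tc a c n ∈ U → nz k * tc a c (n + 1) ∈ U := by
    intro a c n h
    have := (hU 1 0 _ h).2
    rw [rowD_nz_mul, rowD_tc_10] at this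
    exact key (n + 1) (by omega) _ _ rfl (by simpa using this)
  have h4 : ∀ a c n, n < a + c → nz k * tc a c (n + 1) ∈ U → nz k * tc a c n ∈ U := by
    intro a c n hn h
    have := (hU 0 1 _ h).2
    rw [rowD_nz_mul, rowD_tc_01] at this
    refine key (a + c - n) (by omega) ((a + c - n) * tc a c n) _ ?_ (by simpa using this)
    rw [Nat.cast_sub hn.le, Nat.cast_add]
  have h5 : ∀ c a n, nz k * tc a c n ∈ U ↔ nz k * tc (a + c) 0 n ∈ U := by
    intro c
    induction c with
    | zero => intro a n; rfl
    | succ c ih =>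
      intro a n
      rw [show a + (c + 1) = a + 1 + c by ring, ← ih]
      exact ⟨h1 a c n, h2 a c n⟩
  -- Descend to index `0`, then climb to `n'`. The bound on `n` keeps the descending coefficients
  -- nonzero; `n'` needs no bound, since past `a + c` only zero is reached.
  have h6 : nz k * tc a c 0 ∈ U := by
    induction n with
    | zero => exact h
    | succ n ih => exact ih (by omega) (h4 _ _ _ (by omega) h)
  have h7 : nz k * tc a c n' ∈ U := by
    induction n' with
    | zero => exact h6
    | succ n ih => exact h3 _ _ _ ih
  rw [h5, h', ← h5]
  exact h7

lemma tc_lowest (L : ℕ) : tc 0 L 0 = coord 1 1 ^ L := by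
  simp [tc, genPoly, linForm, coeff_zero_eq_eval_zero]

/-- If this vector vanished, `ladder` for the zero subspace would give `N^k z₂₂^(a+c) = 0`, which
fails at `Z = 1`. -/
lemma nz_mul_tc_ne_zero (k : ℤ) {a c n : ℕ} (hn : n ≤ a + c) : nz k * tc a c n ≠ 0 := by
  intro h
  have h1 := ladder (U := ⊥) (k := k) (a' := 0) (c' := a + c) (n' := 0) (by simp) hn
    (zero_add _) (by rw [h]; exact Submodule.zero_mem _)
  rw [Submodule.mem_bot, tc_lowest] at h1
  obtain ⟨φ, -, hφ⟩ := exists_evalAt_hom 1 (by simp)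
  have h2 := congrArg φ (congrArg (nz (-k) * ·) h1)
  simp only [← mul_assoc, nz_neg_mul, one_mul, mul_zero, map_pow, hφ, map_zero] at h2
  simp at h2

/-! Separation of joint eigenvectors -/

/-- The operator `ops t - wt t i` preserves `U`, kills `e i`, and rescales `e i₀` by a nonzero
number when `t` separates `i` from `i₀`. Summands are removed one by one; the coefficients stay
general because each removal rescales them. -/
lemma smul_mem_of_joint_eigen {M ι τ : Type*} [AddCommGroup M] [Module ℂ M]
    {U : Submodule ℂ M} (ops : τ → M →ₗ[ℂ] M) (hU : ∀ t, ∀ f ∈ U, ops t f ∈ U)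
    {e : ι → M} {wt : τ → ι → ℂ} (he : ∀ t i, ops t (e i) = wt t i • e i)
    (hsep : ∀ i j, (∀ t, wt t i = wt t j) → i = j) (i₀ : ι) (s : Finset ι) (hs : i₀ ∉ s)
    (c : ι → ℂ) (h : c i₀ • e i₀ + ∑ i ∈ s, c i • e i ∈ U) : c i₀ • e i₀ ∈ U := by
  classical
  induction s using Finset.induction_on generalizing c with
  | empty => simpa using h
  | insert i s hi ih =>
    rw [Finset.mem_insert, not_or] at hs
    obtain ⟨t, ht⟩ : ∃ t, wt t i₀ ≠ wt t i := by
      by_contra hcon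
      push Not at hcon
      exact hs.1 (hsep _ _ hcon)
    have h1 := U.sub_mem (hU t _ h) (U.smul_mem (wt t i) h)
    have h2 := ih hs.2 (fun j => (wt t j - wt t i) * c j) (by
      convert h1 using 1
      rw [Finset.sum_insert hi]
      simp only [map_add, map_sum, map_smul, he, smul_add, Finset.smul_sum, smul_smul, sub_mul,
        sub_smul, Finset.sum_sub_distrib]
      simp only [mul_comm (c _)]
      abel)
    rw [mul_smul] at h2
    exact (U.smul_mem_iff (sub_ne_zero.mpr ht)).mp h2

/-! ### The basis of functions `N^k t^l` -/

/-- The index set of the basis of functions `N(Z) ^ k * t^l_{n m}(Z)`. -/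
abbrev Idx : Type := Σ p : ℤ × ℕ, Fin (p.2 + 1) × Fin (p.2 + 1)

/-- The functions `N(Z) ^ k * t^l_{n m}(Z)`. -/
def fam (i : Idx) : Laurent := nz i.1.1 * tCoeff i.1.2 i.2.1 i.2.2

lemma fam_ne_zero (i : Idx) : fam i ≠ 0 := nz_mul_tc_ne_zero _ (by omega)

/-- The operators used to separate the functions `N(Z) ^ k * t^l_{n m}(Z)`. -/
def sepOp : Fin 4 → Laurent →ₗ[ℂ] Laurent :=
  ![(rowD 0 0 : Laurent →ₗ[ℂ] Laurent), (rowD 1 1 : Laurent →ₗ[ℂ] Laurent),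
    (colD 0 0 : Laurent →ₗ[ℂ] Laurent),
    (rowD 0 0 : Laurent →ₗ[ℂ] Laurent) ∘ₗ (rowD 1 1 : Laurent →ₗ[ℂ] Laurent)
      - (rowD 0 1 : Laurent →ₗ[ℂ] Laurent) ∘ₗ (rowD 1 0 : Laurent →ₗ[ℂ] Laurent)
      + (rowD 1 1 : Laurent →ₗ[ℂ] Laurent)]

/-- The eigenvalues of the operators `sepOp`. -/
def sepWt (t : Fin 4) (i : Idx) : ℤ :=
  ![i.1.1 + (i.2.2 : ℕ), i.1.1 + i.1.2 - (i.2.2 : ℕ), i.1.1 + (i.2.1 : ℕ),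
    i.1.1 * (i.1.1 + i.1.2 + 1)] t

lemma sepWt_injective (i j : Idx) (h : ∀ t, sepWt t i = sepWt t j) : i = j := by
  obtain ⟨⟨k, L⟩, a, b⟩ := i
  obtain ⟨⟨k', L'⟩, a', b'⟩ := j
  have h0 := h 0
  have h1 := h 1
  have h2 := h 2
  have h3 := h 3
  simp only [sepWt] at h0 h1 h2 h3
  simp at h0 h1 h2 h3
  have hk : k = k' := by
    have h4 : (L : ℤ) = 2 * k' + L' - 2 * k := by linarith
    rw [h4] at h3
    -- The first two weights fix `2k + L`, which turns the last one into a quadratic equation for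
    -- `k`. Its second root `k' + L' + 1` would give `L = -L' - 2 < 0`.
    have h5 : (k - k') * (k' + L' + 1 - k) = 0 := by linarith
    rcases mul_eq_zero.mp h5 with h | h <;> omega
  subst hk
  obtain rfl : L = L' := by omega
  obtain rfl : a = a' := by ext; omega
  obtain rfl : b = b' := by ext; omega
  rfl

/-- The fourth operator is the Capelli element, which acts as `N □ / 4`; written with `rowD` it
visibly preserves invariant subspaces. Its eigenvalue is `(k + b)(k + L - b) - (b + 1)(L - b) + (k +
L - b) = k (k + L + 1)`. -/
lemma sepOp_fam (t : Fin 4) (i : Idx) : sepOp t (fam i) = (sepWt t i : ℂ) • fam i := by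
  obtain ⟨⟨k, L⟩, a, b⟩ := i
  rw [← intCast_mul_eq]
  simp only [fam, tCoeff_eq_tc]
  have hL : (((L - (a : ℕ) : ℕ) : ℕ) : Laurent) = L - (a : ℕ) := Nat.cast_sub (by omega)
  have r0 : rowD 0 0 (nz k * tc a (L - a) b) = (k + (b : ℕ)) * (nz k * tc a (L - a) b) := by
    rw [rowD_nz_mul, rowD_tc_00, if_pos rfl]; ring
  have r1 : rowD 1 1 (nz k * tc a (L - a) b) =
      (((k + L - (b : ℕ) : ℤ) : ℂ)) • (nz k * tc a (L - a) b) := by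
    rw [rowD_nz_mul, rowD_tc_11, if_pos rfl, hL, ← intCast_mul_eq]; push_cast; ring
  have r2 : rowD 1 0 (nz k * tc a (L - a) b) =
      ((b + 1 : ℕ) : ℂ) • (nz k * tc a (L - a) (b + 1)) := by
    rw [rowD_nz_mul, rowD_tc_10, if_neg (by decide), ← natCast_mul_eq]; push_cast; ring
  have r3 : rowD 0 1 (nz k * tc a (L - a) (b + 1)) =
      (L - (b : ℕ)) * (nz k * tc a (L - a) b) := by
    rw [rowD_nz_mul, rowD_tc_01, if_neg (by decide), hL]; ring
  have r4 : colD 0 0 (nz k * tc a (L - a) b) = (k + (a : ℕ)) * (nz k * tc a (L - a) b) := by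
    rw [colD_nz_mul, colD_tc_00, if_pos rfl]; ring
  fin_cases t
  · simp [sepOp, sepWt, r0]
  · simp [sepOp, sepWt, r1]
    simp [Algebra.smul_def]
  · simp [sepOp, sepWt, r4]
  · simp only [sepOp, sepWt, Fin.reduceFinMk, Matrix.cons_val, LinearMap.add_apply,
      LinearMap.sub_apply, LinearMap.comp_apply, Derivation.coeFn_coe, r1, r2, Derivation.map_smul,
      r3, r0]
    simp only [← intCast_mul_eq, ← natCast_mul_eq]
    push_cast
    ring

lemma sepOp_mem {U : Submodule ℂ Laurent} (hU : Inv U) (t : Fin 4) (f : Laurent) (hf : f ∈ U) :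
    sepOp t f ∈ U := by
  have hr := fun p q f hf => (inv_iff.mp hU p q f hf).2.2.1
  fin_cases t
  · exact hr 0 0 f hf
  · exact hr 1 1 f hf
  · exact (inv_iff.mp hU 0 0 f hf).2.1
  · exact U.add_mem (U.sub_mem (hr 0 0 _ (hr 1 1 f hf)) (hr 0 1 _ (hr 1 0 f hf))) (hr 1 1 f hf)

lemma fam_mem_of_sum_mem {U : Submodule ℂ Laurent} (hU : ∀ t, ∀ f ∈ U, sepOp t f ∈ U)
    (s : Finset Idx) (c : Idx → ℂ) (h : ∑ i ∈ s, c i • fam i ∈ U) (i : Idx) (hi : i ∈ s) :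
    c i • fam i ∈ U := by
  classical
  refine smul_mem_of_joint_eigen sepOp hU (wt := fun t i => (sepWt t i : ℂ)) sepOp_fam
    (fun i j h => sepWt_injective i j fun t => by exact_mod_cast h t) i (s.erase i)
    (Finset.notMem_erase i s) c ?_
  rwa [Finset.add_sum_erase s (fun i => c i • fam i) hi]

/-- This is the separation of eigenvectors for the zero subspace. -/
lemma linearIndependent_fam : LinearIndependent ℂ fam := by
  rw [linearIndependent_iff']
  intro s c h i hi
  have := fam_mem_of_sum_mem (U := ⊥) (by simp) s c (by simp [h]) i hi
  simpa [fam_ne_zero] using this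

lemma kSpan_eq_span_fam (P : ℤ → ℤ → Prop) :
    kSpan P = Submodule.span ℂ (fam '' {i | P i.1.1 i.1.2}) := by
  unfold kSpan
  congr 1
  ext f
  constructor
  · rintro ⟨k, L, a, b, hP, rfl⟩
    exact ⟨⟨(k, L), a, b⟩, hP, rfl⟩
  · rintro ⟨⟨⟨k, L⟩, a, b⟩, hP, rfl⟩
    exact ⟨k, L, a, b, hP, rfl⟩

lemma span_range_fam : ⊤ ≤ Submodule.span ℂ (Set.range fam) := by
  rw [← kSpan_true, kSpan_eq_span_fam]
  exact Submodule.span_mono (Set.image_subset_range _ _)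

/-- The basis of functions `N(Z) ^ k * t^l_{n m}(Z)`. -/
def famBasis : Module.Basis Idx ℂ Laurent := Module.Basis.mk linearIndependent_fam span_range_fam

lemma famBasis_apply (i : Idx) : famBasis i = fam i := Module.Basis.mk_apply _ _ i

lemma fam_mem_of_inv {U : Submodule ℂ Laurent} (hU : Inv U) {f : Laurent} (hf : f ∈ U) {i : Idx}
    (hi : famBasis.repr f i ≠ 0) : fam i ∈ U := by
  have h := famBasis.linearCombination_repr f
  rw [Finsupp.linearCombination_apply, Finsupp.sum] at h
  simp only [famBasis_apply] at h
  have := fam_mem_of_sum_mem (sepOp_mem hU) _ _ (h.symm ▸ hf) i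
    (Finsupp.mem_support_iff.mpr hi)
  exact (U.smul_mem_iff hi).mp this

lemma inv_eq_span {U : Submodule ℂ Laurent} (hU : Inv U) :
    U = Submodule.span ℂ (fam '' {i | fam i ∈ U}) := by
  refine le_antisymm (fun f hf => ?_) (Submodule.span_le.mpr ?_)
  · have h := famBasis.linearCombination_repr f
    rw [Finsupp.linearCombination_apply, Finsupp.sum] at h
    rw [← h]
    refine Submodule.sum_mem _ fun i hi => Submodule.smul_mem _ _ (Submodule.subset_span ?_)
    rw [famBasis_apply]
    exact ⟨i, fam_mem_of_inv hU hf (Finsupp.mem_support_iff.mp hi), rfl⟩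
  · rintro _ ⟨i, hi, rfl⟩
    exact hi

lemma fam_mem_span_iff (S : Set Idx) (i : Idx) :
    fam i ∈ Submodule.span ℂ (fam '' S) ↔ i ∈ S :=
  ⟨fun h => by_contra fun hi => linearIndependent_fam.notMem_span_image hi h,
    fun h => Submodule.subset_span ⟨i, h, rfl⟩⟩

/-! ### The `K`-types of an invariant subspace -/

/-- The pair `(k, L)` occurs among the `K`-types of `U`, tested on the lowest weight vector. -/
def types (U : Submodule ℂ Laurent) (k L : ℤ) : Prop := nz k * tc 0 L.toNat 0 ∈ U

lemma inv_ladder {U : Submodule ℂ Laurent} (hU : Inv U) {k : ℤ} {L : ℕ} {a c n : ℕ}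
    (h : a + c = L) (hn : n ≤ L) : nz k * tc a c n ∈ U ↔ types U k L := by
  have hU' : ∀ p q, ∀ f ∈ U, colD p q f ∈ U ∧ rowD p q f ∈ U := fun p q f hf =>
    ⟨(inv_iff.mp hU p q f hf).2.1, (inv_iff.mp hU p q f hf).2.2.1⟩
  subst h
  constructor
  · intro h1
    exact ladder hU' hn (by rw [Int.toNat_natCast, zero_add]) h1
  · intro h1
    exact ladder hU' (Nat.zero_le _) (by rw [Int.toNat_natCast, zero_add]) h1

lemma fam_mem_iff_types {U : Submodule ℂ Laurent} (hU : Inv U) (i : Idx) :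
    fam i ∈ U ↔ types U i.1.1 i.1.2 :=
  inv_ladder hU (by omega) (by omega)

/-- An invariant subspace contains each basis vector that occurs with a nonzero coefficient in one
of its elements. -/
lemma left_mem_of_add_mem {U : Submodule ℂ Laurent} (hU : Inv U) {i j : Idx} (hij : i ≠ j)
    {m n : ℤ} (hm : m ≠ 0) (h : (m : Laurent) * fam i + (n : Laurent) * fam j ∈ U) :
    fam i ∈ U := by
  refine fam_mem_of_inv hU h ?_
  rw [intCast_mul_eq, intCast_mul_eq, ← famBasis_apply, ← famBasis_apply]
  simpa [Finsupp.single_apply, hij, hij.symm] using hm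

/-- Converse to `inv_kSpan`: each unblocked transition is realised with nonzero coefficient on an
explicit extreme vector. If the image has two components, they are multiples of distinct basis
functions, so the wanted one lies in `U` by itself. -/
lemma transClosed_types {U : Submodule ℂ Laurent} (hU : Inv U) : TransClosed (types U) := by
  have hpair : ∀ (k k' : ℤ) (L : ℕ) (m n : ℤ), m ≠ 0 →
      (m : Laurent) * (nz k * tc 0 L 0) + (n : Laurent) * (nz k' * tc 1 (L + 1) 1) ∈ U →
      types U k L := by
    intro k k' L m n hm h
    refine left_mem_of_add_mem hU (i := ⟨(k, L), 0, 0⟩)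
      (j := ⟨(k', L + 2), ⟨1, by omega⟩, ⟨1, by omega⟩⟩) (n := n) ?_ hm h
    intro h
    have := congrArg (fun x : Idx => x.1.2) h
    simp at this
  -- The splitting of `z₁₁ z₂₂^(L+1)`; it is the source of the second vector in `hpair`.
  have hz : ∀ L : ℕ, ((L : Laurent) + 2) * (coord 0 0 * tc 0 (L + 1) 0) =
      tc 1 (L + 1) 1 + (L + 1) * (normUnit * tc 0 L 0) := by
    intro L
    have := coord_00_mul_tc 0 (L + 1) 0
    simp at this
    linear_combination this
  refine ⟨?_, ?_, ?_, ?_⟩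
  · intro k L h hk
    have h1 := (inv_iff.mp hU 0 0 _ h).2.2.2
    -- As `∂₁₁ N = z₂₂`, a power of `z₂₂` stays one and no second component arises.
    have h2 : coord 1 1 * tc 0 L 0 = tc 0 (L + 1) 0 := by rw [tc_lowest, tc_lowest]; ring
    have h3 : partialZ 0 0 (nz k * tc 0 L 0) = k * (nz (k - 1) * tc 0 (L + 1) 0) := by
      rw [derivation_nz_mul, partialZ_tc_00, partialZ_normUnit, ← h2]
      simp [sgn]
      ring
    rw [Int.toNat_natCast, h3] at h1
    exact mem_of_intCast_mul_mem hk h1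
  · intro k L h hk
    have h1 := (inv_iff.mp hU 1 1 _ h).2.2.2
    have h3 : ((L + 2 : ℤ) : Laurent) * partialZ 1 1 (nz k * tc 0 (L + 1) 0) =
        (((L + 1) * (k + L + 2) : ℤ) : Laurent) * (nz k * tc 0 L 0) +
          (k : Laurent) * (nz (k - 1) * tc 1 (L + 1) 1) := by
      rw [derivation_nz_mul, partialZ_tc_11, partialZ_normUnit]
      simp [sgn]
      linear_combination (k : Laurent) * nz (k - 1) * hz L +
        (k : Laurent) * (L + 1) * tc 0 L 0 * nz_sub_one_mul k
    have h4 := intCast_mul_mem (L + 2) h1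
    rw [show ((L : ℤ) + 1).toNat = L + 1 by omega, h3] at h4
    exact hpair _ _ _ _ _ (mul_ne_zero (by omega) hk) h4
  · intro k L h hk
    -- The vector `z₁₁^L` is killed by `∂₂₂`, so only the component of higher degree survives.
    have h0 := (inv_ladder hU (k := k) (L := L) (a := L) (c := 0) (n := L) (by simp) le_rfl).mpr h
    have h1 := (inv_iff.mp hU 0 0 _ h0).1
    have hL : ((L : Laurent) + 1) * (coord 0 0 * tc L 0 L) = (L + 1) * tc (L + 1) 0 (L + 1) := by
      simpa using coord_00_mul_tc L 0 L
    have h3 : ((L + 1 : ℤ) : Laurent) * quadD 0 0 (nz k * tc L 0 L) =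
        (((L + 1) * (k + L) : ℤ) : Laurent) * (nz k * tc (L + 1) 0 (L + 1)) := by
      rw [quadD_nz_mul 0 0 k (euler_harm (tc_mem_harm L (add_zero L)))]
      rw [show (0 : Fin 2) + 1 = 1 from rfl, partialZ_tc_11]
      push_cast
      simp
      linear_combination ((k : Laurent) + L) * nz k * hL
    have h4 := intCast_mul_mem (L + 1) h1
    rw [h3] at h4
    exact (inv_ladder hU (L := L + 1) (by simp) le_rfl).mp
      (mem_of_intCast_mul_mem (mul_ne_zero (by omega) hk) h4)
  · intro k L h hk
    have h1 := (inv_iff.mp hU 0 0 _ h).1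
    have h3 : ((L + 2 : ℤ) : Laurent) * quadD 0 0 (nz k * tc 0 (L + 1) 0) =
        (((L + 1) * (k - 1) : ℤ) : Laurent) * (nz (k + 1) * tc 0 L 0) +
          ((k + L + 1 : ℤ) : Laurent) * (nz k * tc 1 (L + 1) 1) := by
      rw [quadD_nz_mul 0 0 k (euler_harm (tc_mem_harm 0 (zero_add (L + 1))))]
      rw [show (0 : Fin 2) + 1 = 1 from rfl, partialZ_tc_11, nz_add_one]
      simp [sgn]
      linear_combination ((k : Laurent) + L + 1) * nz k * hz L
    have h4 := intCast_mul_mem (L + 2) h1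
    rw [show ((L : ℤ) + 1).toNat = L + 1 by omega, h3] at h4
    exact hpair _ _ _ _ _ (mul_ne_zero (by omega) (by omega)) h4

/-! Reachability under the transitions -/

/-- A monotone walk from `u` to `u'` stays below `m`, and by `h0` and `h1` it never makes the
forbidden steps `0 → -1` and `1 → 2`. -/
lemma reach_line {S : ℤ → Prop} {m : ℤ} (hdown : ∀ u, u ≤ m → S u → u ≠ 0 → S (u - 1))
    (hup : ∀ u, u < m → S u → u ≠ 1 → S (u + 1)) {u u' : ℤ} (h : S u) (hm : u ≤ m) (hm' : u' ≤ m)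
    (h0 : 0 ≤ u → 0 ≤ u') (h1 : u ≤ 1 → u' ≤ 1) : S u' := by
  rcases le_total u u' with hle | hle
  · have : ∀ x, u ≤ x → x ≤ u' → S x := by
      intro x hx
      induction x, hx using Int.leInduction with
      | base => intro _; exact h
      | succ x hx ih => intro hx'; exact hup x (by omega) (ih (by omega)) (by omega)
    exact this u' hle le_rfl
  · have : ∀ x, x ≤ u → u' ≤ x → S x := by
      intro x hx
      induction x, hx using Int.leInductionDown with
      | base => intro _; exact h
      | pred x hx ih => intro hx'; exact hdown x (by omega) (ih (by omega)) (by omega)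
    exact this u' hle le_rfl

/-- In the coordinates `u = k`, `v = -(k + L)` both directions obey `reach_line`, and `L ≥ 0`
becomes `u + v ≤ 0`. Two axis-parallel segments lead to the target. -/
lemma TransClosed.reach {P : ℤ → ℤ → Prop} (hP : TransClosed P) {k L k' L' : ℤ} (hL : 0 ≤ L)
    (hL' : 0 ≤ L') (h : P k L) (h1 : 0 ≤ k → 0 ≤ k') (h2 : k ≤ 1 → k' ≤ 1)
    (h3 : k + L ≤ 0 → k' + L' ≤ 0) (h4 : -1 ≤ k + L → -1 ≤ k' + L') : P k' L' := by
  have hu : ∀ u u' v : ℤ, P u (-(u + v)) → u + v ≤ 0 → u' + v ≤ 0 → (0 ≤ u → 0 ≤ u') →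
      (u ≤ 1 → u' ≤ 1) → P u' (-(u' + v)) := by
    intro u u' v h hv hv' h0 h1
    refine reach_line (S := fun u => P u (-(u + v))) (m := -v) ?_ ?_ h (by omega) (by omega) h0 h1
    · intro u hu h hne
      have := hP.left u (-(u + v)).toNat (by rwa [Int.toNat_of_nonneg (by omega)]) hne
      rw [Int.toNat_of_nonneg (by omega)] at this
      convert this using 1
      ring
    · intro u hu h hne
      have hc : (((-(u + v)).toNat - 1 : ℕ) : ℤ) = -(u + v) - 1 := by omega
      have := hP.right u ((-(u + v)).toNat - 1) (by rw [hc]; simpa using h) hne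
      rw [hc] at this
      convert this using 1
      ring
  have hv : ∀ u v v' : ℤ, P u (-(u + v)) → u + v ≤ 0 → u + v' ≤ 0 → (0 ≤ v → 0 ≤ v') →
      (v ≤ 1 → v' ≤ 1) → P u (-(u + v')) := by
    intro u v v' h hv hv' h0 h1
    refine reach_line (S := fun v => P u (-(u + v))) (m := -u) ?_ ?_ h (by omega) (by omega) h0 h1
    · intro v hv h hne
      have := hP.up u (-(u + v)).toNat (by rwa [Int.toNat_of_nonneg (by omega)]) (by omega)
      rw [Int.toNat_of_nonneg (by omega)] at this
      convert this using 1
      ring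
    · intro v hv h hne
      have hc : (((-(u + v)).toNat - 1 : ℕ) : ℤ) = -(u + v) - 1 := by omega
      have := hP.down u ((-(u + v)).toNat - 1) (by rw [hc]; simpa using h) (by omega)
      rw [hc] at this
      convert this using 1
      ring
  have h' : P k (-(k + -(k + L))) := by simpa using h
  suffices P k' (-(k' + -(k' + L'))) by simpa using this
  -- The corner of the path must satisfy `u + v ≤ 0`. Moving `u` first is safe if `u` does not
  -- increase or `v` does not decrease; otherwise `v` decreases and can be moved first.
  by_cases hc : k' ≤ k ∨ k' + L' ≤ k + L
  · exact hv _ _ _ (hu k k' _ h' (by omega) (by omega) h1 h2) (by omega) (by omega) (by omega)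
      (by omega)
  · exact hu _ _ _ (hv k _ (-(k' + L')) h' (by omega) (by omega) (by omega) (by omega)) (by omega)
      (by omega) h1 h2

/-! The six classes of `K`-types -/

/-- The class of the `K`-type `(k, L)`. -/
def cell (k L : ℤ) : Fin 6 :=
  if 0 ≤ k then (if k ≤ 1 then (if k = 0 ∧ L = 0 then 0 else 1) else 3)
  else if -1 ≤ k + L then (if k + L ≤ 0 then 2 else 5) else 4

/-- The classes that can be reached from a given class. -/
def down : Fin 6 → Finset (Fin 6) :=
  ![{0}, {0, 1}, {0, 2}, {0, 1, 3}, {0, 2, 4}, {0, 1, 2, 5}]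

/-- The table `down` encodes the four barriers. The bound `0 ≤ L` makes `(0, 0)` the only common
point of the strips `0 ≤ k ≤ 1` and `-1 ≤ k + L ≤ 0`. -/
lemma cell_mem_down_iff {k L k' L' : ℤ} (hL : 0 ≤ L) (hL' : 0 ≤ L') :
    cell k' L' ∈ down (cell k L) ↔ (0 ≤ k → 0 ≤ k') ∧ (k ≤ 1 → k' ≤ 1) ∧
      (k + L ≤ 0 → k' + L' ≤ 0) ∧ (-1 ≤ k + L → -1 ≤ k' + L') := by
  unfold cell
  split_ifs <;> simp [down] <;> omega

lemma self_mem_down (c : Fin 6) : c ∈ down c := by revert c; decide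

/-- Sets of classes closed under reachability. -/
def IsLowerCells (s : Finset (Fin 6)) : Prop := ∀ c ∈ s, down c ⊆ s

instance (s : Finset (Fin 6)) : Decidable (IsLowerCells s) := by
  unfold IsLowerCells; infer_instance

lemma transClosed_cell {s : Finset (Fin 6)} (hs : IsLowerCells s) :
    TransClosed fun k L => cell k L ∈ s := by
  refine ⟨?_, ?_, ?_, ?_⟩ <;> intro k L h hk <;>
    exact hs _ h ((cell_mem_down_iff (by omega) (by omega)).mpr (by omega))

/-- A representative of each class. -/
def rep : Fin 6 → ℤ × ℤ := ![(0, 0), (0, 1), (-1, 1), (2, 0), (-2, 0), (-1, 2)]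

lemma rep_nonneg (c : Fin 6) : 0 ≤ (rep c).2 := by revert c; decide

lemma cell_rep (c : Fin 6) : cell (rep c).1 (rep c).2 = c := by revert c; decide

/-- Points of one cell are reachable from each other, so one representative decides for the whole
cell. -/
lemma TransClosed.cell_iff {P : ℤ → ℤ → Prop} (hP : TransClosed P) {k L : ℤ} (hL : 0 ≤ L) :
    P k L ↔ P (rep (cell k L)).1 (rep (cell k L)).2 := by
  have hr := rep_nonneg (cell k L)
  have hc := cell_rep (cell k L)
  constructor
  · intro h
    obtain ⟨h1, h2, h3, h4⟩ := (cell_mem_down_iff hL hr).mp (by rw [hc]; exact self_mem_down _)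
    exact hP.reach hL hr h h1 h2 h3 h4
  · intro h
    obtain ⟨h1, h2, h3, h4⟩ := (cell_mem_down_iff (k' := k) (L' := L) hr hL).mp
      (by rw [hc]; exact self_mem_down _)
    exact hP.reach hr hL h h1 h2 h3 h4

/-! Invariant subspaces of `Ш'` -/

/-- The space of functions underlying an invariant subspace. -/
def under (W : LieSubmodule ℂ GlHC ShP) : Submodule ℂ Laurent :=
  W.toSubmodule.comap (ShP.of : Laurent →ₗ[ℂ] ShP)

lemma mem_under {W : LieSubmodule ℂ GlHC ShP} {f : Laurent} : f ∈ under W ↔ ShP.of f ∈ W := Iff.rfl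

lemma inv_under (W : LieSubmodule ℂ GlHC ShP) : Inv (under W) := fun X f hf => by
  rw [mem_under, ← lie_ShP]
  exact W.lie_mem hf

lemma under_le_iff {W W' : LieSubmodule ℂ GlHC ShP} : under W ≤ under W' ↔ W ≤ W' := by
  constructor
  · intro h f hf
    exact h (x := ShP.of.symm f) hf
  · intro h f hf
    exact h hf

lemma toSubmodule_eq_kSpan_iff (W : LieSubmodule ℂ GlHC ShP) (P : ℤ → ℤ → Prop) :
    W.toSubmodule = ShP.kSpan P ↔ under W = kSpan P := by
  unfold under ShP.kSpan
  constructor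
  · intro h
    rw [h]
    exact Submodule.comap_map_eq_of_injective ShP.of.injective _
  · intro h
    rw [← h]
    exact (Submodule.map_comap_eq_of_surjective ShP.of.surjective _).symm

open Classical in
/-- The classes of `K`-types that occur in an invariant subspace. -/
def cells (W : LieSubmodule ℂ GlHC ShP) : Finset (Fin 6) :=
  {c | types (under W) (rep c).1 (rep c).2}

lemma fam_mem_under_iff (W : LieSubmodule ℂ GlHC ShP) (i : Idx) :
    fam i ∈ under W ↔ cell i.1.1 i.1.2 ∈ cells W := by
  rw [fam_mem_iff_types (inv_under W), (transClosed_types (inv_under W)).cell_iff (by omega)]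
  simp [cells]

lemma under_eq_kSpan (W : LieSubmodule ℂ GlHC ShP) :
    under W = kSpan fun k L => cell k L ∈ cells W := by
  rw [kSpan_eq_span_fam, inv_eq_span (inv_under W)]
  simp only [fam_mem_under_iff]

lemma kSpan_congr {P Q : ℤ → ℤ → Prop} (h : ∀ k L, 0 ≤ L → (P k L ↔ Q k L)) :
    kSpan P = kSpan Q := by
  rw [kSpan_eq_span_fam, kSpan_eq_span_fam]
  congr 2
  ext i
  exact h _ _ (by omega)

lemma fam_mem_kSpan_iff (P : ℤ → ℤ → Prop) (i : Idx) : fam i ∈ kSpan P ↔ P i.1.1 i.1.2 := by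
  rw [kSpan_eq_span_fam, fam_mem_span_iff]
  rfl

/-- A basis index in a given class. -/
def repIdx (c : Fin 6) : Idx := ⟨((rep c).1, (rep c).2.toNat), 0, 0⟩

lemma cell_repIdx (c : Fin 6) : cell (repIdx c).1.1 (repIdx c).1.2 = c := by
  simp [repIdx, Int.toNat_of_nonneg (rep_nonneg c), cell_rep]

lemma mem_cells_iff {W : LieSubmodule ℂ GlHC ShP} {c : Fin 6} :
    c ∈ cells W ↔ fam (repIdx c) ∈ under W := by
  rw [fam_mem_under_iff, cell_repIdx]

lemma isLowerCells_cells (W : LieSubmodule ℂ GlHC ShP) : IsLowerCells (cells W) := by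
  intro c hc c' hc'
  have hP := transClosed_types (inv_under W)
  simp only [cells, Finset.mem_filter, Finset.mem_univ, true_and] at hc ⊢
  rw [← cell_rep c, ← cell_rep c', cell_mem_down_iff (rep_nonneg _) (rep_nonneg _)] at hc'
  exact hP.reach (rep_nonneg _) (rep_nonneg _) hc hc'.1 hc'.2.1 hc'.2.2.1 hc'.2.2.2

/-- Turns statements about infinite-dimensional invariant subspaces into statements about subsets of
a six-element set, which `decide` can settle. -/
lemma le_iff_cells {W W' : LieSubmodule ℂ GlHC ShP} : W ≤ W' ↔ cells W ⊆ cells W' := by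
  constructor
  · intro h c hc
    rw [mem_cells_iff] at hc ⊢
    exact h hc
  · intro h
    rw [← under_le_iff, under_eq_kSpan, under_eq_kSpan, kSpan_eq_span_fam, kSpan_eq_span_fam]
    exact Submodule.span_mono (Set.image_mono fun i hi => h hi)

lemma eq_of_cells_eq {W W' : LieSubmodule ℂ GlHC ShP} (h : cells W = cells W') : W = W' :=
  le_antisymm (le_iff_cells.mpr h.le) (le_iff_cells.mpr h.ge)

lemma cells_top : cells ⊤ = Finset.univ := by
  ext c
  simp [mem_cells_iff, mem_under]

lemma cells_bot : cells ⊥ = ∅ := by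
  ext c
  simp [mem_cells_iff, mem_under, fam_ne_zero]

lemma cells_inf (W W' : LieSubmodule ℂ GlHC ShP) : cells (W ⊓ W') = cells W ∩ cells W' := by
  ext c
  simp [mem_cells_iff, mem_under]

/-- A sum lies in the span of the basis functions of both cell sets, and linear independence
excludes functions from any other cell. -/
lemma cells_sup (W W' : LieSubmodule ℂ GlHC ShP) : cells (W ⊔ W') = cells W ∪ cells W' := by
  refine subset_antisymm ?_ (Finset.union_subset (le_iff_cells.mp le_sup_left)
    (le_iff_cells.mp le_sup_right))
  intro c hc
  have h1 : under (W ⊔ W') ≤ kSpan fun k L => cell k L ∈ cells W ∪ cells W' := by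
    intro f hf
    rw [mem_under, LieSubmodule.mem_sup] at hf
    obtain ⟨x, hx, y, hy, hxy⟩ := hf
    have hx' : ShP.of.symm x ∈ under W := hx
    have hy' : ShP.of.symm y ∈ under W' := hy
    have : f = ShP.of.symm x + ShP.of.symm y := by rw [← map_add, hxy]; simp
    rw [under_eq_kSpan] at hx' hy'
    rw [this]
    have hmono : ∀ s t : Finset (Fin 6), s ⊆ t →
        kSpan (fun k L => cell k L ∈ s) ≤ kSpan (fun k L => cell k L ∈ t) := by
      intro s t hst
      rw [kSpan_eq_span_fam, kSpan_eq_span_fam]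
      exact Submodule.span_mono (Set.image_mono fun i hi => hst hi)
    exact Submodule.add_mem _ (hmono _ _ Finset.subset_union_left hx')
      (hmono _ _ Finset.subset_union_right hy')
  have h2 := h1 (mem_cells_iff.mp hc)
  rwa [fam_mem_kSpan_iff, cell_repIdx] at h2

/-- The invariant subspace with a given set of classes. -/
def ofCells (s : Finset (Fin 6)) (hs : IsLowerCells s) : LieSubmodule ℂ GlHC ShP :=
  { ShP.kSpan (fun k L => cell k L ∈ s) with
    lie_mem := by
      rintro X _ ⟨f, hf, rfl⟩
      exact ⟨_, inv_kSpan (transClosed_cell hs) X f hf, rfl⟩ }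

lemma ofCells_toSubmodule (s : Finset (Fin 6)) (hs : IsLowerCells s) {P : ℤ → ℤ → Prop}
    (h : ∀ k L, 0 ≤ L → (cell k L ∈ s ↔ P k L)) : (ofCells s hs).toSubmodule = ShP.kSpan P := by
  have : (ofCells s hs).toSubmodule = ShP.kSpan (fun k L => cell k L ∈ s) := rfl
  rw [this, ShP.kSpan, ShP.kSpan, kSpan_congr h]

lemma cells_ofCells (s : Finset (Fin 6)) (hs : IsLowerCells s) : cells (ofCells s hs) = s := by
  ext c
  have : under (ofCells s hs) = kSpan fun k L => cell k L ∈ s :=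
    (toSubmodule_eq_kSpan_iff _ _).mp rfl
  rw [mem_cells_iff, this, fam_mem_kSpan_iff, cell_repIdx]

/-! Quotients of Lie modules -/

section Quotients

variable {M N : Type} [AddCommGroup M] [Module ℂ M] [LieRingModule GlHC M] [LieModule ℂ GlHC M]
  [AddCommGroup N] [Module ℂ N] [LieRingModule GlHC N]

/-- The first isomorphism theorem for modules over a Lie algebra. -/
lemma exists_quotient_equiv (f : M →ₗ⁅ℂ, GlHC⁆ N) (K : LieSubmodule ℂ GlHC M)
    (hK : ∀ x, x ∈ K ↔ f x = 0) (hf : Function.Surjective f) :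
    ∃ e : (M ⧸ K) ≃ₗ⁅ℂ, GlHC⁆ N, ∀ x, e (LieSubmodule.Quotient.mk' K x) = f x := by
  have hle : K.toSubmodule ≤ LinearMap.ker (f : M →ₗ[ℂ] N) := fun x hx => (hK x).mp hx
  let g : (M ⧸ K) →ₗ[ℂ] N := K.toSubmodule.liftQ (f : M →ₗ[ℂ] N) hle
  have hg : ∀ x, g (LieSubmodule.Quotient.mk' K x) = f x := fun x => rfl
  let g' : (M ⧸ K) →ₗ⁅ℂ, GlHC⁆ N :=
    { g with
      map_lie' := by
        intro X y
        obtain ⟨x, rfl⟩ := LieSubmodule.Quotient.surjective_mk' K y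
        change g ⁅X, LieSubmodule.Quotient.mk' K x⁆ = ⁅X, g (LieSubmodule.Quotient.mk' K x)⁆
        rw [← LieModuleHom.map_lie, hg, hg, LieModuleHom.map_lie] }
  have hbij : Function.Bijective g' := by
    constructor
    · refine (injective_iff_map_eq_zero g').mpr fun y hy => ?_
      obtain ⟨x, rfl⟩ := LieSubmodule.Quotient.surjective_mk' K y
      exact (LieSubmodule.Quotient.mk_eq_zero _).mpr ((hK x).mpr hy)
    · intro z
      obtain ⟨x, rfl⟩ := hf z
      exact ⟨LieSubmodule.Quotient.mk' K x, rfl⟩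
  let e := LinearEquiv.ofBijective (g' : (M ⧸ K) →ₗ[ℂ] N) hbij
  exact ⟨{ e with
    map_lie' := fun {X y} => g'.map_lie X y
    invFun := e.symm
    left_inv := e.left_inv
    right_inv := e.right_inv }, fun x => rfl⟩

/-- The second isomorphism theorem for modules over a Lie algebra. -/
lemma inclusionIso_of_inf_sup {V W V' W' : LieSubmodule ℂ GlHC M} (hinf : V ⊓ W' = W)
    (hsup : V ⊔ W' = V') : InclusionIso V W V' W' := by
  have h : V ≤ V' := hsup ▸ le_sup_left
  obtain ⟨e, he⟩ := exists_quotient_equiv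
    ((SubQuot.mk V' W').comp (LieSubmodule.inclusion h)) (W.comap V.incl) (by
      intro x
      rw [LieModuleHom.comp_apply, LieSubmodule.Quotient.mk_eq_zero, LieSubmodule.mem_comap,
        LieSubmodule.mem_comap, ← hinf]
      simp) (by
      intro y
      obtain ⟨⟨z, hz⟩, rfl⟩ := LieSubmodule.Quotient.surjective_mk' _ y
      have hz' := hz
      rw [← hsup, LieSubmodule.mem_sup] at hz'
      obtain ⟨v, hv, w, hw, rfl⟩ := hz'
      refine ⟨⟨v, hv⟩, ?_⟩
      rw [LieModuleHom.comp_apply, ← sub_eq_zero, ← map_sub, LieSubmodule.Quotient.mk_eq_zero,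
        LieSubmodule.mem_comap]
      simpa using hw)
  exact ⟨h, e, he⟩

/-- Submodules of a subquotient correspond to intermediate submodules. -/
lemma isIrreducible_subQuot_iff {V W : LieSubmodule ℂ GlHC M} (h : W ≤ V) :
    LieModule.IsIrreducible ℂ GlHC (SubQuot V W) ↔ W ⋖ V := by
  -- Preimage and image under the projection; `hmem` and `hpush` reduce both to membership of
  -- representatives.
  let lift : LieSubmodule ℂ GlHC (SubQuot V W) → LieSubmodule ℂ GlHC M :=
    fun U => (U.comap (SubQuot.mk V W)).map V.incl
  let push : LieSubmodule ℂ GlHC M → LieSubmodule ℂ GlHC (SubQuot V W) :=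
    fun U => (U.comap V.incl).map (SubQuot.mk V W)
  have hmem : ∀ U (x : V), (x : M) ∈ lift U ↔ SubQuot.mk V W x ∈ U := by
    intro U x
    simp only [lift, LieSubmodule.mem_map, LieSubmodule.mem_comap]
    constructor
    · rintro ⟨y, hy, hyx⟩
      obtain rfl : y = x := Subtype.ext hyx
      exact hy
    · exact fun hx => ⟨x, hx, rfl⟩
  have hpush : ∀ U, W ≤ U → ∀ x : V, SubQuot.mk V W x ∈ push U ↔ (x : M) ∈ U := by
    intro U hU x
    simp only [push, LieSubmodule.mem_map, LieSubmodule.mem_comap]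
    constructor
    · rintro ⟨y, hy, hyx⟩
      rw [← sub_eq_zero, ← map_sub, LieSubmodule.Quotient.mk_eq_zero, LieSubmodule.mem_comap] at hyx
      have := U.sub_mem hy (hU hyx)
      simpa using this
    · exact fun hx => ⟨x, hx, rfl⟩
  have hle : ∀ U, lift U ≤ V := by
    rintro U _ ⟨y, -, rfl⟩
    exact y.2
  have hge : ∀ U, W ≤ lift U := by
    intro U x hx
    refine (hmem U ⟨x, h hx⟩).mpr ?_
    have : SubQuot.mk V W ⟨x, h hx⟩ = 0 := (LieSubmodule.Quotient.mk_eq_zero _).mpr hx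
    rw [this]
    exact U.zero_mem
  constructor
  · intro hirr
    refine ⟨lt_of_le_of_ne h ?_, ?_⟩
    · rintro rfl
      obtain ⟨x, hx⟩ := exists_ne (⊥ : LieSubmodule ℂ GlHC (SubQuot W W))
      have : ∀ y : SubQuot W W, y = 0 := by
        intro y
        obtain ⟨z, rfl⟩ := LieSubmodule.Quotient.surjective_mk' _ y
        exact (LieSubmodule.Quotient.mk_eq_zero _).mpr z.2
      refine hx ((LieSubmodule.eq_bot_iff _).mpr fun y _ => this y)
    · intro U hWU hUV
      rcases hirr.eq_bot_or_eq_top (push U) with hb | ht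
      · refine hWU.not_ge fun x hx => ?_
        have := (hpush U hWU.le ⟨x, hUV.le hx⟩).mpr hx
        rw [hb, LieSubmodule.mem_bot, LieSubmodule.Quotient.mk_eq_zero] at this
        exact this
      · refine hUV.not_ge fun x hx => ?_
        refine (hpush U hWU.le ⟨x, hx⟩).mp ?_
        rw [ht]
        trivial
  · intro hcov
    have hnt : Nontrivial (SubQuot V W) := by
      obtain ⟨x, hx, hxW⟩ := Set.exists_of_ssubset (SetLike.coe_ssubset_coe.mpr hcov.lt)
      refine ⟨SubQuot.mk V W ⟨x, hx⟩, 0, fun h0 => hxW ?_⟩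
      exact (LieSubmodule.Quotient.mk_eq_zero (N := W.comap V.incl)).mp h0
    refine LieModule.IsIrreducible.mk fun U hU => ?_
    rcases hcov.eq_or_eq (hge U) (hle U) with hb | ht
    · refine absurd ((LieSubmodule.eq_bot_iff _).mpr fun y hy => ?_) hU
      obtain ⟨x, rfl⟩ := LieSubmodule.Quotient.surjective_mk' _ y
      refine (LieSubmodule.Quotient.mk_eq_zero _).mpr ?_
      have := (hmem U x).mpr hy
      rwa [hb] at this
    · refine eq_top_iff.mpr fun y _ => ?_
      obtain ⟨x, rfl⟩ := LieSubmodule.Quotient.surjective_mk' _ y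
      refine (hmem U x).mp ?_
      rw [ht]
      exact x.2

end Quotients

/-! ### Commutation of `□` with the vector fields -/

lemma derivation_four (D : Derivation ℂ Laurent Laurent) : D (4 : Laurent) = 0 := by
  exact_mod_cast Derivation.map_natCast D 4

lemma box_partialZ (i j : Fin 2) (f : Laurent) : box (partialZ i j f) = partialZ i j (box f) := by
  simp only [box_apply, Derivation.leibniz, smul_eq_mul, derivation_four, map_sub]
  rw [partialZ_comm 1 1 i j, partialZ_comm 0 0 i j, partialZ_comm 1 0 i j, partialZ_comm 0 1 i j]
  ring

lemma box_mul (f g : Laurent) : box (f * g) = f * box g + g * box f +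
    4 * (partialZ 0 0 f * partialZ 1 1 g + partialZ 1 1 f * partialZ 0 0 g
      - partialZ 0 1 f * partialZ 1 0 g - partialZ 1 0 f * partialZ 0 1 g) := by
  simp only [box_apply, Derivation.leibniz, smul_eq_mul, map_add]
  ring

lemma box_coord_mul (i j : Fin 2) (f : Laurent) :
    box (coord i j * f) = coord i j * box f + 4 * (sgn i j * partialZ (i + 1) (j + 1) f) := by
  rw [box_mul, box_apply (coord i j)]
  fin_cases i <;> fin_cases j <;> simp [partialZ_coord, sgn]

lemma rowD_eq_sum (i j : Fin 2) (f : Laurent) :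
    rowD i j f = coord j 0 * partialZ i 0 f + coord j 1 * partialZ i 1 f := by
  have : rowD i j = coord j 0 • partialZ i 0 + coord j 1 • partialZ i 1 := by
    apply derivation_ext
    intro k l
    rw [rowD_coord]
    fin_cases i <;> fin_cases k <;> fin_cases l <;> simp [partialZ_coord]
  rw [this]
  rfl

lemma euler_eq_sum (f : Laurent) : euler f = coord 0 0 * partialZ 0 0 f
    + coord 0 1 * partialZ 0 1 f + coord 1 0 * partialZ 1 0 f + coord 1 1 * partialZ 1 1 f := by
  rw [euler, Derivation.add_apply, rowD_eq_sum, rowD_eq_sum]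
  ring

lemma box_normUnit_mul (f : Laurent) :
    box (normUnit * f) = normUnit * box f + 4 * (euler f + 2 * f) := by
  rw [box_mul, box_apply (normUnit : Laurent), euler_eq_sum]
  simp [partialZ_normUnit, sgn, partialZ_coord]
  ring

lemma colD_eq_sum (i j : Fin 2) (f : Laurent) :
    colD i j f = coord 0 i * partialZ 0 j f + coord 1 i * partialZ 1 j f := by
  have : colD i j = coord 0 i • partialZ 0 j + coord 1 i • partialZ 1 j := by
    apply derivation_ext
    intro k l
    rw [colD_coord]
    fin_cases j <;> fin_cases k <;> fin_cases l <;> simp [partialZ_coord]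
  rw [this]
  rfl

lemma box_rowD (i j : Fin 2) (f : Laurent) :
    box (rowD i j f) = rowD i j (box f) + if i = j then box f else 0 := by
  simp only [rowD_eq_sum, map_add, box_coord_mul, box_partialZ]
  rw [box_apply f]
  have h1 := partialZ_comm 1 1 0 0 f
  have h2 := partialZ_comm 1 0 0 1 f
  have h3 := partialZ_comm 0 1 0 0 f
  have h4 := partialZ_comm 1 1 1 0 f
  fin_cases i <;> fin_cases j <;> simp [sgn, h1, h2, h3, h4] <;> ring

lemma box_colD (i j : Fin 2) (f : Laurent) :
    box (colD i j f) = colD i j (box f) + if i = j then box f else 0 := by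
  simp only [colD_eq_sum, map_add, box_coord_mul, box_partialZ]
  rw [box_apply f]
  have h1 := partialZ_comm 1 1 0 0 f
  have h2 := partialZ_comm 1 0 0 1 f
  have h3 := partialZ_comm 1 0 0 0 f
  have h4 := partialZ_comm 1 1 0 1 f
  fin_cases i <;> fin_cases j <;> simp [sgn, h1, h2, h3, h4] <;> ring

lemma box_euler (f : Laurent) : box (euler f) = euler (box f) + 2 * box f := by
  simp only [euler, Derivation.add_apply, map_add, box_rowD, if_true]
  ring

lemma euler_partialZ (i j : Fin 2) (f : Laurent) :
    euler (partialZ i j f) = partialZ i j (euler f) - partialZ i j f := by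
  simp only [euler, Derivation.add_apply, rowD_eq_sum, map_add, Derivation.leibniz, smul_eq_mul,
    partialZ_coord]
  rw [partialZ_comm 0 0 i j, partialZ_comm 0 1 i j, partialZ_comm 1 0 i j, partialZ_comm 1 1 i j]
  fin_cases i <;> fin_cases j <;> simp <;> ring

lemma box_sgn_mul (i j : Fin 2) (f : Laurent) : box (sgn i j * f) = sgn i j * box f := by
  unfold sgn; split_ifs <;> simp

/-- The terms from `□ (z E f)` and `□ (N ∂f)`, with `E` the Euler operator, cancel up to `∂E f - E∂f
- 2∂f = -∂f`. This leaves the first-order error. -/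
lemma box_quadD (i j : Fin 2) (f : Laurent) :
    box (quadD i j f) = quadD i j (box f) + 2 * (coord j i * box f)
      - 4 * (sgn i j * partialZ (j + 1) (i + 1) f) := by
  have h2 : sgn j i = sgn i j := by simp [sgn, eq_comm]
  rw [quadD_eq, map_sub, box_coord_mul, box_euler, box_sgn_mul, box_normUnit_mul, box_partialZ,
    euler_partialZ, quadD_eq, h2]
  ring

lemma half_multiplier (X : GlHC) : multiplier X = 2 * ∑ p, ∑ q,
    (X 1 0 p q • (2 * coord q p) + X 1 1 p q • (if p = q then (1 : Laurent) else 0)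
      - X 0 0 p q • (if p = q then (1 : Laurent) else 0)) := by
  simp only [multiplier, two_mul, show (4 : Matrix (Fin 2) (Fin 2) Laurent) = 1 + 1 + 1 + 1 by
    norm_num, add_mul, one_mul, Matrix.trace_fin_two, Matrix.add_apply, Matrix.sub_apply,
    Matrix.mul_apply, Fin.sum_univ_two, Matrix.map_apply, Algebra.smul_def]
  simp
  ring

/-- One `□` yields half of the multiplier of `ρ`, and an error from the block `C` only. Both sides
are doubled to avoid the half. -/
lemma box_derivAlong (X : GlHC) (f : Laurent) :
    2 * box (derivAlong (vField X) f) = 2 * derivAlong (vField X) (box f)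
      + multiplier X * box f
      - 8 * ∑ p, ∑ q, X 1 0 p q • (sgn p q * partialZ (q + 1) (p + 1) f) := by
  rw [derivAlong_vField_eq, half_multiplier]
  simp only [Fin.sum_univ_two, Derivation.add_apply, Derivation.sub_apply, Derivation.smul_apply,
    map_add, map_sub, map_smul, box_quadD, box_rowD, box_colD, box_partialZ]
  simp only [Algebra.smul_def]
  simp
  ring

lemma multiplier_mul (X : GlHC) (f : Laurent) : multiplier X * f = 4 • ∑ p, ∑ q,
    X 1 0 p q • (coord q p * f) + (2 : ℕ) • ((X 1 1).trace - (X 0 0).trace) • f := by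
  rw [half_multiplier]
  simp only [Fin.sum_univ_two, Matrix.trace_fin_two, Algebra.smul_def]
  simp
  ring

/-- The multiplier is affine in `Z` with linear part `4 Tr (C Z)`, so only the first-order terms of
`box_coord_mul` appear; they compensate the errors in `box_derivAlong`. -/
lemma box_multiplier_mul (X : GlHC) (f : Laurent) :
    box (multiplier X * f) = multiplier X * box f
      + 16 * ∑ p, ∑ q, X 1 0 p q • (sgn p q * partialZ (q + 1) (p + 1) f) := by
  have hs : ∀ p q, sgn q p = sgn p q := fun p q => by simp [sgn, eq_comm]
  rw [multiplier_mul, multiplier_mul]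
  simp only [Fin.sum_univ_two, map_add, map_smul, map_nsmul, box_coord_mul, hs, smul_add]
  simp only [Algebra.smul_def, nsmul_eq_mul]
  push_cast
  ring

/-- The map `□ ∘ □` intertwines the actions `ρ'` and `ρ`. -/
lemma boxBox_lie (X : GlHC) (f : ShP) : boxBox ⁅X, f⁆ = ⁅X, boxBox f⁆ := by
  obtain ⟨f, rfl⟩ := ShP.of.surjective f
  have hb : ∀ g, boxBox (ShP.of g) = Sh.of (box (box g)) := fun g => rfl
  rw [lie_ShP, hb, hb, lie_Sh]
  congr 1
  have hu : IsUnit (4 : Laurent) := by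
    rw [show (4 : Laurent) = algebraMap ℂ Laurent 4 from (map_ofNat _ 4).symm]
    exact (isUnit_iff_ne_zero.mpr (by norm_num : (4 : ℂ) ≠ 0)).map _
  have e1 := congrArg (fun g => 2 * box g) (box_derivAlong X f)
  have e2 := box_derivAlong X (box f)
  have e3 := box_multiplier_mul X (box f)
  have hm : ∀ (n : ℕ) (g : Laurent), box ((n : Laurent) * g) = n * box g := by
    intro n g
    rw [natCast_mul_eq, map_smul, ← natCast_mul_eq]
  have hm2 : ∀ g : Laurent, box (2 * g) = 2 * box g := fun g => by exact_mod_cast hm 2 g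
  have hm8 : ∀ g : Laurent, box (8 * g) = 8 * box g := fun g => by exact_mod_cast hm 8 g
  simp only [map_sub, map_add, hm2, hm8, map_sum, map_smul, box_sgn_mul, box_partialZ] at e1
  refine hu.mul_left_cancel ?_
  -- The error sums, all applied to `□f`, have coefficients `-16`, `-16` and `+32`.
  linear_combination e1 + 2 * e2 + 2 * e3

/-! The operator `□` on `K`-types -/

lemma box_tc (a c n : ℕ) : box (tc a c n) = 0 := by
  have hn : ∀ (D : Derivation ℂ Laurent Laurent) (m : ℕ) (f : Laurent),
      D ((m : Laurent) * f) = m * D f := by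
    intro D m f
    rw [natCast_mul_eq, Derivation.map_smul, ← natCast_mul_eq]
  rw [box_apply, partialZ_tc_11, partialZ_tc_10, hn, hn, partialZ_tc_00, partialZ_tc_01]
  ring

lemma box_harm {L : ℕ} {f : Laurent} (hf : f ∈ harm L) : box f = 0 :=
  harm_induction (p := fun f => box f = 0) (fun a c n _ => box_tc a c n) (map_zero _)
    (fun f g hf hg => by rw [map_add, hf, hg, add_zero])
    (fun r f hf => by rw [map_smul, hf, smul_zero]) hf

lemma box_nz (k : ℤ) : box (nz k) = 4 * k * (k + 1) * nz (k - 1) := by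
  have hn : ∀ (D : Derivation ℂ Laurent Laurent) (m : ℤ) (f : Laurent),
      D ((m : Laurent) * f) = m * D f := by
    intro D m f
    rw [intCast_mul_eq, Derivation.map_smul, ← intCast_mul_eq]
  have h1 := nz_sub_one_mul (k - 1)
  rw [normUnit_eq'] at h1
  rw [box_apply, derivation_nz, derivation_nz, mul_assoc, mul_assoc, hn, hn]
  simp only [partialZ_normUnit, Derivation.leibniz, smul_eq_mul, derivation_nz]
  simp [sgn, partialZ_coord]
  linear_combination 4 * (k : Laurent) * (k - 1) * h1

/-- For harmonic `f`, only `□ (N^k)` and the cross term contribute. The latter is `4k N^(k-1)` times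
the Euler operator, whence `4k(k + 1) + 4kL`. -/
lemma box_nz_mul (k : ℤ) {L : ℕ} {f : Laurent} (hf : f ∈ harm L) :
    box (nz k * f) = ((4 * k * (k + L + 1) : ℤ) : ℂ) • (nz (k - 1) * f) := by
  have he := euler_harm hf
  rw [euler_eq_sum] at he
  rw [← intCast_mul_eq, box_mul, box_harm hf, box_nz]
  simp only [derivation_nz, partialZ_normUnit]
  simp [sgn]
  linear_combination 4 * (k : Laurent) * nz (k - 1) * he

/-- The factor by which `□ ∘ □` multiplies on the `K`-type `(k, L)`. -/
def boxFactor (k L : ℤ) : ℤ := 4 * k * (k + L + 1) * (4 * (k - 1) * (k + L))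

lemma box_box_nz_mul (k : ℤ) {L : ℕ} {f : Laurent} (hf : f ∈ harm L) :
    box (box (nz k * f)) = (boxFactor k L : ℂ) • (nz (k - 2) * f) := by
  rw [box_nz_mul k hf, map_smul, box_nz_mul (k - 1) hf, smul_smul, sub_sub]
  congr 1
  rw [boxFactor]
  push_cast
  ring

/-- As `□ ∘ □` acts by scalars and lowers `k` by two, the image consists of the shifted `K`-types
with nonzero factor. -/
lemma map_box_box_kSpan {P Q : ℤ → ℤ → Prop}
    (h1 : ∀ k L, 0 ≤ L → P k L → boxFactor k L = 0 ∨ Q (k - 2) L)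
    (h2 : ∀ k L, 0 ≤ L → Q k L → boxFactor (k + 2) L ≠ 0 ∧ P (k + 2) L) :
    (kSpan P).map (box ∘ₗ box) = kSpan Q := by
  refine le_antisymm (Submodule.map_le_iff_le_comap.mpr (kSpan_le fun k L hP f hf => ?_))
    (kSpan_le fun k L hQ f hf => ?_)
  · rw [Submodule.mem_comap, LinearMap.comp_apply, box_box_nz_mul k hf]
    rcases h1 k L (by omega) hP with h | h
    · rw [h, Int.cast_zero, zero_smul]
      exact Submodule.zero_mem _
    · exact Submodule.smul_mem _ _ (nz_mul_mem_kSpan h hf)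
  · obtain ⟨hne, hP⟩ := h2 k L (by omega) hQ
    refine (Submodule.smul_mem_iff _ (Int.cast_ne_zero.mpr hne : (boxFactor (k + 2) L : ℂ) ≠ 0)).mp
      ⟨nz (k + 2) * f, nz_mul_mem_kSpan hP hf, ?_⟩
    rw [LinearMap.comp_apply, box_box_nz_mul _ hf, add_sub_cancel_right]

/-- The homomorphism `□ ∘ □` of modules over the Lie algebra. -/
def boxBoxHom : ShP →ₗ⁅ℂ, GlHC⁆ Sh := { boxBox with map_lie' := fun {X f} => boxBox_lie X f }

lemma map_boxBoxHom_toSubmodule {W : LieSubmodule ℂ GlHC ShP} {P Q : ℤ → ℤ → Prop}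
    (hW : W.toSubmodule = ShP.kSpan P)
    (h1 : ∀ k L, 0 ≤ L → P k L → boxFactor k L = 0 ∨ Q (k - 2) L)
    (h2 : ∀ k L, 0 ≤ L → Q k L → boxFactor (k + 2) L ≠ 0 ∧ P (k + 2) L) :
    (W.map boxBoxHom).toSubmodule = Sh.kSpan Q := by
  rw [LieSubmodule.toSubmodule_map, hW, Sh.kSpan, ShP.kSpan, ← map_box_box_kSpan h1 h2,
    ← Submodule.map_comp, ← Submodule.map_comp]
  rfl

/-- The kernel is invariant, so the factor need only be tested on one representative of each cell.
-/
lemma cells_ker_boxBoxHom : cells boxBoxHom.ker = {0, 1, 2} := by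
  have key : ∀ c, c ∈ cells boxBoxHom.ker ↔ boxFactor (rep c).1 (rep c).2 = 0 := by
    intro c
    have hr := rep_nonneg c
    have h0 : nz ((repIdx c).1.1 - 2) * tCoeff (repIdx c).1.2 (repIdx c).2.1 (repIdx c).2.2 ≠ 0 :=
      nz_mul_tc_ne_zero _ (by omega)
    have hm : ShP.of (fam (repIdx c)) ∈ boxBoxHom.ker ↔ box (box (fam (repIdx c))) = 0 :=
      LieModuleHom.mem_ker
    rw [mem_cells_iff, mem_under, hm, fam, box_box_nz_mul _ (tCoeff_mem_harm _ _ _), smul_eq_zero,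
      or_iff_left h0, Int.cast_eq_zero]
    simp [repIdx, hr]
  ext c
  rw [key]
  revert c
  decide

lemma iSupIndep_span_image {ι κ M : Type*} [AddCommGroup M] [Module ℂ M] {v : κ → M}
    (hv : LinearIndependent ℂ v) (S : ι → Set κ) (hS : ∀ i j x, x ∈ S i → x ∈ S j → i = j) :
    iSupIndep fun i => Submodule.span ℂ (v '' S i) := fun i =>
  (hv.disjoint_span_image disjoint_compl_right).mono_right (iSup₂_le fun j hj =>
    Submodule.span_mono (Set.image_mono fun x hx hx' => hj (hS j i x hx hx')))

lemma iSupIndep_kSpan {ι : Type*} (P : ι → ℤ → ℤ → Prop)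
    (hP : ∀ i j k L, 0 ≤ L → P i k L → P j k L → i = j) :
    iSupIndep fun i => Sh.kSpan (P i) := by
  have hspan : ∀ i, Sh.kSpan (P i) = Submodule.span ℂ ((fun x => Sh.of (fam x)) ''
      {x : Idx | P i x.1.1 x.1.2}) := by
    intro i
    rw [Sh.kSpan, kSpan_eq_span_fam, Submodule.map_span, Set.image_image]
    rfl
  have hli : LinearIndependent ℂ fun x => Sh.of (fam x) :=
    linearIndependent_fam.map' (Sh.of : Laurent →ₗ[ℂ] Sh) Sh.of.ker
  have := iSupIndep_span_image hli (fun i => {x : Idx | P i x.1.1 x.1.2})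
    fun i j x hx hx' => hP i j _ _ (by omega) hx hx'
  rwa [← funext hspan] at this

/-! Composition series -/

lemma covBy_of_cells {W V : LieSubmodule ℂ GlHC ShP} {c : Fin 6} (hc : c ∉ cells W)
    (h : cells V = insert c (cells W)) : W ⋖ V := by
  have hlt : ∀ {A B : LieSubmodule ℂ GlHC ShP}, A < B ↔ cells A ⊂ cells B := by
    intro A B
    rw [lt_iff_le_not_ge, le_iff_cells, le_iff_cells, Finset.ssubset_def]
  have := Finset.covBy_insert hc
  refine ⟨hlt.mpr (h ▸ this.lt), fun U h1 h2 => ?_⟩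
  exact this.2 (hlt.mp h1) (h ▸ hlt.mp h2)

/-- The numbering of the cells refines the reachability order, so the smallest cell missing from a
lower set can be added alone. -/
lemma lt_of_mem_down {c d : Fin 6} (h : d ∈ down c) (hne : d ≠ c) : d < c := by
  revert c d; decide

lemma exists_cell_of_covBy {W V : LieSubmodule ℂ GlHC ShP} (h : W ⋖ V) :
    ∃ c, c ∉ cells W ∧ cells V = insert c (cells W) := by
  have hle := le_iff_cells.mp h.le
  have hne : (cells V \ cells W).Nonempty := by
    rw [Finset.sdiff_nonempty]
    exact fun hle' => h.lt.not_ge (le_iff_cells.mpr hle')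
  obtain ⟨c, hc, hmin⟩ := Finset.exists_min_image _ id hne
  rw [Finset.mem_sdiff] at hc
  -- Everything below the minimal new cell `c` is already in `W`. So `c` alone gives an intermediate
  -- invariant subspace, which must be `V`.
  have hlow : IsLowerCells (insert c (cells W)) := by
    intro d hd e he
    rcases Finset.mem_insert.mp hd with rfl | hd
    · by_cases hed : e = d
      · simp [hed]
      · refine Finset.mem_insert_of_mem (by_contra fun heW => ?_)
        have := hmin e (Finset.mem_sdiff.mpr ⟨isLowerCells_cells V _ hc.1 he, heW⟩)
        exact absurd (lt_of_mem_down he hed) (not_lt.mpr this)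
    · exact Finset.mem_insert_of_mem (isLowerCells_cells W _ hd he)
  refine ⟨c, hc.2, ?_⟩
  have h1 : W ≤ ofCells _ hlow := le_iff_cells.mpr (by
    rw [cells_ofCells]; exact Finset.subset_insert _ _)
  have h2 : ofCells _ hlow ≤ V := le_iff_cells.mpr (by
    rw [cells_ofCells]; exact Finset.insert_subset hc.1 hle)
  rcases h.eq_or_eq h1 h2 with h3 | h3
  · refine absurd ?_ hc.2
    rw [← h3, cells_ofCells]
    exact Finset.mem_insert_self _ _
  · rw [← h3, cells_ofCells]

lemma inclusionIso_of_cells {V W V' W' : LieSubmodule ℂ GlHC ShP}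
    (hinf : cells V ∩ cells W' = cells W) (hsup : cells V ∪ cells W' = cells V') :
    InclusionIso V W V' W' :=
  inclusionIso_of_inf_sup (eq_of_cells_eq (by rw [cells_inf, hinf]))
    (eq_of_cells_eq (by rw [cells_sup, hsup]))

lemma isIrreducible_of_cells {V W : LieSubmodule ℂ GlHC ShP} {c : Fin 6} (hc : c ∉ cells W)
    (h : cells V = insert c (cells W)) : LieModule.IsIrreducible ℂ GlHC (SubQuot V W) :=
  have := covBy_of_cells hc h
  (isIrreducible_subQuot_iff this.le).mpr this

/-- Each step adds one cell `c`, and every cell is added once. The set `down c` meets the cells of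
the smaller term in `down c` without `c`, so the second isomorphism theorem makes the factor depend
on `c` only. -/
lemma exists_equiv_of_compositionSeries (Vs Ws : Fin 6 → LieSubmodule ℂ GlHC ShP)
    (hV : ∀ c, cells (Vs c) = down c) (hW : ∀ c, cells (Ws c) = (down c).erase c)
    (r : ℕ) (F : Fin (r + 1) → LieSubmodule ℂ GlHC ShP) (hF : IsCompositionSeries r F) :
    ∃ e : Fin r ≃ Fin 6, ∀ i : Fin r, Nonempty (SubQuot (F i.succ) (F i.castSucc) ≃ₗ⁅ℂ, GlHC⁆
      SubQuot (Vs (e i)) (Ws (e i))) := by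
  obtain ⟨hbot, htop, hstep⟩ := hF
  have hcov : ∀ i : Fin r, F i.castSucc ⋖ F i.succ := fun i =>
    (isIrreducible_subQuot_iff (hstep i).1).mp (hstep i).2
  choose c hc hcs using fun i => exists_cell_of_covBy (hcov i)
  have hmono : Monotone F := Fin.monotone_iff_le_succ.mpr fun i => (hstep i).1
  have hinj : Function.Injective c := by
    have hlt : ∀ i j, i < j → c i ≠ c j := by
      intro i j hij h
      refine hc j (le_iff_cells.mp (hmono (Fin.succ_le_castSucc_iff.mpr hij)) ?_)
      rw [← h, hcs]
      exact Finset.mem_insert_self _ _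
    intro i j h
    rcases lt_trichotomy i j with hij | hij | hij
    · exact absurd h (hlt i j hij)
    · exact hij
    · exact absurd h.symm (hlt j i hij)
  have hsurj : Function.Surjective c := by
    intro d
    by_contra hd
    push Not at hd
    have : ∀ i, d ∉ cells (F i) := by
      intro i
      induction i using Fin.induction with
      | zero => simp [hbot, cells_bot]
      | succ i ih =>
        rw [hcs, Finset.mem_insert, not_or]
        exact ⟨(hd i).symm, ih⟩
    exact this (Fin.last r) (by simp [htop, cells_top])
  refine ⟨Equiv.ofBijective c ⟨hinj, hsurj⟩, fun i => ?_⟩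
  change Nonempty (_ ≃ₗ⁅ℂ, GlHC⁆ SubQuot (Vs (c i)) (Ws (c i)))
  have hlow := isLowerCells_cells (F i.succ)
  have hd : down (c i) ⊆ insert (c i) (cells (F i.castSucc)) := by
    have := hlow (c i) (by rw [hcs]; exact Finset.mem_insert_self _ _)
    rwa [hcs] at this
  obtain ⟨_, e, _⟩ := inclusionIso_of_cells (V := Vs (c i)) (W := Ws (c i)) (V' := F i.succ)
    (W' := F i.castSucc) (by
      rw [hV, hW]
      ext d
      rw [Finset.mem_inter, Finset.mem_erase, and_comm]
      refine and_congr_left fun hdd => ⟨fun h => ?_, fun h => ?_⟩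
      · rintro rfl
        exact hc i h
      · exact (Finset.mem_insert.mp (hd hdd)).resolve_left h) (by
      rw [hV, hcs]
      refine subset_antisymm (Finset.union_subset hd (Finset.subset_insert _ _))
        (Finset.insert_subset (Finset.mem_union_left _ (self_mem_down _))
          Finset.subset_union_right))
  exact ⟨e.symm⟩

/-- A chain of lower sets of classes, in which each step adds one class. -/
def cellChain : Fin 7 → Finset (Fin 6) :=
  ![∅, {0}, {0, 1}, {0, 1, 2}, {0, 1, 2, 3}, {0, 1, 2, 3, 4}, Finset.univ]

lemma isLowerCells_cellChain (i : Fin 7) : IsLowerCells (cellChain i) := by revert i; decide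

lemma cellChain_succ (i : Fin 6) :
    i ∉ cellChain i.castSucc ∧ cellChain i.succ = insert i (cellChain i.castSucc) := by
  revert i; decide

lemma exists_compositionSeries :
    ∃ (r : ℕ) (F : Fin (r + 1) → LieSubmodule ℂ GlHC ShP), IsCompositionSeries r F := by
  refine ⟨6, fun i => ofCells _ (isLowerCells_cellChain i), ?_, ?_, fun i => ?_⟩
  · exact eq_of_cells_eq (by rw [cells_ofCells, cells_bot]; rfl)
  · exact eq_of_cells_eq (by rw [cells_ofCells, cells_top]; rfl)
  · obtain ⟨h1, h2⟩ := cellChain_succ i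
    have h1' : i ∉ cells (ofCells _ (isLowerCells_cellChain i.castSucc)) := by
      rwa [cells_ofCells]
    have h2' : cells (ofCells _ (isLowerCells_cellChain i.succ)) =
        insert i (cells (ofCells _ (isLowerCells_cellChain i.castSucc))) := by
      rw [cells_ofCells, cells_ofCells, h2]
    exact ⟨(covBy_of_cells h1' h2').le, isIrreducible_of_cells h1' h2'⟩

/-! ### Images under homomorphisms, constants, and sums of invariant subspaces -/

section Image

variable {M N : Type} [AddCommGroup M] [Module ℂ M] [LieRingModule GlHC M] [LieModule ℂ GlHC M]
  [AddCommGroup N] [Module ℂ N] [LieRingModule GlHC N]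

/-- A homomorphism induces an isomorphism of a subquotient with its image. -/
lemma exists_subQuot_equiv_map (f : M →ₗ⁅ℂ, GlHC⁆ N) {V W : LieSubmodule ℂ GlHC M}
    (hW : V ⊓ f.ker = W) :
    ∃ e : SubQuot V W ≃ₗ⁅ℂ, GlHC⁆ V.map f, ∀ x : V, (e (SubQuot.mk V W x) : N) = f x := by
  let g : V →ₗ⁅ℂ, GlHC⁆ V.map f :=
    { ((f : M →ₗ[ℂ] N).comp V.toSubmodule.subtype).codRestrict (V.map f).toSubmodule
        (fun x => ⟨x, x.2, rfl⟩) with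
      map_lie' := fun {X x} => Subtype.ext (f.map_lie X x) }
  have hg : ∀ x, (g x : N) = f x := fun x => rfl
  obtain ⟨e, he⟩ := exists_quotient_equiv g (W.comap V.incl) (by
    intro x
    rw [LieSubmodule.mem_comap, ← hW, LieSubmodule.mem_inf, LieModuleHom.mem_ker,
      ← Subtype.coe_inj, hg]
    simp) (by
    rintro ⟨_, x, hx, rfl⟩
    exact ⟨⟨x, hx⟩, rfl⟩)
  exact ⟨e, fun x => by rw [he, hg]⟩

end Image

lemma ShP_kSpan_zero : ShP.kSpan (fun k L => k = 0 ∧ L = 0) = Submodule.span ℂ {ShP.of 1} := by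
  have h : kSpan (fun k L => k = 0 ∧ L = 0) = Submodule.span ℂ {1} := by
    unfold kSpan
    congr 1
    ext f
    constructor
    · rintro ⟨k, L, a, b, ⟨rfl, hL⟩, rfl⟩
      obtain rfl : L = 0 := by exact_mod_cast hL
      obtain rfl : a = 0 := Fin.fin_one_eq_zero a
      obtain rfl : b = 0 := Fin.fin_one_eq_zero b
      simp [tCoeff]
    · rintro rfl
      exact ⟨0, 0, 0, 0, by simp, by simp [tCoeff]⟩
  rw [ShP.kSpan, h, Submodule.map_span, Set.image_singleton]
  rfl

/-- The constants form a trivial irreducible module of dimension one. -/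
lemma span_one_properties (W : LieSubmodule ℂ GlHC ShP)
    (hW : W.toSubmodule = Submodule.span ℂ {ShP.of 1}) :
    Module.finrank ℂ W = 1 ∧ LieModule.IsTrivial GlHC W ∧ LieModule.IsIrreducible ℂ GlHC W := by
  have hone : ShP.of 1 ≠ 0 := by
    rw [Ne, LinearEquiv.map_eq_zero_iff, one_eq_tc, ← one_mul (tc 0 0 0), ← nz_zero]
    exact nz_mul_tc_ne_zero 0 le_rfl
  have hfin : Module.finrank ℂ W = 1 := by
    change Module.finrank ℂ W.toSubmodule = 1
    rw [hW]
    exact finrank_span_singleton hone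
  refine ⟨hfin, ⟨fun X x => Subtype.ext ?_⟩, ?_⟩
  · have hx : (x : ShP) ∈ W.toSubmodule := x.2
    rw [hW, Submodule.mem_span_singleton] at hx
    obtain ⟨r, hr⟩ := hx
    rw [LieSubmodule.coe_bracket, ← hr, lie_smul, lie_ShP]
    simp
  · have : Nontrivial W := Module.nontrivial_of_finrank_pos (R := ℂ) (by omega)
    have h1 : Module.Finite ℂ W := Module.finite_of_finrank_pos (by omega)
    refine LieModule.IsIrreducible.mk fun U hU => ?_
    rw [← LieSubmodule.toSubmodule_eq_top]
    refine Submodule.eq_top_of_finrank_eq (le_antisymm (Submodule.finrank_le _) ?_)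
    rw [hfin]
    exact Submodule.one_le_finrank_iff.mpr fun h => hU (by
      rwa [LieSubmodule.toSubmodule_eq_bot] at h)

/-- A lower set is the union of the principal lower sets of its elements. -/
lemma sSup_of_cells (𝒮 : Set (LieSubmodule ℂ GlHC ShP))
    (h : ∀ c, ∃ V ∈ 𝒮, cells V = down c) (W : LieSubmodule ℂ GlHC ShP) (hW : W ≠ ⊥) :
    ∃ T ⊆ 𝒮, T.Nonempty ∧ W = sSup T := by
  have hc : ∀ c ∈ cells W, ∃ V ∈ 𝒮, V ≤ W ∧ c ∈ cells V := by
    intro c hc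
    obtain ⟨V, hV, hVc⟩ := h c
    exact ⟨V, hV, le_iff_cells.mpr (hVc ▸ isLowerCells_cells W c hc), hVc ▸ self_mem_down c⟩
  refine ⟨{V ∈ 𝒮 | V ≤ W}, Set.sep_subset _ _, ?_, ?_⟩
  · obtain ⟨c, hcW⟩ : (cells W).Nonempty := by
      rw [Finset.nonempty_iff_ne_empty, ← cells_bot]
      exact fun h => hW (eq_of_cells_eq h)
    obtain ⟨V, hV, hVW, -⟩ := hc c hcW
    exact ⟨V, hV, hVW⟩
  · refine le_antisymm (le_iff_cells.mpr fun c hcW => ?_) (sSup_le fun V hV => hV.2)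
    obtain ⟨V, hV, hVW, hcV⟩ := hc c hcW
    exact le_iff_cells.mp (le_sSup (show V ∈ {V ∈ 𝒮 | V ≤ W} from ⟨hV, hVW⟩)) hcV

end

end QuatConf

theorem mainTheorem6 :
    -- the listed spans are invariant subspaces of `(ρ', Ш')`
    ∃ I₀ BHp BHm Shp Shm Ip Im J : LieSubmodule ℂ GlHC ShP,
      I₀.toSubmodule = ShP.kSpan (fun k L => k = 0 ∧ L = 0) ∧
      BHp.toSubmodule = ShP.kSpan (fun k _ => 0 ≤ k ∧ k ≤ 1) ∧
      BHm.toSubmodule = ShP.kSpan (fun k L => -1 ≤ L + k ∧ L + k ≤ 0) ∧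
      Shp.toSubmodule = ShP.kSpan (fun k _ => 0 ≤ k) ∧
      Shm.toSubmodule = ShP.kSpan (fun k L => k ≤ -L) ∧
      Ip.toSubmodule = ShP.kSpan (fun k L => -(L + 1) ≤ k) ∧
      Im.toSubmodule = ShP.kSpan (fun k _ => k ≤ 1) ∧
      J.toSubmodule = ShP.kSpan (fun k L => -(L + 1) ≤ k ∧ k ≤ 1) ∧
      -- `I₀` is the space of constants, with the trivial action
      I₀.toSubmodule = Submodule.span ℂ {ShP.of 1} ∧
      Module.finrank ℂ I₀ = 1 ∧ LieModule.IsTrivial GlHC I₀ ∧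
      -- they are proper, and the proper invariant subspaces are exactly their sums
      (∀ W ∈ ({I₀, BHp, BHm, Shp, Shm, Ip, Im, J} : Set (LieSubmodule ℂ GlHC ShP)),
        W ≠ ⊥ ∧ W ≠ ⊤) ∧
      (∀ W : LieSubmodule ℂ GlHC ShP, W ≠ ⊥ → W ≠ ⊤ →
        ∃ T ⊆ ({I₀, BHp, BHm, Shp, Shm, Ip, Im, J} : Set (LieSubmodule ℂ GlHC ShP)),
          T.Nonempty ∧ W = sSup T) ∧
      -- the subspaces by which one takes quotients are contained in the respective spaces
      I₀ ≤ BHp ∧ I₀ ≤ BHm ∧ BHp ≤ Shp ∧ BHm ≤ Shm ∧ BHp ⊔ BHm ≤ J ∧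
      Shp ⊔ BHm ≤ Ip ∧ Shm ⊔ BHp ≤ Im ∧
      -- irreducibility
      LieModule.IsIrreducible ℂ GlHC I₀ ∧
      LieModule.IsIrreducible ℂ GlHC (SubQuot BHp I₀) ∧
      LieModule.IsIrreducible ℂ GlHC (SubQuot BHm I₀) ∧
      LieModule.IsIrreducible ℂ GlHC (SubQuot Shp BHp) ∧
      LieModule.IsIrreducible ℂ GlHC (SubQuot Shm BHm) ∧
      LieModule.IsIrreducible ℂ GlHC (SubQuot J (BHp ⊔ BHm)) ∧
      -- identifications between quotients
      InclusionIso Shp BHp ⊤ Im ∧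
      InclusionIso Shm BHm ⊤ Ip ∧
      InclusionIso J (BHp ⊔ BHm) Ip (Shp ⊔ BHm) ∧
      InclusionIso J (BHp ⊔ BHm) Im (Shm ⊔ BHp) ∧
      InclusionIso J (BHp ⊔ BHm) ⊤ (Shp ⊔ Shm) ∧
      -- these six are the irreducible components: there are composition series, and the factors
      -- of each of them are the six modules above, each occurring exactly once
      (∃ (r : ℕ) (F : Fin (r + 1) → LieSubmodule ℂ GlHC ShP), IsCompositionSeries r F) ∧
      (∀ (r : ℕ) (F : Fin (r + 1) → LieSubmodule ℂ GlHC ShP), IsCompositionSeries r F →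
        ∃ e : Fin r ≃ Fin 6, ∀ i : Fin r,
          Nonempty (SubQuot (F i.succ) (F i.castSucc) ≃ₗ⁅ℂ, GlHC⁆
            SubQuot ((![I₀, BHp, BHm, Shp, Shm, J] : Fin 6 → _) (e i))
              ((![⊥, I₀, I₀, BHp, BHm, BHp ⊔ BHm] : Fin 6 → _) (e i)))) ∧
      -- the image of `□ ∘ □ : (ρ', Ш') → (ρ, Ш)`, and the isomorphisms it induces
      (∀ (X : GlHC) (f : ShP), boxBox ⁅X, f⁆ = ⁅X, boxBox f⁆) ∧
      ∃ Sp Sm K : LieSubmodule ℂ GlHC Sh,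
        Sp.toSubmodule = Sh.kSpan (fun k _ => 0 ≤ k) ∧
        Sm.toSubmodule = Sh.kSpan (fun k L => k ≤ -(L + 4)) ∧
        K.toSubmodule = Sh.kSpan (fun k L => -(L + 1) ≤ k ∧ k ≤ -3) ∧
        LinearMap.range boxBox = Sp.toSubmodule ⊔ K.toSubmodule ⊔ Sm.toSubmodule ∧
        iSupIndep ![Sp.toSubmodule, K.toSubmodule, Sm.toSubmodule] ∧
        (∃ e : SubQuot Shp BHp ≃ₗ⁅ℂ, GlHC⁆ Sp,
          ∀ x : Shp, (e (SubQuot.mk Shp BHp x) : Sh) = boxBox x) ∧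
        (∃ e : SubQuot J (BHp ⊔ BHm) ≃ₗ⁅ℂ, GlHC⁆ K,
          ∀ x : J, (e (SubQuot.mk J (BHp ⊔ BHm) x) : Sh) = boxBox x) ∧
        (∃ e : SubQuot Shm BHm ≃ₗ⁅ℂ, GlHC⁆ Sm,
          ∀ x : Shm, (e (SubQuot.mk Shm BHm x) : Sh) = boxBox x) := by
  -- The first six sets are the principal lower sets `down c`; `lp` and `lm` omit only cell `4` and
  -- cell `3`.
  have l0 : IsLowerCells {0} := by decide
  have l1 : IsLowerCells {0, 1} := by decide
  have l2 : IsLowerCells {0, 2} := by decide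
  have l3 : IsLowerCells {0, 1, 3} := by decide
  have l4 : IsLowerCells {0, 2, 4} := by decide
  have l5 : IsLowerCells {0, 1, 2, 5} := by decide
  have lp : IsLowerCells {0, 1, 2, 3, 5} := by decide
  have lm : IsLowerCells {0, 1, 2, 4, 5} := by decide
  have t0 : (ofCells _ l0).toSubmodule = ShP.kSpan (fun k L => k = 0 ∧ L = 0) :=
    ofCells_toSubmodule _ _ fun k L hL => by unfold cell; split_ifs <;> simp <;> omega
  have t1 : (ofCells _ l1).toSubmodule = ShP.kSpan (fun k _ => 0 ≤ k ∧ k ≤ 1) :=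
    ofCells_toSubmodule _ _ fun k L hL => by unfold cell; split_ifs <;> simp <;> omega
  have t2 : (ofCells _ l2).toSubmodule = ShP.kSpan (fun k L => -1 ≤ L + k ∧ L + k ≤ 0) :=
    ofCells_toSubmodule _ _ fun k L hL => by unfold cell; split_ifs <;> simp <;> omega
  have t3 : (ofCells _ l3).toSubmodule = ShP.kSpan (fun k _ => 0 ≤ k) :=
    ofCells_toSubmodule _ _ fun k L hL => by unfold cell; split_ifs <;> simp <;> omega
  have t4 : (ofCells _ l4).toSubmodule = ShP.kSpan (fun k L => k ≤ -L) :=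
    ofCells_toSubmodule _ _ fun k L hL => by unfold cell; split_ifs <;> simp <;> omega
  have t5 : (ofCells _ l5).toSubmodule = ShP.kSpan (fun k L => -(L + 1) ≤ k ∧ k ≤ 1) :=
    ofCells_toSubmodule _ _ fun k L hL => by unfold cell; split_ifs <;> simp <;> omega
  have tp : (ofCells _ lp).toSubmodule = ShP.kSpan (fun k L => -(L + 1) ≤ k) :=
    ofCells_toSubmodule _ _ fun k L hL => by unfold cell; split_ifs <;> simp <;> omega
  have tm : (ofCells _ lm).toSubmodule = ShP.kSpan (fun k _ => k ≤ 1) :=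
    ofCells_toSubmodule _ _ fun k L hL => by unfold cell; split_ifs <;> simp <;> omega
  have c0 := cells_ofCells _ l0
  have c1 := cells_ofCells _ l1
  have c2 := cells_ofCells _ l2
  have c3 := cells_ofCells _ l3
  have c4 := cells_ofCells _ l4
  have c5 := cells_ofCells _ l5
  have hone : (ofCells _ l0).toSubmodule = Submodule.span ℂ {ShP.of 1} :=
    t0.trans ShP_kSpan_zero
  obtain ⟨hfin, htriv, hirr0⟩ := span_one_properties _ hone
  have s12 : cells (ofCells _ l1 ⊔ ofCells _ l2) = {0, 1, 2} := by
    rw [cells_sup, c1, c2]; decide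
  have b1 : (ofCells _ l3 ⊓ boxBoxHom.ker) = ofCells _ l1 := eq_of_cells_eq (by
    rw [cells_inf, cells_ker_boxBoxHom, c1, c3]; decide)
  have b2 : (ofCells _ l5 ⊓ boxBoxHom.ker) = ofCells _ l1 ⊔ ofCells _ l2 := eq_of_cells_eq (by
    rw [cells_inf, cells_ker_boxBoxHom, s12, c5]; decide)
  have b3 : (ofCells _ l4 ⊓ boxBoxHom.ker) = ofCells _ l2 := eq_of_cells_eq (by
    rw [cells_inf, cells_ker_boxBoxHom, c2, c4]; decide)
  have hz : ∀ k L : ℤ, boxFactor k L = 0 ↔ k = 0 ∨ k = 1 ∨ k + L = 0 ∨ k + L = -1 := by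
    intro k L
    simp only [boxFactor, mul_eq_zero]
    omega
  have m1 : ((ofCells _ l3).map boxBoxHom).toSubmodule = Sh.kSpan (fun k _ => 0 ≤ k) :=
    map_boxBoxHom_toSubmodule t3 (fun k L hL h => by rw [hz]; omega)
      (fun k L hL h => by rw [Ne, hz]; omega)
  -- Only cell `5`, given by `k ≤ -1` and `k + L ≥ 1`, survives, and it is shifted by `k ↦ k - 2`.
  have m2 : ((ofCells _ l5).map boxBoxHom).toSubmodule =
      Sh.kSpan (fun k L => -(L + 1) ≤ k ∧ k ≤ -3) :=
    map_boxBoxHom_toSubmodule t5 (fun k L hL h => by rw [hz]; omega)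
      (fun k L hL h => by rw [Ne, hz]; omega)
  have m3 : ((ofCells _ l4).map boxBoxHom).toSubmodule = Sh.kSpan (fun k L => k ≤ -(L + 4)) :=
    map_boxBoxHom_toSubmodule t4 (fun k L hL h => by rw [hz]; omega)
      (fun k L hL h => by rw [Ne, hz]; omega)
  -- These three subspaces exhaust all cells, so their images add up to the whole image of `□ ∘ □`.
  have htop : ofCells _ l3 ⊔ ofCells _ l5 ⊔ ofCells _ l4 = ⊤ := eq_of_cells_eq (by
    rw [cells_sup, cells_sup, c3, c4, c5, cells_top]; decide)
  refine ⟨ofCells _ l0, ofCells _ l1, ofCells _ l2, ofCells _ l3, ofCells _ l4, ofCells _ lp,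
    ofCells _ lm, ofCells _ l5, t0, t1, t2, t3, t4, tp, tm, t5, hone, hfin, htriv, ?_,
    fun W hW _ => sSup_of_cells _ (fun c => ?_) W hW, ?_, ?_, ?_, ?_, ?_, ?_, ?_, hirr0,
    isIrreducible_of_cells (c := 1) ?_ ?_, isIrreducible_of_cells (c := 2) ?_ ?_,
    isIrreducible_of_cells (c := 3) ?_ ?_, isIrreducible_of_cells (c := 4) ?_ ?_,
    isIrreducible_of_cells (c := 5) ?_ ?_, inclusionIso_of_cells ?_ ?_,
    inclusionIso_of_cells ?_ ?_, inclusionIso_of_cells ?_ ?_, inclusionIso_of_cells ?_ ?_,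
    inclusionIso_of_cells ?_ ?_, exists_compositionSeries,
    exists_equiv_of_compositionSeries _ _ (fun c => ?_) (fun c => ?_), boxBox_lie,
    (ofCells _ l3).map boxBoxHom, (ofCells _ l4).map boxBoxHom, (ofCells _ l5).map boxBoxHom,
    m1, m3, m2, ?_, ?_, exists_subQuot_equiv_map boxBoxHom b1,
    exists_subQuot_equiv_map boxBoxHom b2, exists_subQuot_equiv_map boxBoxHom b3⟩
  · intro W hW
    simp only [Set.mem_insert_iff, Set.mem_singleton_iff] at hW
    have key : ∀ s hs, s ≠ ∅ → s ≠ Finset.univ → ofCells s hs ≠ ⊥ ∧ ofCells s hs ≠ ⊤ := by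
      intro s hs h1 h2
      rw [← cells_ofCells s hs] at h1 h2
      exact ⟨fun h => h1 (h ▸ cells_bot), fun h => h2 (h ▸ cells_top)⟩
    rcases hW with rfl | rfl | rfl | rfl | rfl | rfl | rfl | rfl <;>
      exact key _ _ (by decide) (by decide)
  · fin_cases c
    exacts [⟨_, by simp, c0⟩, ⟨_, by simp, c1⟩, ⟨_, by simp, c2⟩, ⟨_, by simp, c3⟩,
      ⟨_, by simp, c4⟩, ⟨_, by simp, c5⟩]
  -- The seven inclusions.
  iterate 7
    rw [le_iff_cells]
    simp only [cells_sup, cells_ofCells]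
    decide
  -- Two conditions on cells for each of the five irreducible quotients and the five isomorphisms.
  iterate 20
    simp only [cells_sup, cells_ofCells, cells_top]
    decide
  · fin_cases c
    exacts [c0, c1, c2, c3, c4, c5]
  · fin_cases c
    exacts [cells_bot, c0, c0, c1, c2, s12]
  · rw [← LieSubmodule.sup_toSubmodule, ← LieSubmodule.sup_toSubmodule, ← LieSubmodule.map_sup,
      ← LieSubmodule.map_sup, htop, LieSubmodule.toSubmodule_map, LieSubmodule.top_toSubmodule,
      Submodule.map_top]
    rfl
  · rw [m1, m2, m3]
    have := iSupIndep_kSpan ![fun k _ => 0 ≤ k, fun k L => -(L + 1) ≤ k ∧ k ≤ -3,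
      fun k L => k ≤ -(L + 4)] (by
        intro i j k L hL
        fin_cases i <;> fin_cases j <;> simp <;> omega)
    convert this using 1
    ext i
    fin_cases i <;> rfl
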